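/- Let $N\ge 1$, $s\in(0,1)$, let $\Omega\subset\mathbb R^N$ be a bounded strictly convex $C^2$-domain (nonempty, open, convex, with strictly convex closure and $C^2$ boundary), and let $g:\mathbb R^N\setminus\Omega\to\mathbb R$ be continuous and bounded. For $f\in L_s(\mathbb R)=\{f\in L^1_{loc}(\mathbb R):\int_{\mathbb R}|f(r)|(1+|r|)^{-1-2s}\,dr<\infty\}$, locally bounded, "the solution $v$ of $\Delta_1^s v=0$ in $(0,1)$, $v=f$ in $\mathbb R\setminus(0,1)$" means the function $v$ that equals $f$ outside $(0,1)$, is bounded on $(0,1)$ and satisfies $\Delta^s_1v(t):=\mathrm{p.v.}\!\int_{\mathbb R}\frac{v(r)-v(t)}{|r-t|^{1+2s}}\,dr=0$ in $(0,1)$ in the viscosity sense: whenever $I\subset(0,1)$ is an open interval, $t_0\in I$, $\phi\in C^2(\mathbb R)$, and $\phi$ touches the upper (lower) semicontinuous envelope $\bar v$ of $v$ from above (below) on $I$ at $t_0$, then the function equal to $\phi$ in $I$, to $\bar v$ in $(0,1)\setminus I$ and to $f$ outside $(0,1)$ has $\Delta_1^s\ge 0$ ($\le0$) at $t_0$. Let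 $\mathcal L_s$ be the set of measurable locally bounded $u:\mathbb R^N\to\mathbb R$ such that $t\mapsto u(x+tz)$ belongs to $L_s(\mathbb R)$ for all $x\in\Omega$, $|z|=1$. A function $u\in\mathcal L_s$ is $s$-convex in $\overline\Omega$ if for all $x\ne y$ in $\overline\Omega$ such that the open segment between $x$ and $y$ is contained in $\overline\Omega$ one has $u(tx+(1-t)y)\le v(t)$ for every $t\in(0,1)$, where $v$ is the solution with exterior datum $f(t)=u(tx+(1-t)y)$. Let $H(g)$ be the set of $w\in\mathcal L_s$ that are $s$-convex in $\overline\Omega$ and satisfy $w\le g$ in $\mathbb R^N\setminus\Omega$. The $s$-convex envelope of $g$ is $u^*(x)=\sup\{w(x):w\in H(g)\}$, $x\in\mathbb R^N$. Then: 1. $u^*$ is well defined: the supremum is finite at every $x\in\mathbb R^N$, and $u^*$ itself belongs to $H(g)$ (in particular $H(g)\neq\emptyset$). 2. $u^*$ is continuous in $\overline\Omega$ and $u^*=g$ on $\partial\Omega$. 3. $u^*=g$ in $\mathbb R^N\setminus\Omega$, and $u^*$ is the unique viscosity solution of $$\Lambda_1^su(x):=\inf_{z\in\mathbb S^{N-1}}\int_{\mathbb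 R}\frac{u(x+tz)-u(x)}{|t|^{1+2s}}\,dt=0\ \text{ in }\Omega,\qquad u=g\ \text{ in }\mathbb R^N\setminus\Omega .$$ Here a bounded function $u:\mathbb R^N\to\mathbb R$ is a viscosity solution if its upper (lower) semicontinuous envelope on $\mathbb R^N$ is a viscosity subsolution (supersolution). For a bounded function $w$, $\delta>0$ and $\phi\in C^2(\mathbb R^N)$ put $$E_\delta(w,\phi,x)=-\inf_{z\in\mathbb S^{N-1}}\Big\{\mathrm{p.v.}\!\int_{-\delta}^{\delta}\frac{\phi(x+tz)-\phi(x)}{|t|^{1+2s}}\,dt+\int_{|t|\ge\delta}\frac{w(x+tz)-w(x)}{|t|^{1+2s}}\,dt\Big\}.$$ Let $u^g$ (resp. $u_g$) equal $u$ in $\Omega$, $g$ in $\mathbb R^N\setminus\overline\Omega$, and $\max\{u,g\}$ (resp. $\min\{u,g\}$) on $\partial\Omega$. A bounded upper semicontinuous $u$ is a viscosity subsolution if $u\le g$ in $\mathbb R^N\setminus\overline\Omega$ and, for all $\delta>0$ and $\phi\in C^2(\mathbb R^N)$ such that $x_0$ is a maximum point of $u-\phi$ in $B_\delta(x_0)$,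 one has $E_\delta(u^g,\phi,x_0)\le0$ if $x_0\in\Omega$ and $\min\{E_\delta(u^g,\phi,x_0),u(x_0)-g(x_0)\}\le0$ if $x_0\in\partial\Omega$. A bounded lower semicontinuous $u$ is a viscosity supersolution if $u\ge g$ in $\mathbb R^N\setminus\overline\Omega$ and, for all $\delta>0$ and $\phi\in C^2(\mathbb R^N)$ such that $x_0$ is a minimum point of $u-\phi$ in $B_\delta(x_0)$, one has $E_\delta(u_g,\phi,x_0)\ge0$ if $x_0\in\Omega$ and $\max\{E_\delta(u_g,\phi,x_0),u(x_0)-g(x_0)\}\ge0$ if $x_0\in\partial\Omega$. -/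

import Mathlib

open Set Filter Topology MeasureTheory

noncomputable section

namespace FracConvex

/-! ### Semicontinuous envelopes

For a locally bounded `w`, `inf_{r>0} sup_{B(x,r)} w` is the `limsup` of `w` along the full
neighbourhood filter `𝓝 x` (the point `x` included), and dually for the lower envelope. -/

/-- Upper semicontinuous envelope of a locally bounded function. -/
def upperEnv {X : Type*} [TopologicalSpace X] (w : X → ℝ) (x : X) : ℝ := limsup w (𝓝 x)

/-- Lower semicontinuous envelope of a locally bounded function. -/
def lowerEnv {X : Type*} [TopologicalSpace X] (w : X → ℝ) (x : X) : ℝ := liminf w (𝓝 x)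

/-! ### The one-dimensional fractional Laplacian and its Dirichlet problem on `(0, 1)` -/

/-- One-dimensional `s`-fractional Laplacian (without the normalising constant)
`p.v. ∫ (ψ r - ψ t) / |r - t| ^ (1 + 2 s) dr`. The principal value is written through symmetric
second differences, which are absolutely integrable near `0` when `ψ` is `C²` near `t`. -/
def fracLap (s : ℝ) (ψ : ℝ → ℝ) (t : ℝ) : ℝ :=
  ∫ r in Ioi (0 : ℝ), (ψ (t + r) + ψ (t - r) - 2 * ψ t) / r ^ (1 + 2 * s)

open Classical in
/-- `v` is a (bounded on `(0, 1)`) viscosity solution of `Δ₁ˢ v = 0` in `(0, 1)`,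
`v = f` in `ℝ \ (0, 1)`. Test functions touch the semicontinuous envelopes of `v` on an open
interval `(a, b) ⊆ (0, 1)`; outside that interval the operator sees the envelope of `v` in the
rest of `(0, 1)`, and the datum outside `(0, 1)`. -/
structure IsDirichletSol (s : ℝ) (f v : ℝ → ℝ) : Prop where
  bounded : ∃ M : ℝ, ∀ t ∈ Ioo (0 : ℝ) 1, |v t| ≤ M
  datum : ∀ t ∉ Ioo (0 : ℝ) 1, v t = f t
  sub : ∀ (a b t₀ : ℝ) (φ : ℝ → ℝ), Ioo a b ⊆ Ioo 0 1 → t₀ ∈ Ioo a b → ContDiff ℝ 2 φ →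
    φ t₀ = upperEnv v t₀ → (∀ t ∈ Ioo a b, upperEnv v t ≤ φ t) →
    0 ≤ fracLap s ((Ioo a b).piecewise φ ((Ioo (0 : ℝ) 1).piecewise (upperEnv v) f)) t₀
  super : ∀ (a b t₀ : ℝ) (φ : ℝ → ℝ), Ioo a b ⊆ Ioo 0 1 → t₀ ∈ Ioo a b → ContDiff ℝ 2 φ →
    φ t₀ = lowerEnv v t₀ → (∀ t ∈ Ioo a b, φ t ≤ lowerEnv v t) →
    fracLap s ((Ioo a b).piecewise φ ((Ioo (0 : ℝ) 1).piecewise (lowerEnv v) f)) t₀ ≤ 0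

/-! ### `s`-convexity and the `s`-convex envelope -/

/-- The weighted space `L_s(ℝ)`. -/
def MemLs (s : ℝ) (f : ℝ → ℝ) : Prop :=
  LocallyIntegrable f ∧ Integrable (fun r : ℝ => |f r| / (1 + |r|) ^ (1 + 2 * s))

variable {N : ℕ}

/-- The space `𝓛_s(ℝᴺ)`: measurable, locally bounded functions whose restriction to every line
meeting `Ω` belongs to `L_s(ℝ)`. -/
structure MemLineLs (s : ℝ) (Ω : Set (EuclideanSpace ℝ (Fin N)))
    (u : EuclideanSpace ℝ (Fin N) → ℝ) : Prop where
  measurable : AEStronglyMeasurable u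
  locallyBounded : ∀ R : ℝ, ∃ M : ℝ, ∀ x, ‖x‖ ≤ R → |u x| ≤ M
  lines : ∀ x ∈ Ω, ∀ z : EuclideanSpace ℝ (Fin N), ‖z‖ = 1 → MemLs s (fun t : ℝ => u (x + t • z))

/-- The segment condition of `s`-convexity in `A`: on each segment `(x, y)` contained in `A`, `u`
lies below the solution of the one-dimensional fractional Dirichlet problem whose exterior datum
is `u` on the rest of the line. -/
def SConvexOn (s : ℝ) (A : Set (EuclideanSpace ℝ (Fin N)))
    (u : EuclideanSpace ℝ (Fin N) → ℝ) : Prop :=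
  ∀ x ∈ A, ∀ y ∈ A, x ≠ y → openSegment ℝ x y ⊆ A →
    ∃ v : ℝ → ℝ, IsDirichletSol s (fun t : ℝ => u (t • x + (1 - t) • y)) v ∧
      ∀ t ∈ Ioo (0 : ℝ) 1, u (t • x + (1 - t) • y) ≤ v t

/-- The class `H(g)` of functions that are `s`-convex in the closure of `Ω` and lie below `g`
outside `Ω`. -/
def belowDatum (s : ℝ) (Ω : Set (EuclideanSpace ℝ (Fin N)))
    (g : EuclideanSpace ℝ (Fin N) → ℝ) : Set (EuclideanSpace ℝ (Fin N) → ℝ) :=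
  {w | MemLineLs s Ω w ∧ SConvexOn s (closure Ω) w ∧ ∀ x ∉ Ω, w x ≤ g x}

/-- The `s`-convex envelope of `g`: the pointwise supremum of the class `H(g)`. -/
def sConvexEnvelope (s : ℝ) (Ω : Set (EuclideanSpace ℝ (Fin N)))
    (g : EuclideanSpace ℝ (Fin N) → ℝ) (x : EuclideanSpace ℝ (Fin N)) : ℝ :=
  sSup ((fun w : EuclideanSpace ℝ (Fin N) → ℝ => w x) '' belowDatum s Ω g)

/-! ### Viscosity solutions of `Λ₁ˢ u = 0` in `Ω`, `u = g` outside `Ω` -/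

open Classical in
/-- Upper `g`-extension of `u` (for open `Ω`). -/
def upperExt (Ω : Set (EuclideanSpace ℝ (Fin N))) (g u : EuclideanSpace ℝ (Fin N) → ℝ)
    (x : EuclideanSpace ℝ (Fin N)) : ℝ :=
  if x ∈ Ω then u x else if x ∈ frontier Ω then max (u x) (g x) else g x

open Classical in
/-- Lower `g`-extension of `u` (for open `Ω`). -/
def lowerExt (Ω : Set (EuclideanSpace ℝ (Fin N))) (g u : EuclideanSpace ℝ (Fin N) → ℝ)
    (x : EuclideanSpace ℝ (Fin N)) : ℝ :=
  if x ∈ Ω then u x else if x ∈ frontier Ω then min (u x) (g x) else g x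

/-- `p.v. ∫_{-δ}^{δ} (φ (x + t z) - φ x) / |t| ^ (1 + 2 s) dt` for a `C²` function `φ`, written
through symmetric second differences. -/
def innerPart (s δ : ℝ) (φ : EuclideanSpace ℝ (Fin N) → ℝ) (x z : EuclideanSpace ℝ (Fin N)) : ℝ :=
  ∫ t in Ioo (0 : ℝ) δ, (φ (x + t • z) + φ (x - t • z) - 2 * φ x) / t ^ (1 + 2 * s)

/-- `∫_{|t| ≥ δ} (w (x + t z) - w x) / |t| ^ (1 + 2 s) dt`. -/
def outerPart (s δ : ℝ) (w : EuclideanSpace ℝ (Fin N) → ℝ) (x z : EuclideanSpace ℝ (Fin N)) : ℝ :=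
  ∫ t in {t : ℝ | δ ≤ |t|}, (w (x + t • z) - w x) / |t| ^ (1 + 2 * s)

/-- `E_δ(w, φ, x) = - inf_{z ∈ S^{N-1}} (I¹_{z,δ}(φ, x) + I²_{z,δ}(w, x))`. -/
def evalE (s δ : ℝ) (w φ : EuclideanSpace ℝ (Fin N) → ℝ) (x : EuclideanSpace ℝ (Fin N)) : ℝ :=
  -⨅ z : Metric.sphere (0 : EuclideanSpace ℝ (Fin N)) 1,
    (innerPart s δ φ x (z : EuclideanSpace ℝ (Fin N)) +
      outerPart s δ w x (z : EuclideanSpace ℝ (Fin N)))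

/-- Bounded upper semicontinuous viscosity subsolutions. -/
structure IsViscositySub (s : ℝ) (Ω : Set (EuclideanSpace ℝ (Fin N)))
    (g u : EuclideanSpace ℝ (Fin N) → ℝ) : Prop where
  bounded : ∃ M : ℝ, ∀ x, |u x| ≤ M
  usc : UpperSemicontinuous u
  exterior : ∀ x ∉ closure Ω, u x ≤ g x
  interior_test : ∀ (δ : ℝ) (φ : EuclideanSpace ℝ (Fin N) → ℝ), 0 < δ → ContDiff ℝ 2 φ →
    ∀ x₀ ∈ Ω, IsMaxOn (fun x => u x - φ x) (Metric.ball x₀ δ) x₀ →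
      evalE s δ (upperExt Ω g u) φ x₀ ≤ 0
  boundary_test : ∀ (δ : ℝ) (φ : EuclideanSpace ℝ (Fin N) → ℝ), 0 < δ → ContDiff ℝ 2 φ →
    ∀ x₀ ∈ frontier Ω, IsMaxOn (fun x => u x - φ x) (Metric.ball x₀ δ) x₀ →
      min (evalE s δ (upperExt Ω g u) φ x₀) (u x₀ - g x₀) ≤ 0

/-- Bounded lower semicontinuous viscosity supersolutions. -/
structure IsViscositySuper (s : ℝ) (Ω : Set (EuclideanSpace ℝ (Fin N)))
    (g u : EuclideanSpace ℝ (Fin N) → ℝ) : Prop where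
  bounded : ∃ M : ℝ, ∀ x, |u x| ≤ M
  lsc : LowerSemicontinuous u
  exterior : ∀ x ∉ closure Ω, g x ≤ u x
  interior_test : ∀ (δ : ℝ) (φ : EuclideanSpace ℝ (Fin N) → ℝ), 0 < δ → ContDiff ℝ 2 φ →
    ∀ x₀ ∈ Ω, IsMinOn (fun x => u x - φ x) (Metric.ball x₀ δ) x₀ →
      0 ≤ evalE s δ (lowerExt Ω g u) φ x₀
  boundary_test : ∀ (δ : ℝ) (φ : EuclideanSpace ℝ (Fin N) → ℝ), 0 < δ → ContDiff ℝ 2 φ →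
    ∀ x₀ ∈ frontier Ω, IsMinOn (fun x => u x - φ x) (Metric.ball x₀ δ) x₀ →
      0 ≤ max (evalE s δ (lowerExt Ω g u) φ x₀) (u x₀ - g x₀)

/-- Viscosity solutions of `Λ₁ˢ u = 0` in `Ω`, `u = g` outside `Ω`: bounded functions whose upper
(lower) semicontinuous envelope is a subsolution (supersolution). -/
structure IsViscositySol (s : ℝ) (Ω : Set (EuclideanSpace ℝ (Fin N)))
    (g u : EuclideanSpace ℝ (Fin N) → ℝ) : Prop where
  bounded : ∃ M : ℝ, ∀ x, |u x| ≤ M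
  sub : IsViscositySub s Ω g (upperEnv u)
  super : IsViscositySuper s Ω g (lowerEnv u)

/-! ### Domains -/

/-- The boundary of `Ω` is of class `C²`: near each boundary point, `Ω` is the strict sublevel set
of a `C²` function with nonvanishing differential. -/
def HasC2Boundary (Ω : Set (EuclideanSpace ℝ (Fin N))) : Prop :=
  ∀ x ∈ frontier Ω, ∃ (U : Set (EuclideanSpace ℝ (Fin N))) (ρ : EuclideanSpace ℝ (Fin N) → ℝ),
    IsOpen U ∧ x ∈ U ∧ ContDiffOn ℝ 2 ρ U ∧ (∀ y ∈ U, fderiv ℝ ρ y ≠ 0) ∧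
      Ω ∩ U = {y ∈ U | ρ y < 0}

/-- Bounded strictly convex `C²`-domains. Strict convexity is required of the closure: no boundary
point is interior to a segment of the closure (for an open set, Mathlib's `StrictConvex` is mere
convexity). -/
structure IsStrictlyConvexC2Domain (Ω : Set (EuclideanSpace ℝ (Fin N))) : Prop where
  isOpen : IsOpen Ω
  nonempty : Ω.Nonempty
  bounded : Bornology.IsBounded Ω
  convex : Convex ℝ Ω
  strictConvex : StrictConvex ℝ (closure Ω)
  boundary : HasC2Boundary Ω

end FracConvex

end

open FracConvex

/-!
Perron's method produces the largest subsolution `W` with `W = g` outside `Ω`, whose lower envelope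
is a supersolution. At a boundary point a subsolution cannot jump above `g`: by strict convexity a
thin slab along a supporting hyperplane cuts off only a small piece of `Ω`, every line through a
point of that piece leaves it quickly in one of the two senses, and a test function growing steeply
across the slab violates the subsolution inequality in every direction. Comparison, proved by
doubling of variables, then makes `W` continuous.

Doubling the variables along an affine map `ℝ → ℝᴺ` also compares `W` on a chord with the
one-dimensional Dirichlet solution, so `W` is `s`-convex. Conversely the upper envelope of an
`s`-convex function below `g` is a subsolution and lies below `W`. Therefore `u* = W`, and
uniqueness is comparison applied to the upper and lower `g`-extensions.
-/

namespace FracConvex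

/-! ### The kernel measure on the half-line -/

/-- The measure `t ^ (-(1 + 2 s)) dt` on the positive half-line: integrating second differences
against it gives the one-dimensional fractional Laplacian. -/
noncomputable def kernelMeasure (s : ℝ) : Measure ℝ :=
  (volume.restrict (Ioi (0 : ℝ))).withDensity (fun t => ENNReal.ofReal (t ^ (-(1 + 2 * s))))

lemma measurable_kernelDensity (s : ℝ) :
    Measurable (fun t : ℝ => ENNReal.ofReal (t ^ (-(1 + 2 * s)))) := by fun_prop

lemma kernelMeasure_absolutelyContinuous (s : ℝ) :
    kernelMeasure s ≪ volume.restrict (Ioi (0 : ℝ)) :=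
  withDensity_absolutelyContinuous _ _

lemma ae_kernelMeasure_pos (s : ℝ) : ∀ᵐ t ∂kernelMeasure s, 0 < t :=
  (kernelMeasure_absolutelyContinuous s).ae_le (ae_restrict_mem measurableSet_Ioi)

lemma integral_kernelMeasure (s : ℝ) (F : ℝ → ℝ) :
    ∫ t, F t ∂kernelMeasure s = ∫ t in Ioi (0 : ℝ), F t / t ^ (1 + 2 * s) := by
  rw [kernelMeasure, integral_withDensity_eq_integral_toReal_smul (measurable_kernelDensity s)
    (Eventually.of_forall fun _ => ENNReal.ofReal_lt_top)]
  refine setIntegral_congr_fun measurableSet_Ioi fun t (ht : 0 < t) => ?_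
  simp only [smul_eq_mul]
  rw [ENNReal.toReal_ofReal (by positivity), Real.rpow_neg ht.le]
  field_simp

lemma integrable_kernelMeasure_iff (s : ℝ) (F : ℝ → ℝ) :
    Integrable F (kernelMeasure s) ↔
      IntegrableOn (fun t => F t / t ^ (1 + 2 * s)) (Ioi (0 : ℝ)) := by
  rw [kernelMeasure, integrable_withDensity_iff_integrable_smul' (measurable_kernelDensity s)
    (Eventually.of_forall fun _ => ENNReal.ofReal_lt_top)]
  refine integrableOn_congr_fun (fun t (ht : 0 < t) => ?_) measurableSet_Ioi
  simp only [smul_eq_mul]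
  rw [ENNReal.toReal_ofReal (by positivity), Real.rpow_neg ht.le]
  field_simp

lemma setIntegral_div_rpow_eq {A : Set ℝ} (hA : MeasurableSet A) (hA0 : A ⊆ Ioi 0) (s : ℝ)
    (F : ℝ → ℝ) :
    ∫ t in A, F t / t ^ (1 + 2 * s) = ∫ t, A.indicator F t ∂kernelMeasure s := by
  rw [integral_kernelMeasure, ← integral_indicator hA, ← integral_indicator measurableSet_Ioi]
  congr 1
  ext t
  by_cases h : t ∈ A
  · simp [h, hA0 h]
  · simp [h, indicator]

lemma integral_kernelMeasure_comp_mul (s : ℝ) {c : ℝ} (hc : 0 < c) (F : ℝ → ℝ) :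
    ∫ t, F (c * t) ∂kernelMeasure s = c ^ (2 * s) * ∫ t, F t ∂kernelMeasure s := by
  rw [integral_kernelMeasure, integral_kernelMeasure]
  have h := integral_comp_mul_left_Ioi (fun u => F u / u ^ (1 + 2 * s)) 0 hc
  rw [mul_zero, smul_eq_mul] at h
  have h2 : ∀ t ∈ Ioi (0 : ℝ), F (c * t) / t ^ (1 + 2 * s)
      = c ^ (1 + 2 * s) * (F (c * t) / (c * t) ^ (1 + 2 * s)) := by
    intro t (ht : 0 < t)
    rw [Real.mul_rpow hc.le ht.le]
    field_simp
  rw [setIntegral_congr_fun measurableSet_Ioi h2, integral_const_mul, h, ← mul_assoc,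
    Real.rpow_add hc, Real.rpow_one]
  field_simp

lemma integrable_kernelMeasure_comp_mul {s c : ℝ} (hc : 0 < c) {F : ℝ → ℝ}
    (hF : Integrable F (kernelMeasure s)) :
    Integrable (fun t => F (c * t)) (kernelMeasure s) := by
  rw [integrable_kernelMeasure_iff] at hF ⊢
  rw [← mul_zero c] at hF
  refine IntegrableOn.congr_fun
    (((integrableOn_Ioi_comp_mul_left_iff _ 0 hc).2 hF).const_mul (c ^ (1 + 2 * s)))
    (fun t (ht : 0 < t) => ?_) measurableSet_Ioi
  rw [Real.mul_rpow hc.le ht.le]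
  field_simp

lemma integrable_indicator_Ici {s a : ℝ} (hs : 0 < s) (ha : 0 < a) :
    Integrable ((Ici a).indicator fun _ => (1 : ℝ)) (kernelMeasure s) := by
  rw [integrable_kernelMeasure_iff]
  have hpow : IntegrableOn (fun t : ℝ => t ^ (-(1 + 2 * s))) (Ici a) := by
    rw [integrableOn_Ici_iff_integrableOn_Ioi]
    exact integrableOn_Ioi_rpow_of_lt (by linarith) ha
  refine ((integrable_indicator_iff measurableSet_Ici).2 hpow).integrableOn.congr_fun
    (fun t (ht : 0 < t) => ?_) measurableSet_Ioi
  by_cases h : t ∈ Ici a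
  · simp only [indicator_of_mem h]
    rw [Real.rpow_neg ht.le, one_div]
  · simp [indicator_of_notMem h]

lemma integral_indicator_Ici {s a : ℝ} (hs : 0 < s) (ha : 0 < a) :
    ∫ t, (Ici a).indicator (fun _ => (1 : ℝ)) t ∂kernelMeasure s = a ^ (-(2 * s)) / (2 * s) := by
  rw [← setIntegral_div_rpow_eq measurableSet_Ici (fun t ht => ha.trans_le ht),
    integral_Ici_eq_integral_Ioi,
    setIntegral_congr_fun (g := fun t : ℝ => t ^ (-(1 + 2 * s))) measurableSet_Ioi]
  · rw [integral_Ioi_rpow_of_lt (by linarith) ha,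
      show -(1 + 2 * s) + 1 = -(2 * s) by ring, neg_div_neg_eq]
  · intro t (ht : a < t)
    simp only [one_div, Real.rpow_neg (ha.trans ht).le]

lemma indicator_Iio_sq_div_rpow (s T : ℝ) {t : ℝ} (ht : 0 < t) :
    (Iio T).indicator (fun t => t ^ 2) t / t ^ (1 + 2 * s)
      = (Ioo 0 T).indicator (fun t => t ^ (1 - 2 * s)) t := by
  by_cases h : t < T
  · rw [indicator_of_mem (mem_Iio.2 h), indicator_of_mem (mem_Ioo.2 ⟨ht, h⟩),
      ← Real.rpow_natCast, ← Real.rpow_sub ht]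
    congr 1
    push_cast
    ring
  · rw [indicator_of_notMem (by simpa using h),
      indicator_of_notMem fun h' : t ∈ Ioo 0 T => h h'.2, zero_div]

lemma integrable_indicator_Iio_sq {s T : ℝ} (hs : s < 1) (hT : 0 < T) :
    Integrable ((Iio T).indicator fun t => t ^ 2) (kernelMeasure s) := by
  have hpow : IntegrableOn (fun t : ℝ => t ^ (1 - 2 * s)) (Ioo 0 T) := by
    rw [← integrableOn_Ioc_iff_integrableOn_Ioo,
      ← intervalIntegrable_iff_integrableOn_Ioc_of_le hT.le]
    exact intervalIntegral.intervalIntegrable_rpow' (by linarith)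
  rw [integrable_kernelMeasure_iff]
  exact ((integrable_indicator_iff measurableSet_Ioo).2 hpow).integrableOn.congr_fun
    (fun t ht => (indicator_Iio_sq_div_rpow s T ht).symm) measurableSet_Ioi

lemma integral_indicator_Iio_sq {s T : ℝ} (hs : s < 1) (hT : 0 < T) :
    ∫ t, (Iio T).indicator (fun t => t ^ 2) t ∂kernelMeasure s
      = T ^ (2 - 2 * s) / (2 - 2 * s) := by
  rw [integral_kernelMeasure,
    setIntegral_congr_fun measurableSet_Ioi fun t ht => indicator_Iio_sq_div_rpow s T ht,
    setIntegral_indicator measurableSet_Ioo, inter_eq_right.2 Ioo_subset_Ioi_self,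
    ← integral_Ioc_eq_integral_Ioo, ← intervalIntegral.integral_of_le hT.le,
    integral_rpow (Or.inl (by linarith)), Real.zero_rpow (by linarith), sub_zero,
    show 1 - 2 * s + 1 = 2 - 2 * s by ring]

/-- The common dominating profile, up to a constant, of second differences that are quadratic at
distances less than `δ` and bounded beyond. -/
noncomputable def kernelProfile (δ t : ℝ) : ℝ := if t < δ then t ^ 2 else 1

lemma integrable_kernelProfile {s δ : ℝ} (hs₀ : 0 < s) (hs₁ : s < 1) (hδ : 0 < δ) :
    Integrable (kernelProfile δ) (kernelMeasure s) := by
  refine ((integrable_indicator_Iio_sq hs₁ hδ).add (integrable_indicator_Ici hs₀ hδ)).congr ?_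
  refine Eventually.of_forall fun t => ?_
  by_cases h : t < δ
  · simp [kernelProfile, h]
  · simp [kernelProfile, h, not_lt.1 h]

lemma integrable_of_abs_le_kernelProfile {s δ C : ℝ} (hs₀ : 0 < s) (hs₁ : s < 1) (hδ : 0 < δ)
    {F : ℝ → ℝ} (hF : AEStronglyMeasurable F (kernelMeasure s))
    (h : ∀ t, 0 < t → |F t| ≤ C * kernelProfile δ t) :
    Integrable F (kernelMeasure s) := by
  refine ((integrable_kernelProfile hs₀ hs₁ hδ).const_mul C).mono' hF ?_
  filter_upwards [ae_kernelMeasure_pos s] with t ht using h t ht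

lemma integral_kernelMeasure_mono {s : ℝ} {F G : ℝ → ℝ} (hF : Integrable F (kernelMeasure s))
    (hG : Integrable G (kernelMeasure s)) (h : ∀ t, 0 < t → F t ≤ G t) :
    ∫ t, F t ∂kernelMeasure s ≤ ∫ t, G t ∂kernelMeasure s := by
  refine integral_mono_ae hF hG ?_
  filter_upwards [ae_kernelMeasure_pos s] with t ht using h t ht

lemma abs_max_le {a b c : ℝ} (ha : |a| ≤ c) (hb : |b| ≤ c) : |max a b| ≤ c :=
  abs_max_le_max_abs_abs.trans (max_le ha hb)

lemma eventually_integral_lt_of_dominated {α : Type*} {l : Filter α} [l.IsCountablyGenerated]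
    {β : Type*} [MeasurableSpace β] {μ : Measure β} {F : α → β → ℝ} {F₀ H : β → ℝ}
    (hH : Integrable H μ)
    (hF : ∀ᶠ p in l, AEStronglyMeasurable (F p) μ) (hF₀ : AEStronglyMeasurable F₀ μ)
    (hb : ∀ᶠ p in l, ∀ᵐ t ∂μ, |F p t| ≤ H t) (hb₀ : ∀ᵐ t ∂μ, |F₀ t| ≤ H t)
    (hlim : ∀ᵐ t ∂μ, ∀ ε > 0, ∀ᶠ p in l, F p t < F₀ t + ε) {b : ℝ} (hlt : ∫ t, F₀ t ∂μ < b) :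
    ∀ᶠ p in l, ∫ t, F p t ∂μ < b := by
  have htendsto : Tendsto (fun p => ∫ t, max (F p t) (F₀ t) ∂μ) l (𝓝 (∫ t, F₀ t ∂μ)) := by
    refine tendsto_integral_filter_of_dominated_convergence H ?_ ?_ hH ?_
    · filter_upwards [hF] with p hp using hp.sup hF₀
    · filter_upwards [hb] with p hp
      filter_upwards [hp, hb₀] with t h h₀ using abs_max_le h h₀
    · filter_upwards [hlim] with t ht
      rw [Metric.tendsto_nhds]
      intro ε hε
      filter_upwards [ht ε hε] with p hp
      rw [Real.dist_eq, abs_lt]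
      exact ⟨by linarith [le_max_right (F p t) (F₀ t)],
        by linarith [max_lt hp (show F₀ t < F₀ t + ε by linarith)]⟩
  filter_upwards [htendsto.eventually (gt_mem_nhds hlt), hF, hb] with p hp hFp hbp
  refine (integral_mono_ae (hH.mono' hFp hbp) (hH.mono' (hFp.sup hF₀) ?_)
    (Eventually.of_forall fun t => le_max_left _ _)).trans_lt hp
  filter_upwards [hbp, hb₀] with t h h₀ using abs_max_le h h₀

/-! ### The directional operator with a test function -/

section Operator

variable {E : Type*} [NormedAddCommGroup E] [NormedSpace ℝ E]

/-- Symmetric second difference of `w` at `x` with increment `t • z`. -/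
def secondDiff (w : E → ℝ) (x z : E) (t : ℝ) : ℝ := w (x + t • z) + w (x - t • z) - 2 * w x

/-- Integrand of `dirLap`: the second difference of `φ` at distances less than `δ`, and of `u`
beyond, where the central value of `u` is taken to be `a`. -/
noncomputable def dirLapIntegrand (δ : ℝ) (φ u : E → ℝ) (x z : E) (a t : ℝ) : ℝ :=
  if t < δ then secondDiff φ x z t else u (x + t • z) + u (x - t • z) - 2 * a

/-- The one-dimensional fractional Laplacian at `x` in direction `z`, evaluated on a test function
`φ` at distances less than `δ` and on `u` beyond. The central value `a` of `u` is a separate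
variable, so that the operator is semicontinuous in `(x, z, a)` even where `u` jumps. -/
noncomputable def dirLap (s δ : ℝ) (φ u : E → ℝ) (x z : E) (a : ℝ) : ℝ :=
  ∫ t, dirLapIntegrand δ φ u x z a t ∂kernelMeasure s

/-- Bounded functions that are measurable along every line: the regularity under which `dirLap` is
given by a convergent integral. -/
structure IsLineBounded (u : E → ℝ) : Prop where
  bounded : ∃ M : ℝ, ∀ x, |u x| ≤ M
  measurable : ∀ x z : E, Measurable fun t : ℝ => u (x + t • z)

lemma IsLineBounded.neg {u : E → ℝ} (hu : IsLineBounded u) : IsLineBounded (-u) where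
  bounded := by
    obtain ⟨M, hM⟩ := hu.bounded
    exact ⟨M, fun x => by simpa using hM x⟩
  measurable x z := (hu.measurable x z).neg

lemma IsLineBounded.measurable_sub {u : E → ℝ} (hu : IsLineBounded u) (x z : E) :
    Measurable fun t : ℝ => u (x - t • z) := by
  simpa [sub_eq_add_neg] using hu.measurable x (-z)

lemma IsLineBounded.of_measurable [MeasurableSpace E] [BorelSpace E] {u : E → ℝ}
    (hu : Measurable u) (hb : ∃ M : ℝ, ∀ x, |u x| ≤ M) : IsLineBounded u where
  bounded := hb
  measurable x z := hu.comp (Continuous.measurable (by fun_prop))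

lemma IsLineBounded.of_upperSemicontinuous {u : E → ℝ} (hu : UpperSemicontinuous u)
    (hb : ∃ M : ℝ, ∀ x, |u x| ≤ M) : IsLineBounded u where
  bounded := hb
  measurable x z :=
    (hu.comp (g := fun t : ℝ => x + t • z) (by fun_prop)).measurable

lemma IsLineBounded.of_lowerSemicontinuous {u : E → ℝ} (hu : LowerSemicontinuous u)
    (hb : ∃ M : ℝ, ∀ x, |u x| ≤ M) : IsLineBounded u where
  bounded := hb
  measurable x z :=
    (hu.comp (g := fun t : ℝ => x + t • z) (by fun_prop)).measurable

lemma upperSemicontinuous_neg {α : Type*} [TopologicalSpace α] {u : α → ℝ}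
    (hu : LowerSemicontinuous u) : UpperSemicontinuous (-u) :=
  continuous_neg.comp_lowerSemicontinuous_antitone hu fun _ _ => neg_le_neg

lemma lowerSemicontinuous_neg {α : Type*} [TopologicalSpace α] {u : α → ℝ}
    (hu : UpperSemicontinuous u) : LowerSemicontinuous (-u) :=
  continuous_neg.comp_upperSemicontinuous_antitone hu fun _ _ => neg_le_neg

lemma secondDiff_smul (w : E → ℝ) (x z : E) (c t : ℝ) :
    secondDiff w x (c • z) t = secondDiff w x z (c * t) := by
  simp only [secondDiff, smul_smul, mul_comm t c]

lemma secondDiff_neg_dir (w : E → ℝ) (x z : E) (t : ℝ) :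
    secondDiff w x (-z) t = secondDiff w x z t := by
  simp only [secondDiff, smul_neg, ← sub_eq_add_neg, sub_neg_eq_add]; ring

lemma dirLapIntegrand_neg (δ : ℝ) (φ u : E → ℝ) (x z : E) (a t : ℝ) :
    dirLapIntegrand δ (-φ) (-u) x z (-a) t = -dirLapIntegrand δ φ u x z a t := by
  unfold dirLapIntegrand; split_ifs <;> simp [secondDiff] <;> ring

lemma dirLap_neg (s δ : ℝ) (φ u : E → ℝ) (x z : E) (a : ℝ) :
    dirLap s δ (-φ) (-u) x z (-a) = -dirLap s δ φ u x z a := by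
  simp only [dirLap, dirLapIntegrand_neg, integral_neg]

lemma dirLap_neg_dir (s δ : ℝ) (φ u : E → ℝ) (x z : E) (a : ℝ) :
    dirLap s δ φ u x (-z) a = dirLap s δ φ u x z a := by
  unfold dirLap dirLapIntegrand
  congr 1; ext t
  rw [secondDiff_neg_dir]
  split_ifs
  · rfl
  · rw [smul_neg, ← sub_eq_add_neg, sub_neg_eq_add]; ring

lemma dirLap_smul_dir {s c : ℝ} (hc : 0 < c) (δ : ℝ) (φ u : E → ℝ) (x z : E) (a : ℝ) :
    dirLap s δ φ u x (c • z) a = c ^ (2 * s) * dirLap s (c * δ) φ u x z a := by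
  rw [dirLap, dirLap, ← integral_kernelMeasure_comp_mul s hc]
  congr 1; ext t
  unfold dirLapIntegrand
  rw [secondDiff_smul]
  simp only [smul_smul, mul_comm _ c, mul_lt_mul_iff_right₀ hc]

lemma dirLap_zero_dir {s δ : ℝ} (φ u : E → ℝ) (x : E) : dirLap s δ φ u x 0 (u x) = 0 := by
  have : ∀ t, dirLapIntegrand δ φ u x 0 (u x) t = 0 := by
    intro t; unfold dirLapIntegrand secondDiff; split_ifs <;> simp <;> ring
  simp [dirLap, this]

lemma dirLap_add_const (s δ b : ℝ) (φ u : E → ℝ) (x z : E) (a : ℝ) :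
    dirLap s δ (fun y => φ y + b) u x z a = dirLap s δ φ u x z a := by
  unfold dirLap dirLapIntegrand secondDiff
  congr 1; ext t
  split_ifs <;> ring

lemma hasDerivAt_add_smul_add_sub_smul {φ : E → ℝ} (hφ : Differentiable ℝ φ) (x h : E) (τ : ℝ) :
    HasDerivAt (fun τ : ℝ => φ (x + τ • h) + φ (x - τ • h))
      ((fderiv ℝ φ (x + τ • h) - fderiv ℝ φ (x - τ • h)) h) τ := by
  have hadd : HasDerivAt (fun τ : ℝ => x + τ • h) h τ := by
    simpa using ((hasDerivAt_id τ).smul_const h).const_add x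
  have hsub : HasDerivAt (fun τ : ℝ => x - τ • h) (-h) τ := by
    simpa using ((hasDerivAt_id τ).smul_const h).const_sub x
  refine HasDerivAt.congr_deriv (((hφ (x + τ • h)).hasFDerivAt.comp_hasDerivAt τ hadd).add
    ((hφ (x - τ • h)).hasFDerivAt.comp_hasDerivAt τ hsub)) ?_
  simp [sub_eq_add_neg]

lemma abs_second_difference_le_of_lipschitzOnWith {φ : E → ℝ} (hφ : Differentiable ℝ φ) {K : NNReal}
    {R : ℝ} (hK : LipschitzOnWith K (fderiv ℝ φ) (Metric.closedBall 0 (2 * R))) {x h : E}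
    (hx : ‖x‖ ≤ R) (hh : ‖h‖ ≤ R) :
    |φ (x + h) + φ (x - h) - 2 * φ x| ≤ 2 * K * ‖h‖ ^ 2 := by
  have hbd : ∀ τ ∈ Ico (0 : ℝ) 1,
      ‖(fderiv ℝ φ (x + τ • h) - fderiv ℝ φ (x - τ • h)) h‖ ≤ 2 * K * ‖h‖ ^ 2 := by
    intro τ hτ
    have hτh : ‖τ • h‖ ≤ ‖h‖ := by
      rw [norm_smul, Real.norm_eq_abs, abs_of_nonneg hτ.1]
      exact mul_le_of_le_one_left (norm_nonneg _) hτ.2.le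
    have hadd : x + τ • h ∈ Metric.closedBall (0 : E) (2 * R) := by
      rw [mem_closedBall_zero_iff]
      linarith [norm_add_le x (τ • h)]
    have hsub : x - τ • h ∈ Metric.closedBall (0 : E) (2 * R) := by
      rw [mem_closedBall_zero_iff]
      linarith [norm_sub_le x (τ • h)]
    have hlip := hK.dist_le_mul _ hadd _ hsub
    rw [dist_eq_norm, dist_eq_norm, show x + τ • h - (x - τ • h) = (2 : ℝ) • (τ • h) by
      rw [two_smul]; abel, norm_smul, Real.norm_ofNat] at hlip
    calc ‖(fderiv ℝ φ (x + τ • h) - fderiv ℝ φ (x - τ • h)) h‖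
        ≤ ‖fderiv ℝ φ (x + τ • h) - fderiv ℝ φ (x - τ • h)‖ * ‖h‖ :=
          ContinuousLinearMap.le_opNorm _ _
      _ ≤ (K * (2 * ‖h‖)) * ‖h‖ := by gcongr; exact hlip.trans (by gcongr)
      _ = 2 * K * ‖h‖ ^ 2 := by ring
  have hmvt := norm_image_sub_le_of_norm_deriv_le_segment_01'
    (fun τ _ => (hasDerivAt_add_smul_add_sub_smul hφ x h τ).hasDerivWithinAt) hbd
  rw [Real.norm_eq_abs] at hmvt
  simpa [two_mul] using hmvt

lemma measurable_dirLapIntegrand {φ : E → ℝ} (hφ : Continuous φ) {u : E → ℝ}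
    (hu : IsLineBounded u) (δ : ℝ) (x z : E) (a : ℝ) :
    Measurable (dirLapIntegrand δ φ u x z a) := by
  unfold dirLapIntegrand
  refine Measurable.ite measurableSet_Iio ?_
    (((hu.measurable x z).add (hu.measurable_sub x z)).sub_const _)
  unfold secondDiff
  exact Continuous.measurable (by fun_prop)

lemma eventually_dirLapIntegrand_lt (δ : ℝ) {φ u : E → ℝ} (hφ : Continuous φ)
    (hu : UpperSemicontinuous u) (x z : E) (a t : ℝ) {ε : ℝ} (hε : 0 < ε) :
    ∀ᶠ p : E × E × ℝ in 𝓝 (x, z, a),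
      dirLapIntegrand δ φ u p.1 p.2.1 p.2.2 t < dirLapIntegrand δ φ u x z a t + ε := by
  unfold dirLapIntegrand
  split_ifs with ht
  · unfold secondDiff
    exact (Continuous.tendsto (f := fun p : E × E × ℝ =>
      φ (p.1 + t • p.2.1) + φ (p.1 - t • p.2.1) - 2 * φ p.1) (by fun_prop) _).eventually
      (gt_mem_nhds (by simp only; linarith))
  · have hadd : ∀ᶠ p : E × E × ℝ in 𝓝 (x, z, a), u (p.1 + t • p.2.1) < u (x + t • z) + ε / 4 :=
      (Continuous.tendsto (f := fun p : E × E × ℝ => p.1 + t • p.2.1) (by fun_prop)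
        (x, z, a)).eventually (hu _ _ (by simp only; linarith))
    have hsub : ∀ᶠ p : E × E × ℝ in 𝓝 (x, z, a), u (p.1 - t • p.2.1) < u (x - t • z) + ε / 4 :=
      (Continuous.tendsto (f := fun p : E × E × ℝ => p.1 - t • p.2.1) (by fun_prop)
        (x, z, a)).eventually (hu _ _ (by simp only; linarith))
    have hcentre : ∀ᶠ p : E × E × ℝ in 𝓝 (x, z, a), a - ε / 4 < p.2.2 :=
      (Continuous.tendsto (f := fun p : E × E × ℝ => p.2.2) (by fun_prop)
        (x, z, a)).eventually (lt_mem_nhds (by simp only; linarith))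
    filter_upwards [hadd, hsub, hcentre] with p h1 h2 h3
    linarith

variable [FiniteDimensional ℝ E]

lemma exists_abs_second_difference_le {φ : E → ℝ} (hφ : ContDiff ℝ 2 φ) (R : ℝ) :
    ∃ C : ℝ, 0 ≤ C ∧ ∀ x h : E, ‖x‖ ≤ R → ‖h‖ ≤ R →
      |φ (x + h) + φ (x - h) - 2 * φ x| ≤ C * ‖h‖ ^ 2 := by
  have hd : ContDiff ℝ 1 (fderiv ℝ φ) := hφ.fderiv_right (by norm_num)
  obtain ⟨K, hK⟩ := (hd.locallyLipschitz.locallyLipschitzOn (s := Metric.closedBall 0 (2 * R))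
    ).exists_lipschitzOnWith_of_compact (isCompact_closedBall _ _)
  exact ⟨2 * K, by positivity, fun x h hx hh =>
    abs_second_difference_le_of_lipschitzOnWith (hφ.differentiable (by norm_num)) hK hx hh⟩

lemma exists_abs_dirLapIntegrand_le {φ : E → ℝ} (hφ : ContDiff ℝ 2 φ) {u : E → ℝ}
    (hu : IsLineBounded u) (R δ : ℝ) :
    ∃ C : ℝ, ∀ (x z : E) (a t : ℝ), ‖x‖ ≤ R → ‖z‖ ≤ R → |a| ≤ R → 0 < t →
      |dirLapIntegrand δ φ u x z a t| ≤ C * kernelProfile δ t := by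
  obtain ⟨M, hM⟩ := hu.bounded
  obtain ⟨C, hC0, hC⟩ := exists_abs_second_difference_le hφ (max R (|δ| * R))
  refine ⟨C * R ^ 2 + 2 * (M + R), fun x z a t hx hz ha ht => ?_⟩
  have hM0 : 0 ≤ M := (abs_nonneg _).trans (hM x)
  have hR0 : 0 ≤ R := (norm_nonneg _).trans hx
  unfold dirLapIntegrand kernelProfile
  split_ifs with htd
  · have h1 : ‖t • z‖ = t * ‖z‖ := by rw [norm_smul, Real.norm_eq_abs, abs_of_pos ht]
    have h2 : ‖t • z‖ ≤ |δ| * R := by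
      rw [h1]
      have : t ≤ |δ| := htd.le.trans (le_abs_self _)
      gcongr
    have := hC x (t • z) (hx.trans (le_max_left _ _)) (h2.trans (le_max_right _ _))
    unfold secondDiff
    refine this.trans ?_
    rw [h1, mul_pow]
    have : ‖z‖ ^ 2 ≤ R ^ 2 := by gcongr
    have h3 : 0 ≤ 2 * (M + R) * t ^ 2 := by positivity
    nlinarith [mul_le_mul_of_nonneg_left this (by positivity : 0 ≤ C * t ^ 2)]
  · have h1 := abs_le.1 (hM (x + t • z))
    have h2 := abs_le.1 (hM (x - t • z))
    have h3 := abs_le.1 ha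
    have h4 : 0 ≤ C * R ^ 2 := by positivity
    rw [abs_le]
    constructor <;> linarith

lemma integrable_dirLapIntegrand {s : ℝ} (hs₀ : 0 < s) (hs₁ : s < 1) {δ : ℝ} (hδ : 0 < δ)
    {φ : E → ℝ} (hφ : ContDiff ℝ 2 φ) {u : E → ℝ} (hu : IsLineBounded u) (x z : E) (a : ℝ) :
    Integrable (dirLapIntegrand δ φ u x z a) (kernelMeasure s) := by
  obtain ⟨C, hC⟩ := exists_abs_dirLapIntegrand_le hφ hu (max (max ‖x‖ ‖z‖) |a|) δ
  exact integrable_of_abs_le_kernelProfile hs₀ hs₁ hδ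
    (measurable_dirLapIntegrand hφ.continuous hu δ x z a).aestronglyMeasurable
    fun t ht => hC x z a t (by simp) (by simp) (by simp) ht

lemma dirLap_mono {s : ℝ} (hs₀ : 0 < s) (hs₁ : s < 1) {δ δ' : ℝ} (hδ : 0 < δ) (hδ' : 0 < δ')
    {φ ψ u v : E → ℝ} (hφ : ContDiff ℝ 2 φ) (hψ : ContDiff ℝ 2 ψ) (hu : IsLineBounded u)
    (hv : IsLineBounded v) {x y z w : E} {a b : ℝ}
    (h : ∀ t, 0 < t → dirLapIntegrand δ φ u x z a t ≤ dirLapIntegrand δ' ψ v y w b t) :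
    dirLap s δ φ u x z a ≤ dirLap s δ' ψ v y w b :=
  integral_kernelMeasure_mono (integrable_dirLapIntegrand hs₀ hs₁ hδ hφ hu x z a)
    (integrable_dirLapIntegrand hs₀ hs₁ hδ' hψ hv y w b) h

lemma dirLap_antitone {s : ℝ} (hs₀ : 0 < s) (hs₁ : s < 1) {δ : ℝ} (hδ : 0 < δ) {φ u : E → ℝ}
    (hφ : ContDiff ℝ 2 φ) (hu : IsLineBounded u) (x z : E) {a b : ℝ} (hab : a ≤ b) :
    dirLap s δ φ u x z b ≤ dirLap s δ φ u x z a :=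
  dirLap_mono hs₀ hs₁ hδ hδ hφ hφ hu hu fun t _ => by
    unfold dirLapIntegrand; split_ifs <;> linarith

lemma dirLap_mono_of_le {s : ℝ} (hs₀ : 0 < s) (hs₁ : s < 1) {δ : ℝ} (hδ : 0 < δ) {φ u v : E → ℝ}
    (hφ : ContDiff ℝ 2 φ) (hu : IsLineBounded u) (hv : IsLineBounded v) (huv : ∀ y, u y ≤ v y)
    (x z : E) (a : ℝ) : dirLap s δ φ u x z a ≤ dirLap s δ φ v x z a :=
  dirLap_mono hs₀ hs₁ hδ hδ hφ hφ hu hv fun t _ => by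
    unfold dirLapIntegrand
    split_ifs
    · exact le_rfl
    · linarith [huv (x + t • z), huv (x - t • z)]

lemma dirLap_le_dirLap_of_le_testFun {s : ℝ} (hs₀ : 0 < s) (hs₁ : s < 1) {δ δ' r : ℝ} (hδ' : 0 < δ')
    (hδδ' : δ' ≤ δ) {φ u : E → ℝ} (hφ : ContDiff ℝ 2 φ) (hu : IsLineBounded u) {x z : E}
    (hx : φ x = u x) (hr : δ * ‖z‖ ≤ r) (hle : ∀ y ∈ Metric.ball x r, u y ≤ φ y) :
    dirLap s δ' φ u x z (u x) ≤ dirLap s δ φ u x z (u x) := by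
  refine dirLap_mono hs₀ hs₁ hδ' (hδ'.trans_le hδδ') hφ hφ hu hu fun t ht => ?_
  unfold dirLapIntegrand secondDiff
  by_cases h1 : t < δ'
  · rw [if_pos h1, if_pos (h1.trans_le hδδ')]
  · rw [if_neg h1]
    split_ifs with h2
    · rcases eq_or_ne z 0 with rfl | hz
      · simp [hx]
      · have hlt : ‖t • z‖ < r := by
          rw [norm_smul, Real.norm_eq_abs, abs_of_pos ht]
          exact (mul_lt_mul_of_pos_right h2 (norm_pos_iff.2 hz)).trans_le hr
        have e1 := hle (x + t • z) (by simpa [Metric.mem_ball, dist_eq_norm] using hlt)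
        have e2 := hle (x - t • z) (by simpa [Metric.mem_ball, dist_eq_norm] using hlt)
        rw [hx]; linarith
    · exact le_rfl

lemma dirLap_le_dirLap_of_testFun_le {s : ℝ} (hs₀ : 0 < s) (hs₁ : s < 1) {δ δ' r : ℝ} (hδ' : 0 < δ')
    (hδδ' : δ' ≤ δ) {φ u : E → ℝ} (hφ : ContDiff ℝ 2 φ) (hu : IsLineBounded u) {x z : E}
    (hx : φ x = u x) (hr : δ * ‖z‖ ≤ r) (hle : ∀ y ∈ Metric.ball x r, φ y ≤ u y) :
    dirLap s δ φ u x z (u x) ≤ dirLap s δ' φ u x z (u x) := by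
  have := dirLap_le_dirLap_of_le_testFun hs₀ hs₁ hδ' hδδ' (φ := -φ) hφ.neg hu.neg (x := x)
    (z := z) (by simp [hx]) hr (fun y hy => neg_le_neg (hle y hy))
  rw [Pi.neg_apply, dirLap_neg, dirLap_neg] at this
  linarith

lemma eventually_dirLap_lt {s : ℝ} (hs₀ : 0 < s) (hs₁ : s < 1) {δ : ℝ} (hδ : 0 < δ) {φ u : E → ℝ}
    (hφ : ContDiff ℝ 2 φ) (hu : UpperSemicontinuous u) (hb : ∃ M : ℝ, ∀ x, |u x| ≤ M)
    {x z : E} {a b : ℝ} (h : dirLap s δ φ u x z a < b) :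
    ∀ᶠ p : E × E × ℝ in 𝓝 (x, z, a), dirLap s δ φ u p.1 p.2.1 p.2.2 < b := by
  have hline := IsLineBounded.of_upperSemicontinuous hu hb
  obtain ⟨R, hR⟩ := exists_gt (max (max ‖x‖ ‖z‖) |a|)
  obtain ⟨⟨hx, hz⟩, ha⟩ : (‖x‖ < R ∧ ‖z‖ < R) ∧ |a| < R := by simpa only [max_lt_iff] using hR
  obtain ⟨C, hC⟩ := exists_abs_dirLapIntegrand_le hφ hline R δ
  have hmeas := fun x z a =>
    (measurable_dirLapIntegrand hφ.continuous hline δ x z a).aestronglyMeasurable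
      (μ := kernelMeasure s)
  refine eventually_integral_lt_of_dominated (H := fun t => C * kernelProfile δ t)
    ((integrable_kernelProfile hs₀ hs₁ hδ).const_mul C) (Eventually.of_forall fun p => hmeas _ _ _)
    (hmeas x z a) ?_ ?_ (Eventually.of_forall fun t ε hε =>
      eventually_dirLapIntegrand_lt δ hφ.continuous hu x z a t hε) h
  · have hnear : ∀ᶠ p : E × E × ℝ in 𝓝 (x, z, a), max (max ‖p.1‖ ‖p.2.1‖) |p.2.2| < R :=
      (Continuous.tendsto (f := fun p : E × E × ℝ => max (max ‖p.1‖ ‖p.2.1‖) |p.2.2|)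
        (by fun_prop) _).eventually (gt_mem_nhds hR)
    filter_upwards [hnear] with p hp
    obtain ⟨⟨hx', hz'⟩, ha'⟩ : (‖p.1‖ < R ∧ ‖p.2.1‖ < R) ∧ |p.2.2| < R := by
      simpa only [max_lt_iff] using hp
    filter_upwards [ae_kernelMeasure_pos s] with t ht using hC _ _ _ t hx'.le hz'.le ha'.le ht
  · filter_upwards [ae_kernelMeasure_pos s] with t ht using hC _ _ _ t hx.le hz.le ha.le ht

end Operator

/-! ### Viscosity tests -/

section Tests

variable {E : Type*} [NormedAddCommGroup E] [NormedSpace ℝ E]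

/-- `u` is a viscosity subsolution, at the points of `X`, of the directional equation in every
direction. The test function touches `u` at `x₀` (`φ x₀ = u x₀`), and `z` need not be a unit vector,
which makes the notion invariant under affine maps. -/
def IsSubsolOn (s : ℝ) (X : Set E) (u : E → ℝ) : Prop :=
  ∀ x₀ ∈ X, ∀ (φ : E → ℝ) (r : ℝ), ContDiff ℝ 2 φ → φ x₀ = u x₀ →
    (∀ x ∈ Metric.ball x₀ r, u x ≤ φ x) → ∀ (z : E) (δ : ℝ), 0 < δ → δ * ‖z‖ ≤ r →
      0 ≤ dirLap s δ φ u x₀ z (u x₀)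

/-- `v` is a viscosity supersolution, at the points of `X`, of the equation for the infimum over
unit directions; since that infimum need not be attained, it is tested through every `c > 0`. -/
def IsSupersolOn (s : ℝ) (X : Set E) (v : E → ℝ) : Prop :=
  ∀ x₀ ∈ X, ∀ (φ : E → ℝ) (r : ℝ), ContDiff ℝ 2 φ → φ x₀ = v x₀ →
    (∀ x ∈ Metric.ball x₀ r, φ x ≤ v x) → ∀ δ : ℝ, 0 < δ → δ ≤ r → ∀ c : ℝ, 0 < c →
      ∃ z : E, ‖z‖ = 1 ∧ dirLap s δ φ v x₀ z (v x₀) < c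

lemma isSubsolOn_of_forall_norm_eq_one {s : ℝ} {X : Set E} {u : E → ℝ}
    (h : ∀ x₀ ∈ X, ∀ (φ : E → ℝ) (r : ℝ), ContDiff ℝ 2 φ → φ x₀ = u x₀ →
      (∀ x ∈ Metric.ball x₀ r, u x ≤ φ x) → ∀ (z : E) (δ : ℝ), 0 < δ → ‖z‖ = 1 → δ ≤ r →
      0 ≤ dirLap s δ φ u x₀ z (u x₀)) : IsSubsolOn s X u := by
  intro x₀ hx₀ φ r hφ h0 hle z δ hδ hr
  rcases eq_or_ne z 0 with rfl | hz
  · rw [dirLap_zero_dir]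
  · have hn : 0 < ‖z‖ := norm_pos_iff.2 hz
    have hz' : z = ‖z‖ • (‖z‖⁻¹ • z) := by rw [smul_smul, mul_inv_cancel₀ hn.ne', one_smul]
    rw [hz', dirLap_smul_dir hn]
    refine mul_nonneg (by positivity) (h x₀ hx₀ φ r hφ h0 hle _ _ (by positivity) ?_ ?_)
    · rw [norm_smul, norm_inv, norm_norm, inv_mul_cancel₀ hn.ne']
    · rwa [mul_comm]

lemma IsSubsolOn.mono {s : ℝ} {X Y : Set E} {u : E → ℝ} (h : IsSubsolOn s X u) (hYX : Y ⊆ X) :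
    IsSubsolOn s Y u := fun x hx => h x (hYX hx)

lemma IsSupersolOn.mono {s : ℝ} {X Y : Set E} {u : E → ℝ} (h : IsSupersolOn s X u) (hYX : Y ⊆ X) :
    IsSupersolOn s Y u := fun x hx => h x (hYX hx)

end Tests

/-! ### Properties of the semicontinuous envelopes -/

lemma abs_neg_apply_le {α : Type*} {w : α → ℝ} {M : ℝ} (hb : ∀ y, |w y| ≤ M) :
    ∀ y, |(-w) y| ≤ M :=
  fun y => by simpa using hb y

section Envelope

variable {X : Type*} [TopologicalSpace X] {w : X → ℝ} {x : X} {M c : ℝ}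

lemma lowerEnv_eq_neg (w : X → ℝ) : lowerEnv w = -upperEnv (-w) := by
  ext x
  simp only [lowerEnv, upperEnv, Pi.neg_apply, limsup_eq, liminf_eq]
  rw [Real.sInf_def, neg_neg]
  congr 1
  ext a
  simp

lemma eventually_lt_of_upperEnv_lt (hb : ∀ᶠ y in 𝓝 x, |w y| ≤ M) (h : upperEnv w x < c) :
    ∀ᶠ y in 𝓝 x, w y < c :=
  eventually_lt_of_limsup_lt h ⟨M, hb.mono fun _ hy => (abs_le.1 hy).2⟩

lemma frequently_lt_of_lt_upperEnv (hb : ∀ᶠ y in 𝓝 x, |w y| ≤ M) (h : c < upperEnv w x) :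
    ∃ᶠ y in 𝓝 x, c < w y := by
  refine frequently_lt_of_lt_limsup ?_ h
  have : IsBoundedUnder (· ≥ ·) (𝓝 x) w := ⟨-M, hb.mono fun _ hy => (abs_le.1 hy).1⟩
  exact this.isCoboundedUnder_le

lemma upperEnv_le (hb : ∀ᶠ y in 𝓝 x, |w y| ≤ M) (h : ∀ᶠ y in 𝓝 x, w y ≤ c) :
    upperEnv w x ≤ c := by
  by_contra! hc
  obtain ⟨y, h1, h2⟩ := ((frequently_lt_of_lt_upperEnv hb hc).and_eventually h).exists
  exact absurd h1 (not_lt.2 h2)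

lemma le_upperEnv (hb : ∀ᶠ y in 𝓝 x, |w y| ≤ M) : w x ≤ upperEnv w x := by
  by_contra! h
  exact lt_irrefl _ (eventually_lt_of_upperEnv_lt hb h).self_of_nhds

lemma upperSemicontinuousAt_upperEnv (hb : ∀ᶠ y in 𝓝 x, |w y| ≤ M) :
    UpperSemicontinuousAt (upperEnv w) x := by
  intro c hc
  obtain ⟨c', h1, h2⟩ := exists_between hc
  filter_upwards [(eventually_lt_of_upperEnv_lt hb h1).eventually_nhds, hb.eventually_nhds]
    with y hy hby
  exact (upperEnv_le hby (hy.mono fun _ h => h.le)).trans_lt h2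

lemma upperSemicontinuous_upperEnv (hb : ∀ y, |w y| ≤ M) : UpperSemicontinuous (upperEnv w) :=
  fun _ => upperSemicontinuousAt_upperEnv (Eventually.of_forall hb)

lemma abs_upperEnv_le (hb : ∀ᶠ y in 𝓝 x, |w y| ≤ M) : |upperEnv w x| ≤ M := by
  rw [abs_le]
  exact ⟨(abs_le.1 hb.self_of_nhds).1.trans (le_upperEnv hb),
    upperEnv_le hb (hb.mono fun _ h => (abs_le.1 h).2)⟩

lemma lowerEnv_le (hb : ∀ y, |w y| ≤ M) (x : X) : lowerEnv w x ≤ w x := by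
  rw [lowerEnv_eq_neg]
  have := le_upperEnv (x := x) (Eventually.of_forall (abs_neg_apply_le hb))
  simp only [Pi.neg_apply] at this ⊢
  linarith

lemma lowerSemicontinuous_lowerEnv (hb : ∀ y, |w y| ≤ M) : LowerSemicontinuous (lowerEnv w) := by
  rw [lowerEnv_eq_neg]
  exact lowerSemicontinuous_neg (upperSemicontinuous_upperEnv (abs_neg_apply_le hb))

lemma abs_lowerEnv_le (hb : ∀ y, |w y| ≤ M) (x : X) : |lowerEnv w x| ≤ M := by
  rw [lowerEnv_eq_neg, Pi.neg_apply, abs_neg]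
  exact abs_upperEnv_le (Eventually.of_forall (abs_neg_apply_le hb))

lemma le_lowerEnv (hb : ∀ y, |w y| ≤ M) (h : ∀ᶠ y in 𝓝 x, c ≤ w y) : c ≤ lowerEnv w x := by
  rw [lowerEnv_eq_neg, Pi.neg_apply]
  have : upperEnv (-w) x ≤ -c := upperEnv_le (Eventually.of_forall (abs_neg_apply_le hb))
    (h.mono fun y hy => by simpa using hy)
  linarith

lemma upperEnv_of_continuousAt (h : ContinuousAt w x) : upperEnv w x = w x :=
  Tendsto.limsup_eq h

lemma lowerEnv_of_continuousAt (h : ContinuousAt w x) : lowerEnv w x = w x :=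
  Tendsto.liminf_eq h

end Envelope

section Touching

variable {E : Type*} [NormedAddCommGroup E] [InnerProductSpace ℝ E]

lemma secondDiff_norm_sub_sq (c x z : E) (t : ℝ) :
    secondDiff (fun y => ‖y - c‖ ^ 2) x z t = 2 * t ^ 2 * ‖z‖ ^ 2 := by
  unfold secondDiff
  have h := parallelogram_law_with_norm ℝ (x - c) (t • z)
  rw [norm_smul, Real.norm_eq_abs] at h
  rw [mul_pow, sq_abs] at h
  simp only
  rw [show x + t • z - c = x - c + t • z by abel, show x - t • z - c = x - c - t • z by abel]
  linarith

lemma contDiff_norm_sub_sq (c : E) : ContDiff ℝ 2 (fun y : E => ‖y - c‖ ^ 2) :=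
  (contDiff_id.sub contDiff_const).norm_sq ℝ

variable [FiniteDimensional ℝ E]

lemma dirLap_add_mul_norm_sub_sq {s : ℝ} (hs₀ : 0 < s) (hs₁ : s < 1) {δ : ℝ} (hδ : 0 < δ)
    {φ u : E → ℝ} (hφ : ContDiff ℝ 2 φ) (hu : IsLineBounded u) (c x z : E) (a γ : ℝ) :
    dirLap s δ (fun y => φ y + γ * ‖y - c‖ ^ 2) u x z a
      = dirLap s δ φ u x z a + γ * (2 * ‖z‖ ^ 2 * (δ ^ (2 - 2 * s) / (2 - 2 * s))) := by
  unfold dirLap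
  rw [← integral_indicator_Iio_sq hs₁ hδ, ← integral_const_mul, ← integral_const_mul,
    ← integral_add (integrable_dirLapIntegrand hs₀ hs₁ hδ hφ hu x z a)
      (((integrable_indicator_Iio_sq hs₁ hδ).const_mul _).const_mul _)]
  congr 1
  ext t
  unfold dirLapIntegrand
  by_cases h : t < δ
  · have hsq := secondDiff_norm_sub_sq c x z t
    rw [if_pos h, if_pos h, indicator_of_mem (mem_Iio.2 h)]
    unfold secondDiff at hsq ⊢
    linear_combination γ * hsq
  · rw [if_neg h, if_neg h, indicator_of_notMem (by simpa using h)]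
    ring

/-- If the subsolution test fails at `x₀`, subtracting a small multiple of `‖x - x₀‖ ^ 2` makes the
touching strict, and semicontinuity makes it fail on a whole neighbourhood of `x₀`. -/
lemma isSubsolOn_of_strict_touching {s : ℝ} (hs₀ : 0 < s) (hs₁ : s < 1) {X : Set E} {U : E → ℝ}
    (hU : UpperSemicontinuous U) (hb : ∃ M : ℝ, ∀ x, |U x| ≤ M)
    (h : ∀ x₀ ∈ X, ∀ (φ : E → ℝ) (z : E) (r γ δ ρ : ℝ), ContDiff ℝ 2 φ → φ x₀ = U x₀ → 0 < γ →
      (∀ x ∈ Metric.ball x₀ r, U x ≤ φ x - γ * ‖x - x₀‖ ^ 2) → 0 < δ → ‖z‖ = 1 → 2 * δ ≤ r →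
      0 < ρ → (∀ x ∈ Metric.ball x₀ ρ, ∀ a, U x₀ - ρ < a → dirLap s δ φ U x z a < 0) → False) :
    IsSubsolOn s X U := by
  refine isSubsolOn_of_forall_norm_eq_one fun x₀ hx₀ φ r hφ h0 hle z δ hδ hz hr => ?_
  by_contra! hneg
  have hline := IsLineBounded.of_upperSemicontinuous hU hb
  have hhalf : dirLap s (δ / 2) φ U x₀ z (U x₀) < 0 :=
    (dirLap_le_dirLap_of_le_testFun hs₀ hs₁ (half_pos hδ) (half_le_self hδ.le) hφ hline h0
      (by rwa [hz, mul_one]) hle).trans_lt hneg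
  obtain ⟨γ, hγ, hγ'⟩ := exists_pos_mul_lt (neg_pos.2 hhalf)
    (2 * ‖z‖ ^ 2 * ((δ / 2) ^ (2 - 2 * s) / (2 - 2 * s)))
  set ψ : E → ℝ := fun y => φ y + γ * ‖y - x₀‖ ^ 2 with hψ
  have hψC : ContDiff ℝ 2 ψ := hφ.add (contDiff_const.mul (contDiff_norm_sub_sq x₀))
  have hψneg : dirLap s (δ / 2) ψ U x₀ z (U x₀) < 0 := by
    rw [hψ, dirLap_add_mul_norm_sub_sq hs₀ hs₁ (half_pos hδ) hφ hline]
    linarith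
  obtain ⟨ρ, hρ, hball⟩ := Metric.eventually_nhds_iff_ball.1
    (eventually_dirLap_lt hs₀ hs₁ (half_pos hδ) hψC hU hb hψneg)
  refine h x₀ hx₀ ψ z r γ (δ / 2) (ρ / 2) hψC (by simp [hψ, h0]) hγ
    (fun x hx => by simpa [hψ] using hle x hx) (half_pos hδ) hz (by linarith) (half_pos hρ)
    fun x hx a ha => ?_
  refine (dirLap_antitone hs₀ hs₁ (half_pos hδ) hψC hline x z ha.le).trans_lt
    (hball (x, z, U x₀ - ρ / 2) ?_)
  rw [Metric.mem_ball] at hx ⊢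
  rw [Prod.dist_eq, Prod.dist_eq, dist_self, Real.dist_eq]
  refine max_lt (by linarith) (max_lt hρ ?_)
  rw [show U x₀ - ρ / 2 - U x₀ = -(ρ / 2) by ring, abs_neg, abs_of_pos (half_pos hρ)]
  linarith

end Touching

/-! ### Steep touching at a boundary jump -/

section Boundary

lemma exists_forall_le_rpow_neg {s : ℝ} (hs₀ : 0 < s) (Y : ℝ) :
    ∃ τ : ℝ, 0 < τ ∧ ∀ T, 0 < T → T ≤ τ → Y ≤ T ^ (-(2 * s)) := by
  have h := (tendsto_rpow_neg_nhdsGT_zero (by linarith : -(2 * s) < 0)).eventually_ge_atTop Y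
  obtain ⟨τ, hτ, hsub⟩ := (mem_nhdsGT_iff_exists_Ioc_subset).1 h
  exact ⟨τ, hτ, fun T h0 h1 => hsub ⟨h0, h1⟩⟩

lemma integral_kernelMeasure_le_of_profile {s : ℝ} (hs₀ : 0 < s) (hs₁ : s < 1) {F : ℝ → ℝ}
    (hF : Integrable F (kernelMeasure s)) {A B D S T R : ℝ} (hS : 0 < S) (hST : S ≤ T) (hTR : T ≤ R)
    (hnear : ∀ t, 0 < t → t < S → F t ≤ A * t ^ 2) (hflat : ∀ t, S ≤ t → t < T → F t ≤ 0)
    (hdrop : ∀ t, T ≤ t → t < R → F t ≤ -B) (hfar : ∀ t, R ≤ t → F t ≤ D) :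
    ∫ t, F t ∂kernelMeasure s ≤ A * (S ^ (2 - 2 * s) / (2 - 2 * s)) - B * (T ^ (-(2 * s)) / (2 * s))
      + (B + D) * (R ^ (-(2 * s)) / (2 * s)) := by
  have hT : 0 < T := hS.trans_le hST
  have hR : 0 < R := hT.trans_le hTR
  have hi₁ := (integrable_indicator_Iio_sq hs₁ hS).const_mul A
  have hi₂ := (integrable_indicator_Ici hs₀ hT).const_mul B
  have hi₃ := (integrable_indicator_Ici hs₀ hR).const_mul (B + D)
  rw [← integral_indicator_Iio_sq hs₁ hS, ← integral_indicator_Ici hs₀ hT,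
    ← integral_indicator_Ici hs₀ hR, ← integral_const_mul, ← integral_const_mul,
    ← integral_const_mul, ← integral_sub hi₁ hi₂]
  refine le_of_le_of_eq ?_ (integral_add (hi₁.sub hi₂) hi₃)
  refine integral_kernelMeasure_mono hF ((hi₁.sub hi₂).add hi₃) fun t ht => ?_
  simp only [indicator, mem_Iio, mem_Ici]
  rcases lt_or_ge t T with hlt | hge
  · rw [if_neg (not_le.2 hlt), if_neg (not_le.2 (hlt.trans_le hTR))]
    rcases lt_or_ge t S with hlt' | hge
    · rw [if_pos hlt']
      linarith [hnear t ht hlt']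
    · rw [if_neg (not_lt.2 hge)]
      linarith [hflat t hge hlt]
  · rw [if_neg (not_lt.2 (hST.trans hge)), if_pos hge]
    rcases lt_or_ge t R with hlt | hge'
    · rw [if_neg (not_le.2 hlt)]
      linarith [hdrop t hge hlt]
    · rw [if_pos hge']
      linarith [hfar t hge']

variable {E : Type*} [NormedAddCommGroup E]

lemma exists_radius_of_jump {Ω : Set E} {g U : E → ℝ} (hg : ContinuousOn g Ωᶜ)
    (hU : UpperSemicontinuous U) (hext : ∀ x ∉ closure Ω, U x ≤ g x) {x₀ : E} (hx₀ : x₀ ∈ Ωᶜ)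
    {η σ : ℝ} (hη : 0 < η) (hσ : 0 < σ) :
    ∃ ρ : ℝ, 0 < ρ ∧ (∀ x ∈ Metric.closedBall x₀ ρ, U x < U x₀ + σ) ∧
      (∀ x ∈ Metric.closedBall x₀ ρ, x ∈ Ωᶜ → g x < g x₀ + η) ∧
      ∀ x ∈ Metric.closedBall x₀ ρ, x ∉ closure Ω → U x < g x₀ + η := by
  have hUnear : ∀ᶠ x in 𝓝 x₀, U x < U x₀ + σ := hU x₀ _ (by linarith)
  have hgnear : ∀ᶠ x in 𝓝 x₀, x ∈ Ωᶜ → g x < g x₀ + η :=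
    eventually_nhdsWithin_iff.1 ((hg x₀ hx₀).eventually (gt_mem_nhds (by linarith)))
  obtain ⟨ρ, hρ, h⟩ := Metric.nhds_basis_closedBall.eventually_iff.1 (hUnear.and hgnear)
  exact ⟨ρ, hρ, fun x hx => (h hx).1, fun x hx => (h hx).2, fun x hx hxΩ =>
    (hext x hxΩ).trans_lt ((h hx).2 fun hmem => hxΩ (subset_closure hmem))⟩

variable [NormedSpace ℝ E]

/-- Bounded strictly convex domains: `IsStrictlyConvexC2Domain` without the regularity of the
boundary, in any normed space. Strict convexity is again that of the closure. -/
structure IsStrictlyConvexDomain (Ω : Set E) : Prop where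
  isOpen : IsOpen Ω
  nonempty : Ω.Nonempty
  bounded : Bornology.IsBounded Ω
  convex : Convex ℝ Ω
  strictConvex : StrictConvex ℝ (closure Ω)

lemma IsStrictlyConvexDomain.openSegment_subset {Ω : Set E}
    (hΩ : IsStrictlyConvexDomain Ω) {x y : E} (hx : x ∈ closure Ω) (hy : y ∈ closure Ω)
    (hxy : x ≠ y) : openSegment ℝ x y ⊆ Ω := by
  have hinterior : interior (closure Ω) = Ω := by
    rw [hΩ.convex.interior_closure_eq_interior_of_nonempty_interior
      (by rw [hΩ.isOpen.interior_eq]; exact hΩ.nonempty), hΩ.isOpen.interior_eq]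
  rw [← hinterior]
  exact hΩ.strictConvex.openSegment_subset hx hy hxy

lemma IsStrictlyConvexDomain.exists_supporting_functional {Ω : Set E}
    (hΩ : IsStrictlyConvexDomain Ω) {x₀ : E} (hx₀ : x₀ ∈ frontier Ω) :
    ∃ ℓ : E →L[ℝ] ℝ, ‖ℓ‖ ≤ 1 ∧ ∀ x ∈ closure Ω, x ≠ x₀ → ℓ x₀ < ℓ x := by
  rw [hΩ.isOpen.frontier_eq] at hx₀
  obtain ⟨f, hf⟩ := geometric_hahn_banach_open_point hΩ.convex hΩ.isOpen hx₀.2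
  have hfc : ∀ x ∈ closure Ω, f x ≤ f x₀ := fun x hx =>
    closure_minimal (fun a ha => (hf a ha).le) (isClosed_le f.continuous continuous_const) hx
  refine ⟨-((‖f‖ + 1)⁻¹ • f), ?_, fun x hx hne => ?_⟩
  · rw [norm_neg, norm_smul, norm_inv, Real.norm_eq_abs, abs_of_pos (by positivity),
      inv_mul_le_one₀ (by positivity)]
    linarith
  · have hlt : f x < f x₀ := by
      refine (hfc x hx).lt_of_ne fun heq => ?_
      have hmid := hΩ.openSegment_subset hx hx₀.1 hne
        (⟨1 / 2, 1 / 2, by norm_num, by norm_num, by norm_num, rfl⟩ :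
          (1 / 2 : ℝ) • x + (1 / 2 : ℝ) • x₀ ∈ openSegment ℝ x x₀)
      have := hf _ hmid
      rw [map_add, map_smul, map_smul, heq, smul_eq_mul] at this
      linarith
    simp only [neg_apply, smul_apply, smul_eq_mul]
    have : 0 < (‖f‖ + 1)⁻¹ := by positivity
    nlinarith

lemma dirLap_le_of_drop [FiniteDimensional ℝ E] {s : ℝ} (hs₀ : 0 < s) (hs₁ : s < 1) {U φ : E → ℝ}
    (hU : IsLineBounded U) {M : ℝ} (hM : ∀ x, |U x| ≤ M) (hφ : ContDiff ℝ 2 φ) {x z : E}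
    (hz : ‖z‖ = 1) (hx : φ x = U x) {A B δ T R : ℝ} (hδ : 0 < δ) (hδT : δ ≤ T) (hTR : T ≤ R)
    (hA : ∀ t, secondDiff φ x z t ≤ A * t ^ 2) (htouch : ∀ y ∈ Metric.closedBall x R, U y ≤ φ y)
    (hdrop : ∀ t, T ≤ t → t < R → U (x + t • z) + U (x - t • z) - 2 * U x ≤ -B) :
    dirLap s δ φ U x z (U x) ≤ A * (T ^ (2 - 2 * s) / (2 - 2 * s)) - B * (T ^ (-(2 * s)) / (2 * s))
      + (B + 4 * M) * (R ^ (-(2 * s)) / (2 * s)) := by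
  refine integral_kernelMeasure_le_of_profile hs₀ hs₁
    (integrable_dirLapIntegrand hs₀ hs₁ hδ hφ hU x z (U x)) (hδ.trans_le hδT) le_rfl
    hTR (fun t ht htT => ?_) (fun t hTt htT => absurd htT hTt.not_gt)
    (fun t htT htR => ?_) (fun t htR => ?_)
  · have hnorm : ‖t • z‖ ≤ R := by
      rw [norm_smul, hz, mul_one, Real.norm_eq_abs, abs_of_pos ht]
      exact htT.le.trans hTR
    have hplus := htouch (x + t • z) (by simpa using hnorm)
    have hminus := htouch (x - t • z) (by simpa using hnorm)
    refine le_trans ?_ (hA t)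
    unfold dirLapIntegrand secondDiff
    split_ifs <;> linarith
  · rw [dirLapIntegrand, if_neg (not_lt.2 (hδT.trans htT))]
    exact hdrop t htT htR
  · rw [dirLapIntegrand, if_neg (not_lt.2 ((hδT.trans hTR).trans htR))]
    linarith [(abs_le.1 (hM (x + t • z))).2, (abs_le.1 (hM (x - t • z))).2, (abs_le.1 (hM x)).1]

lemma profile_le_neg_one {s A T η σ K : ℝ} (hs₀ : 0 < s) (hs₁ : s < 1) (hη : 0 < η) (hT : 0 < T)
    (hA : A * T ^ 2 ≤ 8 * σ) (hσ : 8 * σ / (2 - 2 * s) ≤ η / (8 * s))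
    (hTK : (K + 1) * (8 * s) / η ≤ T ^ (-(2 * s))) :
    A * (T ^ (2 - 2 * s) / (2 - 2 * s)) - η / 2 * (T ^ (-(2 * s)) / (2 * s)) + K ≤ -1 := by
  have hsplit : T ^ (2 - 2 * s) = T ^ 2 * T ^ (-(2 * s)) := by
    rw [sub_eq_add_neg, Real.rpow_add hT, Real.rpow_ofNat]
  set P := T ^ (-(2 * s))
  have hs : 0 < 2 - 2 * s := by linarith
  have hnear : A * (T ^ (2 - 2 * s) / (2 - 2 * s)) ≤ η / (8 * s) * P := by
    calc A * (T ^ (2 - 2 * s) / (2 - 2 * s)) = A * T ^ 2 / (2 - 2 * s) * P := by rw [hsplit]; ring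
      _ ≤ 8 * σ / (2 - 2 * s) * P := by gcongr
      _ ≤ η / (8 * s) * P := by gcongr
  have hK : K + 1 ≤ η / (8 * s) * P := by
    calc K + 1 = η / (8 * s) * ((K + 1) * (8 * s) / η) := by field_simp
      _ ≤ η / (8 * s) * P := by gcongr
  have hdrop : η / 2 * (P / (2 * s)) = 2 * (η / (8 * s) * P) := by field_simp; ring
  linarith

lemma exists_exit_time {Ω : Set E} {x₀ x₁ : E} {ℓ : E →L[ℝ] ℝ} (hℓ₁ : ‖ℓ‖ ≤ 1)
    (hℓ : ∀ x ∈ closure Ω, ℓ x₀ ≤ ℓ x) {ε τ : ℝ} (hε : 0 < ε) (hετ : 2 * ε ≤ τ)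
    (hslice : ∀ x ∈ closure Ω, ℓ x - ℓ x₀ ≤ ε → ‖x - x₀‖ < τ / 2) (hx₁ : ‖x₁ - x₀‖ < τ / 2)
    (hℓx₁ : ℓ x₁ - ℓ x₀ < ε) {z : E} (hz : ‖z‖ = 1) (hℓz : 0 ≤ ℓ z) :
    ∃ T, 2 * ε ≤ T ∧ T ≤ τ ∧ ℓ z * T ≤ 2 * ε ∧ ∀ t, T ≤ t → x₁ - t • z ∉ closure Ω := by
  have hτ : 0 < τ := by linarith
  have hℓz₁ : ℓ z ≤ 1 := (le_abs_self _).trans ((ℓ.le_opNorm z).trans (by rwa [hz, mul_one]))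
  set β := max (ℓ z) (2 * ε / τ) with hβ
  have hβ₀ : 0 < β := lt_max_of_lt_right (by positivity)
  have hβ₁ : β ≤ 1 := max_le hℓz₁ (by rwa [div_le_one hτ])
  have hτβ : 2 * ε ≤ τ * β := (div_le_iff₀' hτ).1 (le_max_right _ _)
  refine ⟨2 * ε / β, le_div_self (by positivity) hβ₀ hβ₁, (div_le_iff₀ hβ₀).2 hτβ, ?_,
    fun t ht hmem => ?_⟩
  · rw [← mul_div_assoc, div_le_iff₀ hβ₀, mul_comm]
    exact mul_le_mul_of_nonneg_left (le_max_left _ _) (by positivity)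
  · have ht₀ : 0 < t := lt_of_lt_of_le (by positivity) ht
    have hℓt : ℓ (x₁ - t • z) = ℓ x₁ - t * ℓ z := by rw [map_sub, map_smul, smul_eq_mul]
    have hin : ‖x₁ - t • z - x₀‖ < τ / 2 :=
      hslice _ hmem (by rw [hℓt]; linarith [mul_nonneg ht₀.le hℓz])
    have htτ : t < τ := by
      have hsub := norm_sub_le (x₁ - x₀) (x₁ - t • z - x₀)
      rw [sub_sub_sub_cancel_right, sub_sub_cancel, norm_smul, hz, mul_one, Real.norm_eq_abs,
        abs_of_pos ht₀] at hsub
      linarith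
    have htℓ : t * ℓ z < 2 * ε := by linarith [hℓ _ hmem]
    have htε : t * (2 * ε / τ) < 2 * ε := by
      rw [← mul_div_assoc, div_lt_iff₀ hτ, mul_comm]
      exact mul_lt_mul_of_pos_left htτ (by linarith)
    have htβ : t * β < 2 * ε := by
      rcases max_choice (ℓ z) (2 * ε / τ) with h | h <;> rw [hβ, h] <;> assumption
    exact htβ.not_ge ((div_le_iff₀ hβ₀).1 ht)

/-- Squared height of `x` above the hyperplane `ℓ = ℓ x₀`, in units of `ε`: the profile of the
functions that touch a boundary jump at `x₀` from above. -/
noncomputable def slabSq (ℓ : E →L[ℝ] ℝ) (x₀ : E) (ε : ℝ) (x : E) : ℝ := ((ℓ x - ℓ x₀) / ε) ^ 2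

lemma contDiff_slabSq (ℓ : E →L[ℝ] ℝ) (x₀ : E) (ε : ℝ) : ContDiff ℝ 2 (slabSq ℓ x₀ ε) := by
  have : ContDiff ℝ 2 fun x => ℓ x := ℓ.contDiff
  unfold slabSq
  fun_prop

lemma secondDiff_add_mul_slabSq (ℓ : E →L[ℝ] ℝ) (x₀ : E) (ε σ a b : ℝ) (x z : E) (t : ℝ) :
    secondDiff (fun y => a + σ * (slabSq ℓ x₀ ε y - b)) x z t = 2 * σ * (ℓ z / ε) ^ 2 * t ^ 2 := by
  simp only [secondDiff, slabSq, map_add, map_sub, map_smul, smul_eq_mul]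
  ring

variable [FiniteDimensional ℝ E]

lemma exists_slice_subset_ball {Ω : Set E} (hΩb : Bornology.IsBounded Ω) {x₀ : E} {ℓ : E →L[ℝ] ℝ}
    (hℓ : ∀ x ∈ closure Ω, x ≠ x₀ → ℓ x₀ < ℓ x) {τ : ℝ} (hτ : 0 < τ) :
    ∃ ε : ℝ, 0 < ε ∧ ∀ x ∈ closure Ω, ℓ x - ℓ x₀ ≤ ε → ‖x - x₀‖ < τ := by
  have hK : IsCompact (closure Ω \ Metric.ball x₀ τ) :=
    hΩb.isCompact_closure.diff Metric.isOpen_ball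
  rcases (closure Ω \ Metric.ball x₀ τ).eq_empty_or_nonempty with he | hne
  · refine ⟨1, one_pos, fun x hx _ => ?_⟩
    by_contra h
    have : x ∈ closure Ω \ Metric.ball x₀ τ := ⟨hx, by rwa [mem_ball_iff_norm]⟩
    rw [he] at this
    exact this
  · obtain ⟨y, hy, hmin⟩ := hK.exists_isMinOn hne ℓ.continuous.continuousOn
    have hyx : y ≠ x₀ := by
      rintro rfl; exact hy.2 (Metric.mem_ball_self hτ)
    have hpos := hℓ y hy.1 hyx
    refine ⟨(ℓ y - ℓ x₀) / 2, by linarith, fun x hx hle => ?_⟩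
    by_contra h
    have : ℓ y ≤ ℓ x := hmin (⟨hx, by rwa [mem_ball_iff_norm]⟩ : x ∈ closure Ω \ _)
    linarith

lemma exists_slabSq_touching {U : E → ℝ} (hU : UpperSemicontinuous U) (ℓ : E →L[ℝ] ℝ) {x₀ : E}
    {ε ρ σ : ℝ} (hε : 0 < ε) (hρ : 0 < ρ) (hσ : 0 < σ)
    (hUρ : ∀ x ∈ Metric.closedBall x₀ ρ, U x < U x₀ + σ) :
    ∃ x₁ ∈ Metric.closedBall x₀ ρ, U x₀ ≤ U x₁ ∧ ℓ x₁ - ℓ x₀ < ε ∧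
      ∀ x ∈ Metric.closedBall x₀ ρ, U x ≤ U x₁ + σ * (slabSq ℓ x₀ ε x - slabSq ℓ x₀ ε x₁) := by
  have hx₀ := Metric.mem_closedBall_self (x := x₀) hρ.le
  have hcont : Continuous fun x => -(σ * slabSq ℓ x₀ ε x) :=
    (continuous_const.mul (contDiff_slabSq ℓ x₀ ε).continuous).neg
  obtain ⟨x₁, hx₁, hmax⟩ := UpperSemicontinuousOn.exists_isMaxOn ⟨x₀, hx₀⟩
    (isCompact_closedBall x₀ ρ) ((hU.add hcont.upperSemicontinuous).upperSemicontinuousOn _)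
  have htouch : ∀ x ∈ Metric.closedBall x₀ ρ,
      U x ≤ U x₁ + σ * (slabSq ℓ x₀ ε x - slabSq ℓ x₀ ε x₁) := fun x hx => by
    have := hmax hx
    simp only [mem_ofPred_eq] at this
    linarith
  have hval : U x₀ + σ * slabSq ℓ x₀ ε x₁ ≤ U x₁ := by
    have hzero : slabSq ℓ x₀ ε x₀ = 0 := by simp [slabSq]
    have := htouch x₀ hx₀
    rw [hzero] at this
    linarith
  have hpos : 0 ≤ σ * slabSq ℓ x₀ ε x₁ := mul_nonneg hσ.le (sq_nonneg _)
  have hlt : slabSq ℓ x₀ ε x₁ < 1 := by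
    refine lt_of_mul_lt_mul_left ?_ hσ.le
    linarith [hUρ x₁ hx₁]
  refine ⟨x₁, hx₁, by linarith, ?_, htouch⟩
  exact (div_lt_one hε).1 (abs_lt.1 ((sq_lt_one_iff_abs_lt_one _).1 hlt)).2

lemma exists_opening {s η : ℝ} (hs₀ : 0 < s) (hs₁ : s < 1) (hη : 0 < η) :
    ∃ σ : ℝ, 0 < σ ∧ σ ≤ η / 4 ∧ 8 * σ / (2 - 2 * s) ≤ η / (8 * s) := by
  have hs : 0 < 2 - 2 * s := by linarith
  refine ⟨min (η / 4) (η / (8 * s) * (2 - 2 * s) / 8), lt_min (by positivity) (by positivity),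
    min_le_left _ _, ?_⟩
  rw [div_le_iff₀ hs]
  linarith [min_le_right (η / 4) (η / (8 * s) * (2 - 2 * s) / 8)]

lemma exists_slabSq_touching_of_closure {Ω : Set E} (hΩb : Bornology.IsBounded Ω) {U : E → ℝ}
    (hU : UpperSemicontinuous U) {ℓ : E →L[ℝ] ℝ} (hℓ₁ : ‖ℓ‖ ≤ 1) {x₀ : E}
    (hℓ : ∀ x ∈ closure Ω, x ≠ x₀ → ℓ x₀ < ℓ x) {ρ σ τ : ℝ} (hρ : 0 < ρ) (hσ : 0 < σ)
    (hτ : 0 < τ) (hUρ : ∀ x ∈ Metric.closedBall x₀ ρ, U x < U x₀ + σ)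
    (hUout : ∀ x ∈ Metric.closedBall x₀ ρ, x ∉ closure Ω → U x < U x₀) :
    ∃ ε, 0 < ε ∧ 2 * ε ≤ τ ∧ ∃ x₁ ∈ closure Ω, ‖x₁ - x₀‖ < τ / 2 ∧ U x₀ ≤ U x₁ ∧
      (∀ x ∈ Metric.closedBall x₀ ρ, U x ≤ U x₁ + σ * (slabSq ℓ x₀ ε x - slabSq ℓ x₀ ε x₁)) ∧
      ∀ z, ‖z‖ = 1 → 0 ≤ ℓ z →
        ∃ T, 2 * ε ≤ T ∧ T ≤ τ ∧ ℓ z * T ≤ 2 * ε ∧ ∀ t, T ≤ t → x₁ - t • z ∉ closure Ω := by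
  have hℓle : ∀ x ∈ closure Ω, ℓ x₀ ≤ ℓ x := fun x hx =>
    (eq_or_ne x x₀).elim (fun h => h ▸ le_rfl) fun h => (hℓ x hx h).le
  obtain ⟨ε₀, hε₀, hε₀slice⟩ := exists_slice_subset_ball hΩb hℓ (half_pos hτ)
  obtain ⟨ε, hε, hεε₀, hετ⟩ : ∃ ε : ℝ, 0 < ε ∧ ε ≤ ε₀ ∧ 2 * ε ≤ τ :=
    ⟨min ε₀ (τ / 2), lt_min hε₀ (half_pos hτ), min_le_left _ _,
      by linarith [min_le_right ε₀ (τ / 2)]⟩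
  have hslice : ∀ x ∈ closure Ω, ℓ x - ℓ x₀ ≤ ε → ‖x - x₀‖ < τ / 2 := fun x hx h =>
    hε₀slice x hx (h.trans hεε₀)
  obtain ⟨x₁, hx₁ρ, hUx₁, hℓx₁, htouch⟩ := exists_slabSq_touching hU ℓ hε hρ hσ hUρ
  have hx₁cl : x₁ ∈ closure Ω := by
    by_contra h
    linarith [hUout x₁ hx₁ρ h]
  have hx₁near := hslice x₁ hx₁cl hℓx₁.le
  exact ⟨ε, hε, hετ, x₁, hx₁cl, hx₁near, hUx₁, htouch, fun z hz hℓz =>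
    exists_exit_time hℓ₁ hℓle hε hετ hslice hx₁near hℓx₁ hz hℓz⟩

lemma dirLap_slabSq_le_neg_one {s : ℝ} (hs₀ : 0 < s) (hs₁ : s < 1) {U : E → ℝ}
    (hU : IsLineBounded U) {M : ℝ} (hM : ∀ x, |U x| ≤ M) {ℓ : E →L[ℝ] ℝ} {x₀ x z : E}
    {ε η σ T R : ℝ} (hη : 0 < η) (hε : 0 < ε) (hσ : 0 < σ) (hεT : 2 * ε ≤ T) (hTR : T ≤ R)
    (hz : ‖z‖ = 1) (hℓz : 0 ≤ ℓ z) (hℓT : ℓ z * T ≤ 2 * ε)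
    (htouch : ∀ y ∈ Metric.closedBall x R, U y ≤ U x + σ * (slabSq ℓ x₀ ε y - slabSq ℓ x₀ ε x))
    (hdrop : ∀ t, T ≤ t → t < R → U (x + t • z) + U (x - t • z) - 2 * U x ≤ -(η / 2))
    (hσs : 8 * σ / (2 - 2 * s) ≤ η / (8 * s))
    (hTpow : ((η / 2 + 4 * M) * (R ^ (-(2 * s)) / (2 * s)) + 1) * (8 * s) / η ≤ T ^ (-(2 * s))) :
    dirLap s (2 * ε) (fun y => U x + σ * (slabSq ℓ x₀ ε y - slabSq ℓ x₀ ε x)) U x z (U x)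
      ≤ -1 := by
  have hT : 0 < T := by linarith
  have hφ : ContDiff ℝ 2 fun y => U x + σ * (slabSq ℓ x₀ ε y - slabSq ℓ x₀ ε x) := by
    have := contDiff_slabSq ℓ x₀ ε
    fun_prop
  have hopening : 2 * σ * (ℓ z / ε) ^ 2 * T ^ 2 ≤ 8 * σ := by
    have hle : ℓ z / ε * T ≤ 2 := by rwa [div_mul_eq_mul_div, div_le_iff₀ hε]
    have hsq : (ℓ z / ε * T) ^ 2 ≤ 2 ^ 2 := pow_le_pow_left₀ (by positivity) hle 2
    nlinarith
  exact (dirLap_le_of_drop hs₀ hs₁ hU hM hφ hz (by simp) (by linarith) hεT hTR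
    (fun t => (secondDiff_add_mul_slabSq ℓ x₀ ε σ (U x) _ x z t).le) htouch hdrop).trans
    (profile_le_neg_one hs₀ hs₁ hη hT hopening hσs hTpow)

/-- The slab `ℓ - ℓ x₀ < ε` meets `Ω` in a small set only, so a line through a point of it leaves
`Ω` on one side after a short time; beyond that time the jump makes the second difference at most
`-η / 2`, which outweighs the opening of the touching parabola. -/
lemma exists_steep_touching {s : ℝ} (hs₀ : 0 < s) (hs₁ : s < 1) {Ω : Set E}
    (hΩ : IsStrictlyConvexDomain Ω) {g U : E → ℝ} (hg : ContinuousOn g Ωᶜ)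
    (hU : UpperSemicontinuous U) (hb : ∃ M : ℝ, ∀ x, |U x| ≤ M)
    (hext : ∀ x ∉ closure Ω, U x ≤ g x) {x₀ : E} (hx₀ : x₀ ∈ frontier Ω) (hgt : g x₀ < U x₀) :
    ∃ x₁, (x₁ ∈ Ω ∨ x₁ ∈ frontier Ω ∧ g x₁ < U x₁) ∧ ∃ (φ : E → ℝ) (r δ : ℝ),
      ContDiff ℝ 2 φ ∧ φ x₁ = U x₁ ∧ (∀ x ∈ Metric.ball x₁ r, U x ≤ φ x) ∧ 0 < δ ∧ δ ≤ r ∧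
      ∀ z : E, ‖z‖ = 1 → dirLap s δ φ U x₁ z (U x₁) ≤ -1 := by
  have hL := IsLineBounded.of_upperSemicontinuous hU hb
  obtain ⟨M, hM⟩ := hb
  obtain ⟨ℓ, hℓ₁, hℓ⟩ := hΩ.exists_supporting_functional hx₀
  have hx₀Ω : x₀ ∈ Ωᶜ := (hΩ.isOpen.frontier_eq ▸ hx₀).2
  set η := U x₀ - g x₀
  have hη₀ : 0 < η := sub_pos.2 hgt
  obtain ⟨σ, hσ₀, hση, hσs⟩ := exists_opening hs₀ hs₁ hη₀
  obtain ⟨ρ, hρ, hUρ, hgρ, hUout⟩ := exists_radius_of_jump hg hU hext hx₀Ω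
    (by linarith : 0 < η / 4) hσ₀
  obtain ⟨τ₀, hτ₀, hτpow⟩ := exists_forall_le_rpow_neg hs₀
    (((η / 2 + 4 * M) * ((ρ / 2) ^ (-(2 * s)) / (2 * s)) + 1) * (8 * s) / η)
  obtain ⟨τ, hτ, hττ₀, hτρ⟩ : ∃ τ : ℝ, 0 < τ ∧ τ ≤ τ₀ ∧ τ ≤ ρ / 2 :=
    ⟨min τ₀ (ρ / 2), lt_min hτ₀ (half_pos hρ), min_le_left _ _, min_le_right _ _⟩
  obtain ⟨ε, hε, hετ, x₁, hx₁cl, hx₁near, hUx₁, htouch, hexit⟩ := exists_slabSq_touching_of_closure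
    hΩ.bounded hU hℓ₁ hℓ hρ hσ₀ hτ hUρ fun x hx hxΩ => (hUout x hx hxΩ).trans (by linarith)
  have hball : Metric.closedBall x₁ (ρ / 2) ⊆ Metric.closedBall x₀ ρ :=
    Metric.closedBall_subset_closedBall' (by rw [dist_eq_norm]; linarith)
  set φ : E → ℝ := fun x => U x₁ + σ * (slabSq ℓ x₀ ε x - slabSq ℓ x₀ ε x₁)
  have hφ : ContDiff ℝ 2 φ := by
    have := contDiff_slabSq ℓ x₀ ε
    fun_prop
  refine ⟨x₁, ?_, φ, ρ / 2, 2 * ε, hφ, by simp [φ], fun x hx => htouch x (hball ?_),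
    by linarith, hετ.trans hτρ, fun z hz => ?_⟩
  · by_cases h : x₁ ∈ Ω
    · exact Or.inl h
    · have hgx₁ := hgρ x₁ (hball (Metric.mem_closedBall_self (half_pos hρ).le)) h
      exact Or.inr ⟨hΩ.isOpen.frontier_eq ▸ ⟨hx₁cl, h⟩, by linarith⟩
  · exact Metric.ball_subset_closedBall hx
  wlog hℓz : 0 ≤ ℓ z generalizing z
  · rw [← dirLap_neg_dir]
    exact this (-z) (by rwa [norm_neg]) (by rw [map_neg]; linarith)
  obtain ⟨T, hεT, hTτ, hℓT, hout⟩ := hexit z hz hℓz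
  have hT : 0 < T := by linarith
  have hdrop : ∀ t, T ≤ t → t < ρ / 2 → U (x₁ + t • z) + U (x₁ - t • z) - 2 * U x₁ ≤ -(η / 2) := by
    intro t hTt htρ
    have hnorm : ‖t • z‖ ≤ ρ / 2 := by
      rw [norm_smul, hz, mul_one, Real.norm_eq_abs, abs_of_pos (hT.trans_le hTt)]
      exact htρ.le
    have hplus := hUρ (x₁ + t • z) (hball (by simpa using hnorm))
    have hminus := hUout (x₁ - t • z) (hball (by simpa using hnorm)) (hout t hTt)
    linarith
  exact dirLap_slabSq_le_neg_one hs₀ hs₁ hL hM hη₀ hε hσ₀ hεT (hTτ.trans hτρ) hz hℓz hℓT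
    (fun x hx => htouch x (hball hx)) hdrop hσs (hτpow T hT (hTτ.trans hττ₀))

end Boundary

/-! ### Comparison -/

section BoundaryDatum

variable {E : Type*} [NormedAddCommGroup E] [NormedSpace ℝ E] [FiniteDimensional ℝ E]

lemma IsSubsolOn.le_datum [Nontrivial E] {s : ℝ} (hs₀ : 0 < s) (hs₁ : s < 1) {Ω : Set E}
    (hΩ : IsStrictlyConvexDomain Ω) {g U : E → ℝ} (hg : ContinuousOn g Ωᶜ)
    (hU : UpperSemicontinuous U) (hb : ∃ M : ℝ, ∀ x, |U x| ≤ M)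
    (hext : ∀ x ∉ closure Ω, U x ≤ g x)
    (h : IsSubsolOn s {x | x ∈ Ω ∨ x ∈ frontier Ω ∧ g x < U x} U) :
    ∀ x ∉ Ω, U x ≤ g x := by
  intro x hxΩ
  by_cases hxc : x ∉ closure Ω
  · exact hext x hxc
  have hx : x ∈ frontier Ω := hΩ.isOpen.frontier_eq ▸ ⟨not_not.1 hxc, hxΩ⟩
  by_contra! hgt
  obtain ⟨x₁, hx₁, φ, r, δ, hφ, h0, hle, hδ, hr, hop⟩ := exists_steep_touching hs₀ hs₁ hΩ
    hg hU hb hext hx hgt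
  obtain ⟨z, hz⟩ := exists_norm_eq E zero_le_one
  linarith [hop z hz, h x₁ hx₁ φ r hφ h0 hle z δ hδ (by rwa [hz, mul_one])]

lemma IsSupersolOn.datum_le {s : ℝ} (hs₀ : 0 < s) (hs₁ : s < 1) {Ω : Set E}
    (hΩ : IsStrictlyConvexDomain Ω) {g V : E → ℝ} (hg : ContinuousOn g Ωᶜ)
    (hV : LowerSemicontinuous V) (hb : ∃ M : ℝ, ∀ x, |V x| ≤ M) (hext : ∀ x ∉ closure Ω, g x ≤ V x)
    (h : IsSupersolOn s {x | x ∈ Ω ∨ x ∈ frontier Ω ∧ V x < g x} V) :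
    ∀ x ∉ Ω, g x ≤ V x := by
  intro x hxΩ
  by_cases hxc : x ∉ closure Ω
  · exact hext x hxc
  have hx : x ∈ frontier Ω := hΩ.isOpen.frontier_eq ▸ ⟨not_not.1 hxc, hxΩ⟩
  by_contra! hgt
  obtain ⟨x₁, hx₁, φ, r, δ, hφ, h0, hle, hδ, hr, hop⟩ := exists_steep_touching hs₀ hs₁ hΩ
    (g := -g) (U := -V) hg.neg (upperSemicontinuous_neg hV) (by simpa using hb)
    (by simpa using hext) hx (by simpa using hgt)
  obtain ⟨z, hz, hlt⟩ := h x₁ (by simpa using hx₁) (-φ) r hφ.neg (by simp [h0])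
    (fun y hy => by have := hle y hy; simp only [Pi.neg_apply] at this ⊢; linarith) δ hδ hr 1
    one_pos
  have hneg := dirLap_neg s δ (-φ) V x₁ z (V x₁)
  rw [neg_neg] at hneg
  have := hop z hz
  simp only [Pi.neg_apply] at this
  linarith

lemma exists_mul_rpow_near_lt {s : ℝ} (hs₁ : s < 1) (A : ℝ) {b δ₀ : ℝ} (hb : 0 < b)
    (hδ₀ : 0 < δ₀) :
    ∃ δ : ℝ, 0 < δ ∧ δ ≤ δ₀ ∧ A * (δ ^ (2 - 2 * s) / (2 - 2 * s)) < b := by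
  have hp : 0 < 2 - 2 * s := by linarith
  have hc : Tendsto (fun δ : ℝ => A * (δ ^ (2 - 2 * s) / (2 - 2 * s))) (𝓝 0) (𝓝 0) := by
    have h := (Real.continuousAt_rpow_const 0 (2 - 2 * s) (Or.inr hp.le)).tendsto
    rw [Real.zero_rpow hp.ne'] at h
    simpa using (h.div_const (2 - 2 * s)).const_mul A
  obtain ⟨ε, hε, h⟩ := Metric.eventually_nhds_iff.1 (hc.eventually (gt_mem_nhds hb))
  refine ⟨min δ₀ (ε / 2), lt_min hδ₀ (half_pos hε), min_le_left _ _, h ?_⟩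
  rw [dist_zero_right, Real.norm_eq_abs, abs_of_pos (lt_min hδ₀ (half_pos hε))]
  exact (min_le_right _ _).trans_lt (half_lt_self hε)

lemma exists_mul_rpow_tail_lt {s : ℝ} (hs₀ : 0 < s) (A R₀ : ℝ) {b : ℝ} (hb : 0 < b) :
    ∃ R : ℝ, R₀ ≤ R ∧ A * (R ^ (-(2 * s)) / (2 * s)) < b := by
  have hc : Tendsto (fun R : ℝ => A * (R ^ (-(2 * s)) / (2 * s))) atTop (𝓝 0) := by
    simpa using ((tendsto_rpow_neg_atTop (by linarith : 0 < 2 * s)).div_const (2 * s)).const_mul A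
  exact ((eventually_ge_atTop R₀).and (hc.eventually (gt_mem_nhds hb))).exists

end BoundaryDatum

section Doubling

lemma exists_radius_forall_sub_lt {E X : Type*} [SeminormedAddCommGroup E] [TopologicalSpace X]
    {Ω : Set E} {Ω' K : Set X} (hΩ : IsOpen Ω) (hΩ' : IsOpen Ω') (hK : IsCompact K) {u : E → ℝ}
    {v : X → ℝ} (hu : UpperSemicontinuous u) (hv : LowerSemicontinuous v) {A : X → E}
    (hA : Continuous A) (hmaps : MapsTo A Ω' Ω) (hle : ∀ x ∉ Ω', u (A x) ≤ v x) {θ : ℝ}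
    (hθ : 0 < θ) :
    ∃ ρ : ℝ, 0 < ρ ∧ ∀ w : E, ‖w‖ < ρ → ∀ x ∈ K,
      (A x + w ∈ Ω ∧ x ∈ Ω') ∨ u (A x + w) - v x < θ := by
  have hnear : ∀ᶠ w in 𝓝 (0 : E), ∀ x ∈ K, (A x + w ∈ Ω ∧ x ∈ Ω') ∨ u (A x + w) - v x < θ := by
    refine hK.eventually_forall_of_forall_eventually fun x _ => ?_
    have hfst : Tendsto (fun q : E × X => A q.2 + q.1) (𝓝 (0, x)) (𝓝 (A x)) := by
      have : Continuous fun q : E × X => A q.2 + q.1 := by fun_prop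
      simpa using this.tendsto (0, x)
    have hsnd : Tendsto (fun q : E × X => q.2) (𝓝 (0, x)) (𝓝 x) := continuous_snd.tendsto _
    by_cases hxΩ : x ∈ Ω'
    · filter_upwards [hfst.eventually (hΩ.mem_nhds (hmaps hxΩ)),
        hsnd.eventually (hΩ'.mem_nhds hxΩ)] with q hq hq' using Or.inl ⟨hq, hq'⟩
    · filter_upwards [hfst.eventually (hu (A x) (u (A x) + θ / 2) (by linarith)),
        hsnd.eventually (hv x (v x - θ / 2) (by linarith))] with q hq hq'
      exact Or.inr (by linarith [hle x hxΩ])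
  simpa only [Metric.eventually_nhds_iff, dist_zero_right] using hnear

variable {E E' : Type*} [NormedAddCommGroup E] [NormedSpace ℝ E] [NormedAddCommGroup E']
  [NormedSpace ℝ E']

/-- The penalty `n * ‖y - (p + L x)‖ ^ 2` of the doubling of variables along `x ↦ p + L x`. -/
noncomputable def doublingPenalty (n : ℝ) (p : E) (L : E' →L[ℝ] E) (y : E) (x : E') : ℝ :=
  n * ‖y - (p + L x)‖ ^ 2

lemma doublingPenalty_add_smul (n : ℝ) (p : E) (L : E' →L[ℝ] E) (y : E) (x z : E') (t : ℝ) :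
    doublingPenalty n p L (y + t • L z) (x + t • z) = doublingPenalty n p L y x := by
  simp only [doublingPenalty, map_add, map_smul]
  congr 3
  abel

lemma continuous_doublingPenalty (n : ℝ) (p : E) (L : E' →L[ℝ] E) :
    Continuous fun q : E × E' => doublingPenalty n p L q.1 q.2 := by
  unfold doublingPenalty
  fun_prop

lemma exists_doubling_maximum {K : Set E} {K' : Set E'} (hK : IsCompact K) (hK' : IsCompact K')
    {u : E → ℝ} {v : E' → ℝ} (hu : UpperSemicontinuous u) (hv : LowerSemicontinuous v) {M : ℝ}
    (huM : ∀ x, |u x| ≤ M) (hvM : ∀ x, |v x| ≤ M) (p : E) (L : E' →L[ℝ] E) {x₀ : E'}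
    (hx₀ : x₀ ∈ K') (hpx₀ : p + L x₀ ∈ K) (hlt : v x₀ < u (p + L x₀)) {ρ : ℝ} (hρ : 0 < ρ) :
    ∃ n, 0 < n ∧ ∃ y ∈ K, ∃ x ∈ K', ‖y - (p + L x)‖ < ρ ∧ u (p + L x₀) - v x₀ ≤ u y - v x ∧
      ∀ y' ∈ K, ∀ x' ∈ K', u y' - v x' - doublingPenalty n p L y' x'
        ≤ u y - v x - doublingPenalty n p L y x := by
  set n := (2 * M + 1) / ρ ^ 2
  have hM : 0 ≤ M := (abs_nonneg _).trans (huM p)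
  have husc : UpperSemicontinuous fun q : E × E' =>
      u q.1 + (-v) q.2 + -doublingPenalty n p L q.1 q.2 :=
    ((hu.comp continuous_fst).add ((upperSemicontinuous_neg hv).comp continuous_snd)).add
      (continuous_doublingPenalty n p L).neg.upperSemicontinuous
  obtain ⟨⟨y, x⟩, ⟨hy, hx⟩, hmax⟩ := UpperSemicontinuousOn.exists_isMaxOn
    (s := K ×ˢ K') ⟨(p + L x₀, x₀), hpx₀, hx₀⟩ (hK.prod hK') (husc.upperSemicontinuousOn _)
  have hmax' : ∀ y' ∈ K, ∀ x' ∈ K', u y' - v x' - doublingPenalty n p L y' x'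
      ≤ u y - v x - doublingPenalty n p L y x := fun y' hy' x' hx' => by
    simpa [sub_eq_add_neg] using hmax (show (y', x') ∈ K ×ˢ K' from ⟨hy', hx'⟩)
  have hval : u (p + L x₀) - v x₀ + n * ‖y - (p + L x)‖ ^ 2 ≤ u y - v x := by
    have := hmax' _ hpx₀ x₀ hx₀
    have hzero : doublingPenalty n p L (p + L x₀) x₀ = 0 := by simp [doublingPenalty]
    rw [hzero, doublingPenalty] at this
    linarith
  have hpen : 0 ≤ n * ‖y - (p + L x)‖ ^ 2 := by positivity
  refine ⟨n, by positivity, y, hy, x, hx, ?_, by linarith, hmax'⟩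
  by_contra! h
  have hnρ : 2 * M + 1 ≤ n * ‖y - (p + L x)‖ ^ 2 := by
    calc 2 * M + 1 = n * ρ ^ 2 := by simp only [n]; field_simp
      _ ≤ n * ‖y - (p + L x)‖ ^ 2 := by gcongr
  linarith [(abs_le.1 (huM y)).2, (abs_le.1 (hvM x)).1]

lemma add_smul_mem_closedBall {x z : E} {t R r : ℝ} (ht : |t| ≤ R) (hr : R * ‖z‖ ≤ r) :
    x + t • z ∈ Metric.closedBall x r := by
  rw [Metric.mem_closedBall, dist_eq_norm, add_sub_cancel_left, norm_smul, Real.norm_eq_abs]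
  exact (mul_le_mul_of_nonneg_right ht (norm_nonneg z)).trans hr

variable [FiniteDimensional ℝ E] [FiniteDimensional ℝ E']

lemma exists_interior_doubling_maximum {Ω : Set E} {Ω' : Set E'} (hΩ : IsOpen Ω)
    (hΩ' : IsOpen Ω') (hΩb : Bornology.IsBounded Ω') {u : E → ℝ} {v : E' → ℝ}
    (hu : UpperSemicontinuous u) (hv : LowerSemicontinuous v) {M : ℝ} (huM : ∀ x, |u x| ≤ M)
    (hvM : ∀ x, |v x| ≤ M) (p : E) (L : E' →L[ℝ] E) (hmaps : MapsTo (fun x => p + L x) Ω' Ω)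
    (hle : ∀ x ∉ Ω', u (p + L x) ≤ v x) {x₀ : E'} (hlt : v x₀ < u (p + L x₀)) (r : ℝ) :
    ∃ n, 0 < n ∧ ∃ y ∈ Ω, ∃ x ∈ Ω',
      (∀ y' ∈ Metric.closedBall y r, ∀ x' ∈ Metric.closedBall x r,
        u y' - v x' - doublingPenalty n p L y' x' ≤ u y - v x - doublingPenalty n p L y x) ∧
      ∀ x' ∈ Metric.closedBall x r, x' ∉ Ω' →
        u (y + L (x' - x)) - v x' ≤ u y - v x - (u (p + L x₀) - v x₀) / 2 := by
  have hx₀ : x₀ ∈ Ω' := by_contra fun h => (hle x₀ h).not_gt hlt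
  have hA : Continuous fun x : E' => p + L x := by fun_prop
  set I := (fun x => p + L x) '' closure Ω'
  have hK' : IsCompact (Metric.cthickening r (closure Ω')) := hΩb.isCompact_closure.cthickening
  have hK : IsCompact (Metric.cthickening (r + 1) I) :=
    (hΩb.isCompact_closure.image hA).cthickening
  obtain ⟨ρ, hρ, hmatch⟩ := exists_radius_forall_sub_lt hΩ hΩ' hK' hu hv hA hmaps hle
    (half_pos (sub_pos.2 hlt))
  obtain ⟨n, hn, y, -, x, hx, hyx, hval, hmax⟩ := exists_doubling_maximum hK hK' hu hv huM hvM p L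
    (Metric.self_subset_cthickening _ (subset_closure hx₀))
    (Metric.self_subset_cthickening _ (mem_image_of_mem _ (subset_closure hx₀))) hlt
    (lt_min hρ one_pos)
  obtain ⟨hyΩ, hxΩ⟩ : y ∈ Ω ∧ x ∈ Ω' := by
    have := hmatch _ (hyx.trans_le (min_le_left _ _)) x hx
    rw [add_sub_cancel] at this
    exact this.resolve_right fun h => by linarith
  have hball : Metric.closedBall x r ⊆ Metric.cthickening r (closure Ω') := fun x' hx' =>
    Metric.mem_cthickening_of_dist_le _ _ _ _ (subset_closure hxΩ) hx'
  refine ⟨n, hn, y, hyΩ, x, hxΩ, fun y' hy' x' hx' => hmax y' ?_ x' (hball hx'), ?_⟩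
  · refine Metric.mem_cthickening_of_dist_le _ _ _ _
      (mem_image_of_mem (fun x => p + L x) (subset_closure hxΩ)) ?_
    have hyI : dist y (p + L x) ≤ 1 := by
      rw [dist_eq_norm]
      exact (hyx.trans_le (min_le_right _ _)).le
    linarith [dist_triangle y' y (p + L x), Metric.mem_closedBall.1 hy']
  · intro x' hx' hx'Ω
    have := (hmatch _ (hyx.trans_le (min_le_left _ _)) x' (hball hx')).resolve_left
      fun h => hx'Ω h.2
    rw [show p + L x' + (y - (p + L x)) = y + L (x' - x) by rw [map_sub]; abel] at this
    linarith

lemma dirLap_sub_dirLap_le {s : ℝ} (hs₀ : 0 < s) (hs₁ : s < 1) {φ u : E → ℝ} {ψ v : E' → ℝ}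
    (hφ : ContDiff ℝ 2 φ) (hψ : ContDiff ℝ 2 ψ) (hu : IsLineBounded u) (hv : IsLineBounded v)
    {M : ℝ} (huM : ∀ x, |u x| ≤ M) (hvM : ∀ x, |v x| ≤ M) {y w : E} {x z : E'} {A θ δ R₁ R₂ : ℝ}
    (hδ : 0 < δ) (hδR₁ : δ ≤ R₁) (hR : R₁ ≤ R₂)
    (hnear : ∀ t, 0 < t → t < δ → secondDiff φ y w t - secondDiff ψ x z t ≤ A * t ^ 2)
    (hflat : ∀ t, |t| < R₂ → u (y + t • w) - v (x + t • z) ≤ u y - v x)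
    (hdrop : ∀ t, R₁ ≤ |t| → |t| < R₂ → u (y + t • w) - v (x + t • z) ≤ u y - v x - θ / 2) :
    dirLap s δ φ u y w (u y) - dirLap s δ ψ v x z (v x) ≤ A * (δ ^ (2 - 2 * s) / (2 - 2 * s))
      - θ * (R₁ ^ (-(2 * s)) / (2 * s)) + (θ + 8 * M) * (R₂ ^ (-(2 * s)) / (2 * s)) := by
  have hiu := integrable_dirLapIntegrand hs₀ hs₁ hδ hφ hu y w (u y)
  have hiv := integrable_dirLapIntegrand hs₀ hs₁ hδ hψ hv x z (v x)
  have hbeyond : ∀ t, δ ≤ t → dirLapIntegrand δ φ u y w (u y) t - dirLapIntegrand δ ψ v x z (v x) t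
      = (u (y + t • w) - v (x + t • z)) + (u (y + -t • w) - v (x + -t • z))
        - 2 * (u y - v x) := fun t ht => by
    simp only [dirLapIntegrand, if_neg (not_lt.2 ht), neg_smul, ← sub_eq_add_neg]
    ring
  rw [dirLap, dirLap, ← integral_sub hiu hiv]
  refine integral_kernelMeasure_le_of_profile hs₀ hs₁ (hiu.sub hiv) hδ hδR₁ hR ?_ ?_ ?_ ?_
  · intro t ht htδ
    simpa [dirLapIntegrand, htδ] using hnear t ht htδ
  · intro t htδ htR
    have habs : |t| = t := abs_of_pos (hδ.trans_le htδ)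
    rw [Pi.sub_apply, hbeyond t htδ]
    linarith [hflat t (by linarith), hflat (-t) (by rw [abs_neg]; linarith)]
  · intro t htR₁ htR₂
    have htδ := hδR₁.trans htR₁
    have habs : |t| = t := abs_of_pos (hδ.trans_le htδ)
    rw [Pi.sub_apply, hbeyond t htδ]
    linarith [hdrop t (by linarith) (by linarith),
      hdrop (-t) (by rw [abs_neg]; linarith) (by rw [abs_neg]; linarith)]
  · intro t htR
    rw [Pi.sub_apply, hbeyond t ((hδR₁.trans hR).trans htR)]
    linarith [abs_le.1 (huM (y + t • w)), abs_le.1 (huM (y + -t • w)), abs_le.1 (huM y),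
      abs_le.1 (hvM (x + t • z)), abs_le.1 (hvM (x + -t • z)), abs_le.1 (hvM x)]

end Doubling

section Comparison

variable {E E' : Type*} [NormedAddCommGroup E] [InnerProductSpace ℝ E] [NormedAddCommGroup E']
  [NormedSpace ℝ E']

lemma secondDiff_doublingPenalty_left (n : ℝ) (p : E) (L : E' →L[ℝ] E) (y w : E) (x : E') (t : ℝ) :
    secondDiff (fun y' => doublingPenalty n p L y' x) y w t = 2 * n * t ^ 2 * ‖w‖ ^ 2 := by
  have h := secondDiff_norm_sub_sq (p + L x) y w t
  simp only [secondDiff, doublingPenalty] at h ⊢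
  linear_combination n * h

lemma secondDiff_doublingPenalty_right (n : ℝ) (p : E) (L : E' →L[ℝ] E) (y : E) (x z : E') (t : ℝ) :
    secondDiff (doublingPenalty n p L y) x z t = 2 * n * t ^ 2 * ‖L z‖ ^ 2 := by
  have h := secondDiff_norm_sub_sq y (p + L x) (L z) t
  simp only [secondDiff, doublingPenalty, map_add, map_sub, map_smul, ← add_assoc,
    ← add_sub_assoc, norm_sub_rev y] at h ⊢
  linear_combination n * h

lemma contDiff_doublingPenalty (n : ℝ) (p : E) (L : E' →L[ℝ] E) :
    ContDiff ℝ 2 fun q : E × E' => doublingPenalty n p L q.1 q.2 := by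
  have h : ContDiff ℝ 2 fun q : E × E' => q.1 - (p + L q.2) := by fun_prop
  exact contDiff_const.mul (h.norm_sq ℝ)

variable [FiniteDimensional ℝ E] [FiniteDimensional ℝ E']

lemma lt_of_isMaxOn_doubling {s : ℝ} (hs₀ : 0 < s) (hs₁ : s < 1) {Ω : Set E} {Ω' : Set E'}
    {u : E → ℝ} {v : E' → ℝ} (hu : UpperSemicontinuous u) (hv : LowerSemicontinuous v) {M : ℝ}
    (huM : ∀ x, |u x| ≤ M) (hvM : ∀ x, |v x| ≤ M) (hus : IsSubsolOn s Ω u)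
    (hvs : IsSupersolOn s Ω' v) {n : ℝ} (hn : 0 ≤ n) {p : E} {L : E' →L[ℝ] E} {y : E} (hy : y ∈ Ω)
    {x : E'} (hx : x ∈ Ω') {θ δ R₁ R₂ r : ℝ} (hδ : 0 < δ) (hδR : δ ≤ R₁) (hR : R₁ ≤ R₂)
    (hr : R₂ * (‖L‖ + 1) ≤ r)
    (hmax : ∀ y' ∈ Metric.closedBall y r, ∀ x' ∈ Metric.closedBall x r,
      u y' - v x' - doublingPenalty n p L y' x' ≤ u y - v x - doublingPenalty n p L y x)
    (hfar : ∀ x' ∈ Metric.closedBall x r, R₁ ≤ dist x' x →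
      u (y + L (x' - x)) - v x' ≤ u y - v x - θ / 2) {c : ℝ} (hc : 0 < c) :
    θ * (R₁ ^ (-(2 * s)) / (2 * s)) < c + 4 * n * ‖L‖ ^ 2 * (δ ^ (2 - 2 * s) / (2 - 2 * s))
      + (θ + 8 * M) * (R₂ ^ (-(2 * s)) / (2 * s)) := by
  have hR₂ : 0 < R₂ := hδ.trans_le (hδR.trans hR)
  have hδL : 0 ≤ R₂ * ‖L‖ := by positivity
  have hyr : y ∈ Metric.closedBall y r := Metric.mem_closedBall_self (by linarith)
  have hxr : x ∈ Metric.closedBall x r := Metric.mem_closedBall_self (by linarith)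
  obtain ⟨φ, hφ⟩ : ∃ φ : E → ℝ, φ = fun y' =>
    u y + (doublingPenalty n p L y' x - doublingPenalty n p L y x) := ⟨_, rfl⟩
  obtain ⟨ψ, hψ⟩ : ∃ ψ : E' → ℝ, ψ = fun x' =>
    v x - (doublingPenalty n p L y x' - doublingPenalty n p L y x) := ⟨_, rfl⟩
  have hφC : ContDiff ℝ 2 φ := hφ ▸ contDiff_const.add
    (((contDiff_doublingPenalty n p L).comp (contDiff_id.prodMk contDiff_const)).sub contDiff_const)
  have hψC : ContDiff ℝ 2 ψ := hψ ▸ contDiff_const.sub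
    (((contDiff_doublingPenalty n p L).comp (contDiff_const.prodMk contDiff_id)).sub contDiff_const)
  obtain ⟨z, hz, hvlt⟩ := hvs x hx ψ r hψC (by simp [hψ]) (fun x' hx' => by
    have := hmax y hyr x' (Metric.ball_subset_closedBall hx')
    simp only [hψ]; linarith) δ hδ (by linarith) c hc
  have hLz : ‖L z‖ ≤ ‖L‖ := by simpa [hz] using L.le_opNorm z
  have hule := hus y hy φ r hφC (by simp [hφ]) (fun y' hy' => by
    have := hmax y' (Metric.ball_subset_closedBall hy') x hxr
    simp only [hφ]; linarith) (L z) δ hδ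
      ((mul_le_mul (hδR.trans hR) (by linarith) (norm_nonneg _) hR₂.le).trans hr)
  have hxt : ∀ t : ℝ, |t| < R₂ → x + t • z ∈ Metric.closedBall x r := fun t ht =>
    add_smul_mem_closedBall ht.le (by rw [hz]; linarith)
  have hyt : ∀ t : ℝ, |t| < R₂ → y + t • L z ∈ Metric.closedBall y r := fun t ht =>
    add_smul_mem_closedBall ht.le
      ((mul_le_mul_of_nonneg_left (by linarith) hR₂.le).trans hr)
  have hgap := dirLap_sub_dirLap_le hs₀ hs₁ hφC hψC (.of_upperSemicontinuous hu ⟨M, huM⟩)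
    (.of_lowerSemicontinuous hv ⟨M, hvM⟩) huM hvM (y := y) (w := L z) (x := x) (z := z)
    (A := 4 * n * ‖L‖ ^ 2) (θ := θ) hδ hδR hR (fun t _ _ => ?_) (fun t ht => ?_)
    (fun t ht ht' => ?_)
  · linarith
  · have hφt := secondDiff_doublingPenalty_left n p L y (L z) x t
    have hψt := secondDiff_doublingPenalty_right n p L y x z t
    have : 4 * n * t ^ 2 * ‖L z‖ ^ 2 ≤ 4 * n * t ^ 2 * ‖L‖ ^ 2 := by gcongr
    simp only [hφ, hψ, secondDiff] at hφt hψt ⊢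
    linarith
  · have := hmax _ (hyt t ht) _ (hxt t ht)
    rw [doublingPenalty_add_smul] at this
    linarith
  · have hdist : dist (x + t • z) x = |t| := by
      rw [dist_eq_norm, add_sub_cancel_left, norm_smul, hz, mul_one, Real.norm_eq_abs]
    simpa using hfar _ (hxt t ht') (hdist ▸ ht)

theorem comparison {s : ℝ} (hs₀ : 0 < s) (hs₁ : s < 1) {Ω : Set E} {Ω' : Set E'}
    (hΩ : IsOpen Ω) (hΩ' : IsOpen Ω') (hΩb : Bornology.IsBounded Ω') {u : E → ℝ} {v : E' → ℝ}
    (hu : UpperSemicontinuous u) (hub : ∃ M : ℝ, ∀ x, |u x| ≤ M)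
    (hv : LowerSemicontinuous v) (hvb : ∃ M : ℝ, ∀ x, |v x| ≤ M) (p : E) (L : E' →L[ℝ] E)
    (hmaps : MapsTo (fun x => p + L x) Ω' Ω) (hus : IsSubsolOn s Ω u) (hvs : IsSupersolOn s Ω' v)
    (hle : ∀ x ∉ Ω', u (p + L x) ≤ v x) : ∀ x, u (p + L x) ≤ v x := by
  intro x₀
  by_contra! hlt
  obtain ⟨M, huM, hvM⟩ : ∃ M : ℝ, (∀ x, |u x| ≤ M) ∧ ∀ x, |v x| ≤ M := by
    obtain ⟨⟨M₁, hM₁⟩, M₂, hM₂⟩ := And.intro hub hvb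
    exact ⟨max M₁ M₂, fun x => le_max_of_le_left (hM₁ x), fun x => le_max_of_le_right (hM₂ x)⟩
  set θ := u (p + L x₀) - v x₀
  have hθ : 0 < θ := sub_pos.2 hlt
  obtain ⟨R₁, hR₁, hdiam⟩ : ∃ R₁ : ℝ, 0 < R₁ ∧ ∀ x ∈ Ω', ∀ x' ∈ Ω', dist x x' < R₁ := by
    obtain ⟨C, hC⟩ := Metric.isBounded_iff.1 hΩb
    exact ⟨max C 0 + 1, by positivity, fun x hx x' hx' =>
      ((hC hx hx').trans (le_max_left _ _)).trans_lt (lt_add_one _)⟩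
  obtain ⟨R₂, hR, htail⟩ := exists_mul_rpow_tail_lt hs₀ (θ + 8 * M) R₁
    (b := θ * (R₁ ^ (-(2 * s)) / (2 * s))) (mul_pos hθ (by positivity))
  obtain ⟨n, hn, y, hy, x, hx, hmax, hfar⟩ := exists_interior_doubling_maximum hΩ hΩ' hΩb hu hv
    huM hvM p L hmaps hle hlt (R₂ * (‖L‖ + 1))
  obtain ⟨δ, hδ, hδR, hnear⟩ := exists_mul_rpow_near_lt hs₁ (4 * n * ‖L‖ ^ 2)
    (half_pos (sub_pos.2 htail)) hR₁
  have hgap := lt_of_isMaxOn_doubling hs₀ hs₁ hu hv huM hvM hus hvs hn.le hy hx hδ hδR hR le_rfl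
    hmax (fun x' hx' hd => hfar x' hx' fun h => (hdiam x' h x hx).not_ge hd)
    (half_pos (sub_pos.2 htail))
  linarith

lemma IsSubsolOn.le_of_isSupersolOn {s : ℝ} (hs₀ : 0 < s) (hs₁ : s < 1) {Ω : Set E}
    (hΩ : IsOpen Ω) (hΩb : Bornology.IsBounded Ω) {u v : E → ℝ} (hus : IsSubsolOn s Ω u)
    (hu : UpperSemicontinuous u) (hub : ∃ M : ℝ, ∀ x, |u x| ≤ M) (hvs : IsSupersolOn s Ω v)
    (hv : LowerSemicontinuous v) (hvb : ∃ M : ℝ, ∀ x, |v x| ≤ M) (hle : ∀ x ∉ Ω, u x ≤ v x)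
    (x : E) : u x ≤ v x := by
  simpa using comparison hs₀ hs₁ hΩ hΩ hΩb hu hub hv hvb 0 (.id ℝ E)
    (fun x hx => by simpa using hx) hus hvs (by simpa using hle) x

end Comparison

/-! ### Perron's method -/

section LocalSup

variable {X : Type*}

open Classical in
/-- `W` raised to at least `P` inside `B`: the modification of a competitor in Perron's method. -/
noncomputable def localSup (B : Set X) (W P : X → ℝ) : X → ℝ := B.piecewise (W ⊔ P) W

lemma le_localSup (B : Set X) (W P : X → ℝ) (y : X) : W y ≤ localSup B W P y := by
  unfold localSup
  by_cases h : y ∈ B <;> simp [h]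

lemma le_localSup_of_mem {B : Set X} (W P : X → ℝ) {y : X} (hy : y ∈ B) :
    P y ≤ localSup B W P y := by
  simp [localSup, hy]

lemma localSup_eq_or (B : Set X) (W P : X → ℝ) (y : X) :
    localSup B W P y = W y ∨ localSup B W P y = P y ∧ y ∈ B ∧ W y < P y := by
  by_cases hy : y ∈ B
  · rcases le_or_gt (P y) (W y) with h | h
    · left; simp [localSup, hy, h]
    · right; exact ⟨by simp [localSup, hy, h.le], hy, h⟩
  · left; simp [localSup, hy]

lemma upperSemicontinuous_localSup [TopologicalSpace X] {B C : Set X} (hB : IsOpen B)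
    (hC : IsClosed C) (hCB : C ⊆ B) {W P : X → ℝ} (hW : UpperSemicontinuous W)
    (hP : UpperSemicontinuous P)
    (hlt : ∀ y ∈ B, W y < P y → y ∈ C) : UpperSemicontinuous (localSup B W P) := by
  intro y b hb
  by_cases hy : y ∈ B
  · have hsup : max (W y) (P y) < b := by simpa [localSup, hy] using hb
    filter_upwards [hW.sup hP y b hsup, hB.mem_nhds hy] with x hx hxB
    simpa [localSup, hxB] using hx
  · filter_upwards [hW y b ((le_localSup B W P y).trans_lt hb),
      hC.isOpen_compl.mem_nhds fun h => hy (hCB h)] with x hx hxC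
    rcases localSup_eq_or B W P x with h | ⟨-, hxB, hxlt⟩
    · rwa [h]
    · exact absurd (hlt x hxB hxlt) hxC

end LocalSup

section Perron

variable {E : Type*} [NormedAddCommGroup E]

lemma continuousAt_of_eq_datum {Ω : Set E} {g W : E → ℝ} (hg : ContinuousOn g Ωᶜ)
    (hW : ∀ x ∉ Ω, W x = g x) {x : E} (hx : x ∉ closure Ω) : ContinuousAt W x := by
  have hx' : (closure Ω)ᶜ ∈ 𝓝 x := isClosed_closure.isOpen_compl.mem_nhds hx
  have hsub : (closure Ω)ᶜ ⊆ Ωᶜ := compl_subset_compl.2 subset_closure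
  exact (hg.continuousAt (mem_of_superset hx' hsub)).congr
    (by filter_upwards [hx'] with y hy using (hW y (hsub hy)).symm)

lemma exists_eventually_datum_lt_sub {Ω : Set E} (hΩ : IsOpen Ω) {g : E → ℝ}
    (hg : ContinuousOn g Ωᶜ) {x₀ : E} {a : ℝ} (hx₀ : x₀ ∈ Ω ∨ x₀ ∈ frontier Ω ∧ g x₀ < a) :
    ∃ η : ℝ, 0 < η ∧ ∀ᶠ x in 𝓝 x₀, x ∉ Ω → g x < a - η := by
  rcases hx₀ with h | ⟨h, hlt⟩
  · exact ⟨1, one_pos, by filter_upwards [hΩ.mem_nhds h] with x hx hx' using absurd hx hx'⟩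
  · rw [hΩ.frontier_eq] at h
    refine ⟨(a - g x₀) / 2, by linarith, ?_⟩
    exact eventually_nhdsWithin_iff.1 ((hg x₀ h.2).eventually (gt_mem_nhds (by linarith)))

lemma exists_room {Ω : Set E} (hΩ : IsOpen Ω) {g ψ : E → ℝ} (hg : ContinuousOn g Ωᶜ)
    (hψ : Continuous ψ) {M : ℝ} {x₀ : E} (hM : ψ x₀ < M)
    (hx₀ : x₀ ∈ Ω ∨ x₀ ∈ frontier Ω ∧ ψ x₀ < g x₀) :
    ∃ η r : ℝ, 0 < η ∧ 0 < r ∧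
      ∀ x ∈ Metric.ball x₀ r, ψ x + η ≤ M ∧ (x ∉ Ω → ψ x + η ≤ g x) := by
  obtain ⟨η, hη, hgap⟩ := exists_eventually_datum_lt_sub hΩ hg.neg (a := -ψ x₀)
    (hx₀.imp id fun h => ⟨h.1, neg_lt_neg h.2⟩)
  set κ := min η (M - ψ x₀) / 2 with hκdef
  have hκ : 0 < κ := half_pos (lt_min hη (by linarith))
  have hκη : 2 * κ ≤ η := by linarith [min_le_left η (M - ψ x₀)]
  have hκM : 2 * κ ≤ M - ψ x₀ := by linarith [min_le_right η (M - ψ x₀)]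
  have hψx : ∀ᶠ x in 𝓝 x₀, ψ x < ψ x₀ + κ :=
    hψ.continuousAt.eventually (gt_mem_nhds (by linarith))
  obtain ⟨r, hr, hball⟩ := Metric.eventually_nhds_iff_ball.1 (hgap.and hψx)
  refine ⟨κ, r, hκ, hr, fun x hx => ⟨by linarith [(hball x hx).2], fun hxΩ => ?_⟩⟩
  have hgx := (hball x hx).1 hxΩ
  rw [Pi.neg_apply] at hgx
  linarith [(hball x hx).2]

variable [NormedSpace ℝ E]

lemma add_smul_mem_ball {x z : E} (hz : ‖z‖ = 1) {t r : ℝ} (ht : 0 < t) (hr : t < r) :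
    x + t • z ∈ Metric.ball x r ∧ x - t • z ∈ Metric.ball x r := by
  simpa [mem_ball_iff_norm, norm_smul, hz, abs_of_pos ht] using hr

lemma dirLap_nonneg (s : ℝ) {δ r : ℝ} {φ u : E → ℝ} {x z : E} {a : ℝ} (hz : ‖z‖ = 1) (hr : δ ≤ r)
    (hφ : ∀ y ∈ Metric.ball x r, φ x ≤ φ y) (hu : ∀ y, a ≤ u y) :
    0 ≤ dirLap s δ φ u x z a := by
  refine integral_nonneg_of_ae ?_
  filter_upwards [ae_kernelMeasure_pos s] with t ht
  simp only [dirLapIntegrand, secondDiff, Pi.zero_apply]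
  split_ifs with htδ
  · obtain ⟨hadd, hsub⟩ := add_smul_mem_ball (x := x) hz ht (htδ.trans_le hr)
    linarith [hφ _ hadd, hφ _ hsub]
  · linarith [hu (x + t • z), hu (x - t • z)]

lemma dirLap_nonpos (s : ℝ) {δ r : ℝ} {φ u : E → ℝ} {x z : E} {a : ℝ} (hz : ‖z‖ = 1) (hr : δ ≤ r)
    (hφ : ∀ y ∈ Metric.ball x r, φ y ≤ φ x) (hu : ∀ y, u y ≤ a) :
    dirLap s δ φ u x z a ≤ 0 := by
  have := dirLap_nonneg s (φ := -φ) (u := -u) (a := -a) hz hr (fun y hy => neg_le_neg (hφ y hy))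
    fun y => neg_le_neg (hu y)
  rwa [dirLap_neg, neg_nonneg] at this

lemma lt_of_dirLap_pos (s : ℝ) {M δ r : ℝ} {V ψ : E → ℝ} {x₀ z : E} (hz : ‖z‖ = 1) (hδr : δ ≤ r)
    (h0 : ψ x₀ = V x₀) (hψV : ∀ x ∈ Metric.ball x₀ r, ψ x ≤ V x) (hVM : ∀ y, V y ≤ M)
    (hpos : 0 < dirLap s δ ψ V x₀ z (V x₀)) : V x₀ < M := by
  by_contra! h
  have hVle : ∀ y, V y ≤ V x₀ := fun y => (hVM y).trans h
  exact hpos.not_ge (dirLap_nonpos s hz hδr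
    (fun y hy => (hψV y hy).trans ((hVle y).trans h0.ge)) hVle)

/-- The competitors in Perron's method: upper semicontinuous subsolutions in `Ω`, bounded by `M`,
that agree with the datum off `Ω`. -/
structure IsPerronSubsol (s : ℝ) (Ω : Set E) (g : E → ℝ) (M : ℝ) (u : E → ℝ) : Prop where
  upperSemicontinuous : UpperSemicontinuous u
  bounded : ∀ x, |u x| ≤ M
  eq_datum : ∀ x ∉ Ω, u x = g x
  isSubsolOn : IsSubsolOn s Ω u

/-- The Perron solution: the pointwise supremum of all competitors. -/
noncomputable def perronSol (s : ℝ) (Ω : Set E) (g : E → ℝ) (M : ℝ) (x : E) : ℝ :=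
  ⨆ u : {u : E → ℝ // IsPerronSubsol s Ω g M u}, u.1 x

variable {s M : ℝ} {Ω : Set E} {g u : E → ℝ}

lemma IsPerronSubsol.isLineBounded (hu : IsPerronSubsol s Ω g M u) : IsLineBounded u :=
  .of_upperSemicontinuous hu.upperSemicontinuous ⟨M, hu.bounded⟩

open Classical in
lemma isPerronSubsol_piecewise (s : ℝ) (hΩ : IsOpen Ω) (hg : ContinuousOn g Ωᶜ)
    (hM : ∀ x ∈ Ωᶜ, |g x| ≤ M) (hM0 : 0 ≤ M) :
    IsPerronSubsol s Ω g M (Ω.piecewise (fun _ => -M) g) := by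
  have hge : ∀ x, -M ≤ Ω.piecewise (fun _ => -M) g x := fun x => by
    by_cases h : x ∈ Ω
    · simp [h]
    · simpa [h] using (abs_le.1 (hM x h)).1
  refine ⟨fun x c hc => ?_, fun x => ?_, fun x hx => piecewise_eq_of_notMem _ _ _ hx,
    isSubsolOn_of_forall_norm_eq_one fun x₀ hx₀ φ r _ h0 hle z δ _ hz hr => ?_⟩
  · dsimp only at hc
    by_cases hx : x ∈ Ω
    · filter_upwards [hΩ.mem_nhds hx] with y hy
      simpa [hx, hy] using hc
    · rw [piecewise_eq_of_notMem _ _ _ hx] at hc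
      filter_upwards [eventually_nhdsWithin_iff.1 ((hg x hx).eventually (gt_mem_nhds hc))]
        with y hy
      by_cases h : y ∈ Ω
      · simpa [h] using (abs_le.1 (hM x hx)).1.trans_lt hc
      · simpa [h] using hy h
  · refine abs_le.2 ⟨hge x, ?_⟩
    by_cases h : x ∈ Ω
    · simp only [piecewise_eq_of_mem _ _ _ h]; linarith
    · simpa [h] using (abs_le.1 (hM x h)).2
  · rw [piecewise_eq_of_mem _ _ _ hx₀] at h0 ⊢
    exact dirLap_nonneg s hz hr (fun y hy => h0.trans_le ((hge y).trans (hle y hy))) hge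

lemma IsPerronSubsol.le_perronSol (hu : IsPerronSubsol s Ω g M u) (x : E) :
    u x ≤ perronSol s Ω g M x := by
  refine le_ciSup (f := fun u : {u : E → ℝ // IsPerronSubsol s Ω g M u} => u.1 x) ⟨M, ?_⟩ ⟨u, hu⟩
  rintro _ ⟨v, rfl⟩
  exact (abs_le.1 (v.2.bounded x)).2

lemma IsPerronSubsol.abs_perronSol_le (hu : IsPerronSubsol s Ω g M u) (x : E) :
    |perronSol s Ω g M x| ≤ M := by
  have : Nonempty {u : E → ℝ // IsPerronSubsol s Ω g M u} := ⟨u, hu⟩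
  exact abs_le.2 ⟨(abs_le.1 (hu.bounded x)).1.trans (hu.le_perronSol x),
    ciSup_le fun v => (abs_le.1 (v.2.bounded x)).2⟩

lemma IsPerronSubsol.perronSol_eq_datum (hu : IsPerronSubsol s Ω g M u) {x : E} (hx : x ∉ Ω) :
    perronSol s Ω g M x = g x := by
  have : Nonempty {u : E → ℝ // IsPerronSubsol s Ω g M u} := ⟨u, hu⟩
  rw [perronSol, iSup_congr fun v : {u : E → ℝ // IsPerronSubsol s Ω g M u} => v.2.eq_datum x hx,
    ciSup_const]

lemma IsPerronSubsol.exists_near_upperEnv (hu : IsPerronSubsol s Ω g M u) {φ : E → ℝ} {x₀ : E}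
    (hφ : ContinuousAt φ x₀) (h0 : φ x₀ = upperEnv (perronSol s Ω g M) x₀) {S : Set E}
    (hS : S ∈ 𝓝 x₀) {e : ℝ} (he : 0 < e) :
    ∃ v, IsPerronSubsol s Ω g M v ∧ ∃ x ∈ S, φ x - e < v x := by
  have : Nonempty {u : E → ℝ // IsPerronSubsol s Ω g M u} := ⟨u, hu⟩
  have hfreq := frequently_lt_of_lt_upperEnv (x := x₀) (c := φ x₀ - e / 2)
    (Eventually.of_forall hu.abs_perronSol_le) (by linarith)
  have hnear : ∀ᶠ x in 𝓝 x₀, φ x < φ x₀ + e / 2 ∧ x ∈ S :=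
    (hφ.eventually (gt_mem_nhds (by linarith))).and hS
  obtain ⟨x, hx, hφx, hxS⟩ := (hfreq.and_eventually hnear).exists
  obtain ⟨v, hv⟩ := exists_lt_of_lt_ciSup (show φ x - e < perronSol s Ω g M x by linarith)
  exact ⟨v, v.2, x, hxS, hv⟩

end Perron

section Perron

variable {E : Type*} [NormedAddCommGroup E] [InnerProductSpace ℝ E] [FiniteDimensional ℝ E]
  {s M : ℝ} {Ω : Set E} {g u : E → ℝ}

lemma exists_isMaxOn_sub_near {φ : E → ℝ} (hu : UpperSemicontinuous u) (hφ : Continuous φ)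
    {x₀ x₁ : E} {R γ e : ℝ}
    (hle : ∀ x ∈ Metric.closedBall x₀ R, u x ≤ φ x - γ * ‖x - x₀‖ ^ 2)
    (hx₁ : x₁ ∈ Metric.closedBall x₀ R) (h : φ x₁ - e < u x₁) :
    ∃ y, IsMaxOn (fun x => u x - φ x) (Metric.closedBall x₀ R) y ∧ φ y - e < u y ∧
      γ * ‖y - x₀‖ ^ 2 < e := by
  obtain ⟨y, hy, hmax⟩ := UpperSemicontinuousOn.exists_isMaxOn (f := fun x => u x + -φ x)
    ⟨x₁, hx₁⟩ (isCompact_closedBall x₀ R)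
    ((hu.add hφ.neg.upperSemicontinuous).upperSemicontinuousOn _)
  have hyx₁ : u x₁ - φ x₁ ≤ u y - φ y := by simpa [sub_eq_add_neg] using hmax hx₁
  exact ⟨y, by simpa only [sub_eq_add_neg] using hmax, by linarith, by linarith [hle y hy]⟩

lemma isSubsolOn_upperEnv_perronSol (hs₀ : 0 < s) (hs₁ : s < 1) (hΩ : IsOpen Ω)
    (hg : ContinuousOn g Ωᶜ) (hu : IsPerronSubsol s Ω g M u) :
    IsSubsolOn s {x | x ∈ Ω ∨ x ∈ frontier Ω ∧ g x < upperEnv (perronSol s Ω g M) x}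
      (upperEnv (perronSol s Ω g M)) := by
  have hWb : ∀ x, |perronSol s Ω g M x| ≤ M := hu.abs_perronSol_le
  set U := upperEnv (perronSol s Ω g M)
  have hU : UpperSemicontinuous U := upperSemicontinuous_upperEnv hWb
  have hUb : ∃ M : ℝ, ∀ x, |U x| ≤ M := ⟨M, fun x => abs_upperEnv_le (.of_forall hWb)⟩
  refine isSubsolOn_of_strict_touching hs₀ hs₁ hU hUb
    fun x₀ hx₀ φ z r γ δ ρ hφ h0 hγ hle hδ hz hr hρ hneg => ?_
  obtain ⟨η, hη, hgap⟩ := exists_eventually_datum_lt_sub hΩ hg hx₀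
  set κ := min ρ η / 2 with hκdef
  have hκ : 0 < κ := half_pos (lt_min hρ hη)
  have hκρ : 2 * κ ≤ ρ := by linarith [min_le_left ρ η]
  have hκη : 2 * κ ≤ η := by linarith [min_le_right ρ η]
  have hnear : ∀ᶠ x in 𝓝 x₀, ((x ∉ Ω → g x < U x₀ - η) ∧ φ x₀ - κ < φ x) ∧
      x ∈ Metric.ball x₀ ρ ∧ x ∈ Metric.ball x₀ (δ / 2) :=
    (hgap.and (hφ.continuous.continuousAt.eventually (lt_mem_nhds (by linarith)))).and
      (inter_mem (Metric.ball_mem_nhds x₀ hρ) (Metric.ball_mem_nhds x₀ (half_pos hδ)))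
  obtain ⟨σ, hσ, hball⟩ := Metric.eventually_nhds_iff_ball.1 hnear
  obtain ⟨v, hv, x₁, hx₁, hvx₁⟩ := hu.exists_near_upperEnv (e := min κ (γ * σ ^ 2))
    hφ.continuous.continuousAt h0 (Metric.closedBall_mem_nhds x₀ (ε := 3 / 2 * δ) (by positivity))
    (lt_min hκ (by positivity))
  have hvU : ∀ x, v x ≤ U x := fun x =>
    (hv.le_perronSol x).trans (le_upperEnv (.of_forall hWb))
  obtain ⟨y, hmax, hvy, hyσ⟩ := exists_isMaxOn_sub_near hv.upperSemicontinuous hφ.continuous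
    (fun x hx => (hvU x).trans (hle x (Metric.closedBall_subset_ball (by linarith) hx))) hx₁ hvx₁
  obtain ⟨⟨hyg, hyφ⟩, hyρ, hyδ⟩ := hball y (mem_ball_iff_norm.2 (lt_of_pow_lt_pow_left₀ 2 hσ.le
    (lt_of_mul_lt_mul_left (hyσ.trans_le (min_le_right _ _)) hγ.le)))
  have hyU : U x₀ - 2 * κ < v y := by linarith [min_le_left κ (γ * σ ^ 2)]
  have hyΩ : y ∈ Ω := by
    by_contra h
    linarith [hyg h, hv.eq_datum y h]
  have hsub : Metric.ball y δ ⊆ Metric.closedBall x₀ (3 / 2 * δ) :=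
    (Metric.ball_subset_ball' (by rw [Metric.mem_ball] at hyδ; linarith)).trans
      Metric.ball_subset_closedBall
  have htest := hv.isSubsolOn y hyΩ (fun x => φ x + (v y - φ y)) δ (hφ.add contDiff_const)
    (by ring) (fun x hx => by linarith [isMaxOn_iff.1 hmax x (hsub hx)]) z δ hδ
    (by rw [hz, mul_one])
  rw [dirLap_add_const] at htest
  linarith [hneg y hyρ (v y) (by linarith), dirLap_mono_of_le hs₀ hs₁ hδ hφ hv.isLineBounded
    (.of_upperSemicontinuous hU hUb) hvU y z (v y)]

lemma exists_forall_dirLap_pos (hs₀ : 0 < s) (hs₁ : s < 1) {δ : ℝ} (hδ : 0 < δ) {φ v : E → ℝ}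
    (hφ : ContDiff ℝ 2 φ) (hv : LowerSemicontinuous v) (hvb : ∃ M : ℝ, ∀ x, |v x| ≤ M) {x₀ : E}
    {a₀ : ℝ} (hpos : ∀ z : E, ‖z‖ = 1 → 0 < dirLap s δ φ v x₀ z a₀) :
    ∃ ρ : ℝ, 0 < ρ ∧ ∀ x ∈ Metric.ball x₀ ρ, ∀ a < a₀ + ρ, ∀ z : E, ‖z‖ = 1 →
      0 < dirLap s δ φ v x z a := by
  have huniform : ∀ᶠ q : E × ℝ in 𝓝 (x₀, a₀), ∀ z ∈ Metric.sphere (0 : E) 1,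
      0 < dirLap s δ φ v q.1 z q.2 := by
    refine (isCompact_sphere (0 : E) 1).eventually_forall_of_forall_eventually fun z hz => ?_
    have hneg : dirLap s δ (-φ) (-v) x₀ z (-a₀) < 0 := by
      rw [dirLap_neg]; linarith [hpos z (by simpa using hz)]
    have hcont : Continuous fun q : (E × ℝ) × E => ((q.1.1, q.2, -q.1.2) : E × E × ℝ) := by
      fun_prop
    have hev := eventually_dirLap_lt hs₀ hs₁ hδ hφ.neg (upperSemicontinuous_neg hv)
      (by simpa using hvb) hneg
    filter_upwards [(hcont.tendsto ((x₀, a₀), z)).eventually hev] with q hq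
    change dirLap s δ (-φ) (-v) q.1.1 q.2 (-q.1.2) < 0 at hq
    rwa [dirLap_neg, neg_lt_zero] at hq
  obtain ⟨ρ, hρ, h⟩ := Metric.eventually_nhds_iff.1 huniform
  refine ⟨ρ / 2, half_pos hρ, fun x hx a ha z hz => ?_⟩
  have hdist : dist (x, a₀ + ρ / 2) (x₀, a₀) < ρ := by
    rw [Prod.dist_eq, Real.dist_eq, add_sub_cancel_left, abs_of_pos (half_pos hρ)]
    exact max_lt (hx.trans (half_lt_self hρ)) (half_lt_self hρ)
  exact (h hdist z (by simpa using hz)).trans_le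
    (dirLap_antitone hs₀ hs₁ hδ hφ (.of_lowerSemicontinuous hv hvb) x z ha.le)

lemma isSubsolOn_localSup {s : ℝ} (hs₀ : 0 < s) (hs₁ : s < 1) {X : Set E} {W P : E → ℝ} {x₀ : E}
    {δ : ℝ} (hδ : 0 < δ) (hW : IsLineBounded W)
    (hL : IsLineBounded (localSup (Metric.ball x₀ (2 * δ)) W P)) (hWX : IsSubsolOn s X W)
    (hP : ContDiff ℝ 2 P)
    (hlt : ∀ y ∈ Metric.ball x₀ (2 * δ), W y < P y →
      y ∈ Metric.ball x₀ δ ∧ ∀ z : E, ‖z‖ = 1 → 0 ≤ dirLap s δ P W y z (P y)) :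
    IsSubsolOn s X (localSup (Metric.ball x₀ (2 * δ)) W P) := by
  set L := localSup (Metric.ball x₀ (2 * δ)) W P with hLdef
  have hWL : ∀ y, W y ≤ L y := le_localSup _ W P
  refine isSubsolOn_of_forall_norm_eq_one fun y hy ψ r hψ h0 hle z ε hε hz hr => ?_
  rcases localSup_eq_or (Metric.ball x₀ (2 * δ)) W P y with h | ⟨h, hyB, hWP⟩
  · rw [← hLdef] at h
    rw [h] at h0 ⊢
    exact (hWX y hy ψ r hψ h0 (fun x hx => (hWL x).trans (hle x hx)) z ε hε
      (by rwa [hz, mul_one])).trans (dirLap_mono_of_le hs₀ hs₁ hε hψ hW hL hWL y z _)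
  · rw [← hLdef] at h
    rw [h] at h0 ⊢
    obtain ⟨hyδ, hpos⟩ := hlt y hyB hWP
    refine (hpos z hz).trans (dirLap_mono hs₀ hs₁ hδ hε hP hψ hW hL fun t ht => ?_)
    have hPL : t < δ → P (y + t • z) ≤ L (y + t • z) ∧ P (y - t • z) ≤ L (y - t • z) := fun htδ =>
      have hsub : Metric.ball y δ ⊆ Metric.ball x₀ (2 * δ) :=
        Metric.ball_subset_ball' (by rw [Metric.mem_ball] at hyδ; linarith)
      (add_smul_mem_ball hz ht htδ).imp (fun h => le_localSup_of_mem W P (hsub h))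
        fun h => le_localSup_of_mem W P (hsub h)
    have hLψ : t < ε → L (y + t • z) ≤ ψ (y + t • z) ∧ L (y - t • z) ≤ ψ (y - t • z) := fun htε =>
      (add_smul_mem_ball hz ht (htε.trans_le hr)).imp (hle _) (hle _)
    have hadd := hWL (y + t • z)
    have hsub := hWL (y - t • z)
    unfold dirLapIntegrand secondDiff
    split_ifs with htδ htε htε
    · linarith [hPL htδ, hLψ htε]
    · linarith [hPL htδ]
    · linarith [hLψ htε]
    · linarith

lemma isPerronSubsol_localSup (hs₀ : 0 < s) (hs₁ : s < 1) (hu : IsPerronSubsol s Ω g M u)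
    {P : E → ℝ} (hP : ContDiff ℝ 2 P) {x₀ : E} {δ : ℝ} (hδ : 0 < δ)
    (hroom : ∀ y ∈ Metric.ball x₀ (2 * δ), P y ≤ M ∧ (y ∉ Ω → P y ≤ g y))
    (hlt : ∀ y ∈ Metric.ball x₀ (2 * δ), u y < P y →
      y ∈ Metric.ball x₀ δ ∧ ∀ z : E, ‖z‖ = 1 → 0 ≤ dirLap s δ P u y z (P y)) :
    IsPerronSubsol s Ω g M (localSup (Metric.ball x₀ (2 * δ)) u P) := by
  have husc := upperSemicontinuous_localSup Metric.isOpen_ball Metric.isClosed_closedBall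
    (Metric.closedBall_subset_ball (by linarith)) hu.upperSemicontinuous
    hP.continuous.upperSemicontinuous
    fun y hy h => Metric.ball_subset_closedBall (hlt y hy h).1
  have hb : ∀ y, |localSup (Metric.ball x₀ (2 * δ)) u P y| ≤ M := fun y => by
    refine abs_le.2 ⟨(abs_le.1 (hu.bounded y)).1.trans (le_localSup _ u P y), ?_⟩
    rcases localSup_eq_or (Metric.ball x₀ (2 * δ)) u P y with h | ⟨h, hy, -⟩ <;> rw [h]
    · exact (abs_le.1 (hu.bounded y)).2
    · exact (hroom y hy).1
  refine ⟨husc, hb, fun y hy => ?_, isSubsolOn_localSup hs₀ hs₁ hδ hu.isLineBounded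
    (.of_upperSemicontinuous husc ⟨M, hb⟩) hu.isSubsolOn hP hlt⟩
  rcases localSup_eq_or (Metric.ball x₀ (2 * δ)) u P y with h | ⟨-, hyB, hyP⟩
  · rw [h, hu.eq_datum y hy]
  · rw [hu.eq_datum y hy] at hyP
    exact absurd hyP ((hroom y hyB).2 hy).not_gt

lemma exists_strict_touching_below (hs₀ : 0 < s) (hs₁ : s < 1) {V φ : E → ℝ}
    (hV : IsLineBounded V) {x₀ : E} {r δ c : ℝ} (hφ : ContDiff ℝ 2 φ) (h0 : φ x₀ = V x₀)
    (hle : ∀ x ∈ Metric.ball x₀ r, φ x ≤ V x) (hδ : 0 < δ) (hc : 0 < c)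
    (hpos : ∀ z : E, ‖z‖ = 1 → c ≤ dirLap s δ φ V x₀ z (V x₀)) :
    ∃ (ψ : E → ℝ) (γ : ℝ), ContDiff ℝ 2 ψ ∧ ψ x₀ = V x₀ ∧ 0 < γ ∧
      (∀ x ∈ Metric.ball x₀ r, ψ x + γ * ‖x - x₀‖ ^ 2 ≤ V x) ∧
      ∀ z : E, ‖z‖ = 1 → 0 < dirLap s δ ψ V x₀ z (V x₀) := by
  obtain ⟨γ, hγ, hγc⟩ := exists_pos_mul_lt hc (2 * 1 ^ 2 * (δ ^ (2 - 2 * s) / (2 - 2 * s)))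
  refine ⟨fun x => φ x + -γ * ‖x - x₀‖ ^ 2, γ,
    hφ.add (contDiff_const.mul (contDiff_norm_sub_sq x₀)), by simp [h0], hγ,
    fun x hx => by simpa using hle x hx, fun z hz => ?_⟩
  rw [dirLap_add_mul_norm_sub_sq hs₀ hs₁ hδ hφ hV, hz]
  linarith [hpos z hz]

lemma exists_isPerronSubsol_localSup {V W ψ : E → ℝ} (hs₀ : 0 < s) (hs₁ : s < 1)
    (hW : IsPerronSubsol s Ω g M W) (hV : LowerSemicontinuous V) (hVb : ∃ M : ℝ, ∀ x, |V x| ≤ M)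
    (hVW : ∀ x, V x ≤ W x) {x₀ : E} {r δ η γ : ℝ} (hδ : 0 < δ) (hδr : δ ≤ r) (hη : 0 < η)
    (hγ : 0 < γ) (hψ : ContDiff ℝ 2 ψ) (h0 : ψ x₀ = V x₀)
    (hψV : ∀ x ∈ Metric.ball x₀ r, ψ x + γ * ‖x - x₀‖ ^ 2 ≤ V x)
    (hpos : ∀ z : E, ‖z‖ = 1 → 0 < dirLap s δ ψ V x₀ z (V x₀))
    (hroom : ∀ x ∈ Metric.ball x₀ r, ψ x + η ≤ M ∧ (x ∉ Ω → ψ x + η ≤ g x)) :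
    ∃ ε κ : ℝ, 0 < ε ∧ 0 < κ ∧
      IsPerronSubsol s Ω g M (localSup (Metric.ball x₀ ε) W fun y => ψ y + κ) := by
  have hVL : IsLineBounded V := .of_lowerSemicontinuous hV hVb
  have hδ2 : 0 < δ / 2 := half_pos hδ
  obtain ⟨ρ, hρ, hρpos⟩ := exists_forall_dirLap_pos hs₀ hs₁ hδ2 hψ hV hVb fun z hz =>
    (hpos z hz).trans_le (dirLap_le_dirLap_of_testFun_le hs₀ hs₁ hδ2 (half_le_self hδ.le) hψ hVL h0
      (by rwa [hz, mul_one]) fun x hx => (le_add_of_nonneg_right (by positivity)).trans (hψV x hx))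
  have hnear : ∀ᶠ x in 𝓝 x₀, ψ x < V x₀ + ρ / 2 ∧ x ∈ Metric.ball x₀ ρ ∧
      x ∈ Metric.ball x₀ (δ / 2) :=
    (hψ.continuous.continuousAt.eventually (gt_mem_nhds (by linarith))).and
      (inter_mem (Metric.ball_mem_nhds x₀ hρ) (Metric.ball_mem_nhds x₀ hδ2))
  obtain ⟨σ, hσ, hball⟩ := Metric.eventually_nhds_iff_ball.1 hnear
  obtain ⟨κ, hκ, hκη, hκρ, hκσ⟩ : ∃ κ, 0 < κ ∧ κ ≤ η ∧ κ ≤ ρ / 2 ∧ κ ≤ γ * σ ^ 2 :=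
    ⟨min η (min (ρ / 2) (γ * σ ^ 2)), by positivity, by simp, by simp, by simp⟩
  have hBr : Metric.ball x₀ (2 * (δ / 2)) ⊆ Metric.ball x₀ r :=
    Metric.ball_subset_ball (by linarith)
  refine ⟨2 * (δ / 2), κ, by positivity, hκ, isPerronSubsol_localSup hs₀ hs₁ hW
    (hψ.add contDiff_const) hδ2 (fun y hy => ⟨by linarith [(hroom y (hBr hy)).1],
      fun h => by linarith [(hroom y (hBr hy)).2 h]⟩) fun y hy hlt => ?_⟩
  have hyσ : γ * ‖y - x₀‖ ^ 2 < γ * σ ^ 2 := by linarith [hψV y (hBr hy), hVW y]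
  obtain ⟨hψy, hyρ, hyδ⟩ := hball y (mem_ball_iff_norm.2
    (lt_of_pow_lt_pow_left₀ 2 hσ.le (lt_of_mul_lt_mul_left hyσ hγ.le)))
  refine ⟨hyδ, fun z hz => ?_⟩
  rw [dirLap_add_const]
  exact (hρpos y hyρ _ (by linarith) z hz).le.trans
    (dirLap_mono_of_le hs₀ hs₁ hδ2 hψ hVL hW.isLineBounded hVW y z _)

/-- If the lower envelope of the largest competitor `W` failed the supersolution test, a slightly
raised strict test function could be used to enlarge `W`. -/
lemma IsPerronSubsol.isSupersolOn_lowerEnv [Nontrivial E] {W : E → ℝ} (hs₀ : 0 < s) (hs₁ : s < 1)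
    (hΩ : IsOpen Ω) (hg : ContinuousOn g Ωᶜ) (hW : IsPerronSubsol s Ω g M W)
    (hmaximal : ∀ u, IsPerronSubsol s Ω g M u → ∀ x, u x ≤ W x) :
    IsSupersolOn s {x | x ∈ Ω ∨ x ∈ frontier Ω ∧ lowerEnv W x < g x} (lowerEnv W) := by
  set V := lowerEnv W
  have hV : LowerSemicontinuous V := lowerSemicontinuous_lowerEnv hW.bounded
  have hVb : ∀ x, |V x| ≤ M := abs_lowerEnv_le hW.bounded
  have hVL : IsLineBounded V := .of_lowerSemicontinuous hV ⟨M, hVb⟩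
  intro x₀ hx₀ φ r hφ h0 hle δ hδ hδr c hc
  by_contra! hpos
  obtain ⟨ψ, γ, hψ, hψ0, hγ, hψV, hψpos⟩ :=
    exists_strict_touching_below hs₀ hs₁ hVL hφ h0 hle hδ hc hpos
  have hψleV : ∀ x ∈ Metric.ball x₀ r, ψ x ≤ V x := fun x hx =>
    (le_add_of_nonneg_right (by positivity)).trans (hψV x hx)
  obtain ⟨z, hz⟩ := exists_norm_eq E zero_le_one
  have hVM : V x₀ < M :=
    lt_of_dirLap_pos s hz hδr hψ0 hψleV (fun y => (abs_le.1 (hVb y)).2) (hψpos z hz)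
  obtain ⟨η, d, hη, hd, hroom⟩ := exists_room (M := M) hΩ hg hψ.continuous (hψ0.trans_lt hVM)
    (hψ0.symm ▸ hx₀)
  have hpos_min : ∀ z : E, ‖z‖ = 1 → 0 < dirLap s (min d δ) ψ V x₀ z (V x₀) := fun z hz =>
    (hψpos z hz).trans_le (dirLap_le_dirLap_of_testFun_le hs₀ hs₁ (lt_min hd hδ) (min_le_right _ _)
      hψ hVL hψ0 (by rwa [hz, mul_one]) hψleV)
  obtain ⟨ε, κ, hε, hκ, hW'⟩ := exists_isPerronSubsol_localSup hs₀ hs₁ hW hV ⟨M, hVb⟩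
    (lowerEnv_le hW.bounded) (lt_min hd hδ) le_rfl hη hγ hψ hψ0
    (fun x hx => hψV x (Metric.ball_subset_ball ((min_le_right _ _).trans hδr) hx)) hpos_min
    fun x hx => hroom x (Metric.ball_subset_ball (min_le_left _ _) hx)
  have hraise : V x₀ + κ / 2 ≤ V x₀ := by
    refine le_lowerEnv hW.bounded ?_
    filter_upwards [hψ.continuous.continuousAt.eventually
      (lt_mem_nhds (show V x₀ - κ / 2 < ψ x₀ by linarith)), Metric.ball_mem_nhds x₀ hε]
      with y hy hyB
    linarith [le_localSup_of_mem W (fun y => ψ y + κ) hyB, hmaximal _ hW' y]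
  linarith

lemma isPerronSubsol_perronSol [Nontrivial E] (hs₀ : 0 < s) (hs₁ : s < 1)
    (hΩ : IsStrictlyConvexDomain Ω) (hg : ContinuousOn g Ωᶜ) (hu : IsPerronSubsol s Ω g M u) :
    IsPerronSubsol s Ω g M (perronSol s Ω g M) := by
  set W := perronSol s Ω g M
  have hWb : ∀ x, |W x| ≤ M := hu.abs_perronSol_le
  have hWg : ∀ x ∉ Ω, W x = g x := fun x => hu.perronSol_eq_datum
  have hWU : ∀ x, W x ≤ upperEnv W x := fun x => le_upperEnv (.of_forall hWb)
  have hU : UpperSemicontinuous (upperEnv W) := upperSemicontinuous_upperEnv hWb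
  have hUb : ∀ x, |upperEnv W x| ≤ M := fun x => abs_upperEnv_le (.of_forall hWb)
  have hUsub := isSubsolOn_upperEnv_perronSol hs₀ hs₁ hΩ.isOpen hg hu
  have hUext : ∀ x ∉ closure Ω, upperEnv W x = g x := fun x hx => by
    rw [upperEnv_of_continuousAt (continuousAt_of_eq_datum hg hWg hx),
      hWg x fun h => hx (subset_closure h)]
  have hUle := hUsub.le_datum hs₀ hs₁ hΩ hg hU ⟨M, hUb⟩ fun x hx => (hUext x hx).le
  have hUg : ∀ x ∉ Ω, upperEnv W x = g x := fun x hx =>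
    (hUle x hx).antisymm ((hWg x hx).ge.trans (hWU x))
  have hUperron : IsPerronSubsol s Ω g M (upperEnv W) :=
    ⟨hU, hUb, hUg, hUsub.mono fun x hx => Or.inl hx⟩
  rwa [funext fun x => (hUperron.le_perronSol x).antisymm (hWU x)] at hUperron

theorem exists_solution [Nontrivial E] (hs₀ : 0 < s) (hs₁ : s < 1) (hΩ : IsStrictlyConvexDomain Ω)
    (hg : ContinuousOn g Ωᶜ) (hgb : ∃ M : ℝ, ∀ x ∈ Ωᶜ, |g x| ≤ M) :
    ∃ W : E → ℝ, Continuous W ∧ (∃ M : ℝ, ∀ x, |W x| ≤ M) ∧ (∀ x ∉ Ω, W x = g x) ∧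
      IsSubsolOn s Ω W ∧ IsSupersolOn s Ω W := by
  obtain ⟨M, hM⟩ := hgb
  have hW := isPerronSubsol_perronSol hs₀ hs₁ hΩ hg (isPerronSubsol_piecewise s hΩ.isOpen hg
    (fun x hx => (hM x hx).trans (le_max_left M 0)) (le_max_right M 0))
  set W := perronSol s Ω g (max M 0)
  have hV : LowerSemicontinuous (lowerEnv W) := lowerSemicontinuous_lowerEnv hW.bounded
  have hVb : ∃ M : ℝ, ∀ x, |lowerEnv W x| ≤ M := ⟨_, abs_lowerEnv_le hW.bounded⟩
  have hVsup := hW.isSupersolOn_lowerEnv hs₀ hs₁ hΩ.isOpen hg fun u hu => hu.le_perronSol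
  have hVext : ∀ x ∉ closure Ω, g x ≤ lowerEnv W x := fun x hx => by
    rw [lowerEnv_of_continuousAt (continuousAt_of_eq_datum hg hW.eq_datum hx),
      hW.eq_datum x fun h => hx (subset_closure h)]
  have hVg := hVsup.datum_le hs₀ hs₁ hΩ hg hV hVb hVext
  have hWV := hW.isSubsolOn.le_of_isSupersolOn hs₀ hs₁ hΩ.isOpen hΩ.bounded
    hW.upperSemicontinuous ⟨_, hW.bounded⟩ (hVsup.mono fun x hx => Or.inl hx) hV hVb
    fun x hx => (hW.eq_datum x hx).trans_le (hVg x hx)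
  have hVW : lowerEnv W = W := funext fun x => (lowerEnv_le hW.bounded x).antisymm (hWV x)
  rw [hVW] at hV hVsup
  exact ⟨W, continuous_iff_lower_upperSemicontinuous.2 ⟨hV, hW.upperSemicontinuous⟩,
    ⟨_, hW.bounded⟩, hW.eq_datum, hW.isSubsolOn, hVsup.mono fun x hx => Or.inl hx⟩

end Perron

/-! ### The one-dimensional Dirichlet problem -/

section OneDim

variable {s : ℝ}

lemma fracLap_eq_integral (s : ℝ) (ψ : ℝ → ℝ) (t₀ : ℝ) :
    fracLap s ψ t₀ = ∫ t, secondDiff ψ t₀ 1 t ∂kernelMeasure s := by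
  simp [integral_kernelMeasure, fracLap, secondDiff]

lemma fracLap_eq_dirLap {r t₀ : ℝ} {φ ψ : ℝ → ℝ} (hr : 0 < r)
    (h : ∀ t ∈ Metric.ball t₀ r, ψ t = φ t) :
    fracLap s ψ t₀ = dirLap s r φ ψ t₀ 1 (φ t₀) := by
  rw [Real.ball_eq_Ioo] at h
  rw [fracLap_eq_integral, dirLap]
  refine integral_congr_ae ?_
  filter_upwards [ae_kernelMeasure_pos s] with t ht
  have hcenter := h t₀ ⟨by linarith, by linarith⟩
  unfold dirLapIntegrand secondDiff
  simp only [smul_eq_mul, mul_one]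
  split_ifs with htr
  · rw [h (t₀ + t) ⟨by linarith, by linarith⟩, h (t₀ - t) ⟨by linarith, by linarith⟩, hcenter]
  · rw [hcenter]

lemma exists_abs_piecewise_Ioo_le {φ v : ℝ → ℝ} (hφ : Continuous φ) (a b : ℝ)
    (hv : ∃ M : ℝ, ∀ t, |v t| ≤ M) [∀ t, Decidable (t ∈ Ioo a b)] :
    ∃ M : ℝ, ∀ t, |(Ioo a b).piecewise φ v t| ≤ M := by
  obtain ⟨M, hM⟩ := hv
  obtain ⟨C, hC⟩ := (isCompact_Icc (a := a) (b := b)).exists_bound_of_continuousOn hφ.continuousOn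
  refine ⟨max C M, fun t => ?_⟩
  by_cases ht : t ∈ Ioo a b
  · rw [piecewise_eq_of_mem _ _ _ ht]
    exact (hC t (Ioo_subset_Icc_self ht)).trans (le_max_left _ _)
  · rw [piecewise_eq_of_notMem _ _ _ ht]
    exact (hM t).trans (le_max_right _ _)

lemma isLineBounded_piecewise_Ioo {φ v : ℝ → ℝ} (hφ : Continuous φ) (hv : Measurable v)
    (hvb : ∃ M : ℝ, ∀ t, |v t| ≤ M) (a b : ℝ) [∀ t, Decidable (t ∈ Ioo a b)] :
    IsLineBounded ((Ioo a b).piecewise φ v) :=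
  .of_measurable (hφ.measurable.piecewise measurableSet_Ioo hv)
    (exists_abs_piecewise_Ioo_le hφ a b hvb)

lemma piecewise_eq_right {α : Type*} {S : Set α} [∀ t, Decidable (t ∈ S)] {f v : α → ℝ}
    (h : ∀ t ∉ S, v t = f t) : S.piecewise v f = v := by
  ext t
  by_cases ht : t ∈ S
  · rw [piecewise_eq_of_mem _ _ _ ht]
  · rw [piecewise_eq_of_notMem _ _ _ ht, h t ht]

lemma IsSubsolOn.fracLap_piecewise_nonneg (hs₀ : 0 < s) (hs₁ : s < 1) {v φ : ℝ → ℝ}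
    {a b t₀ : ℝ} [∀ t, Decidable (t ∈ Ioo a b)] (hsub : IsSubsolOn s (Ioo a b) v)
    (hv : Measurable v) (hvb : ∃ M : ℝ, ∀ t, |v t| ≤ M) (ht₀ : t₀ ∈ Ioo a b)
    (hφ : ContDiff ℝ 2 φ) (htouch : φ t₀ = v t₀) (hle : ∀ t ∈ Ioo a b, v t ≤ φ t) :
    0 ≤ fracLap s ((Ioo a b).piecewise φ v) t₀ := by
  obtain ⟨r, hr, hball⟩ := Metric.mem_nhds_iff.1 (isOpen_Ioo.mem_nhds ht₀)
  rw [fracLap_eq_dirLap hr fun t ht => piecewise_eq_of_mem _ _ _ (hball ht)]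
  refine (hsub t₀ ht₀ φ r hφ htouch (fun t ht => hle t (hball ht)) 1 r hr (by simp)).trans ?_
  rw [htouch]
  refine dirLap_mono_of_le hs₀ hs₁ hr hφ (.of_measurable hv hvb)
    (isLineBounded_piecewise_Ioo hφ.continuous hv hvb a b) (fun t => ?_) t₀ 1 (v t₀)
  by_cases ht : t ∈ Ioo a b
  · rw [piecewise_eq_of_mem _ _ _ ht]; exact hle t ht
  · rw [piecewise_eq_of_notMem _ _ _ ht]

lemma IsSupersolOn.fracLap_piecewise_nonpos (hs₀ : 0 < s) (hs₁ : s < 1) {v φ : ℝ → ℝ}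
    {a b t₀ : ℝ} [∀ t, Decidable (t ∈ Ioo a b)] (hsup : IsSupersolOn s (Ioo a b) v)
    (hv : Measurable v) (hvb : ∃ M : ℝ, ∀ t, |v t| ≤ M) (ht₀ : t₀ ∈ Ioo a b)
    (hφ : ContDiff ℝ 2 φ) (htouch : φ t₀ = v t₀) (hle : ∀ t ∈ Ioo a b, φ t ≤ v t) :
    fracLap s ((Ioo a b).piecewise φ v) t₀ ≤ 0 := by
  obtain ⟨r, hr, hball⟩ := Metric.mem_nhds_iff.1 (isOpen_Ioo.mem_nhds ht₀)
  rw [fracLap_eq_dirLap hr fun t ht => piecewise_eq_of_mem _ _ _ (hball ht)]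
  have hmono : dirLap s r φ ((Ioo a b).piecewise φ v) t₀ 1 (φ t₀) ≤ dirLap s r φ v t₀ 1 (v t₀) := by
    rw [htouch]
    refine dirLap_mono_of_le hs₀ hs₁ hr hφ
      (isLineBounded_piecewise_Ioo hφ.continuous hv hvb a b) (.of_measurable hv hvb)
      (fun t => ?_) t₀ 1 (v t₀)
    by_cases ht : t ∈ Ioo a b
    · rw [piecewise_eq_of_mem _ _ _ ht]; exact hle t ht
    · rw [piecewise_eq_of_notMem _ _ _ ht]
  refine hmono.trans (le_of_forall_pos_le_add fun c hc => ?_)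
  obtain ⟨z, hz, hlt⟩ :=
    hsup t₀ ht₀ φ r hφ htouch (fun t ht => hle t (hball ht)) r hr le_rfl c hc
  rw [zero_add]
  rcases eq_or_eq_neg_of_abs_eq (a := z) (b := 1) (by simpa using hz) with rfl | rfl
  · exact hlt.le
  · rw [dirLap_neg_dir] at hlt; exact hlt.le

lemma isDirichletSol_of_isSubsolOn_of_isSupersolOn (hs₀ : 0 < s) (hs₁ : s < 1) {f v : ℝ → ℝ}
    (hv : Continuous v) (hvb : ∃ M : ℝ, ∀ t, |v t| ≤ M) (hvf : ∀ t ∉ Ioo (0 : ℝ) 1, v t = f t)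
    (hsub : IsSubsolOn s (Ioo 0 1) v) (hsup : IsSupersolOn s (Ioo 0 1) v) :
    IsDirichletSol s f v := by
  classical
  have hU : upperEnv v = v := funext fun t => upperEnv_of_continuousAt hv.continuousAt
  have hL : lowerEnv v = v := funext fun t => lowerEnv_of_continuousAt hv.continuousAt
  refine ⟨hvb.imp fun M hM t _ => hM t, hvf, fun a b t₀ φ hab ht₀ hφ htouch hle => ?_,
    fun a b t₀ φ hab ht₀ hφ htouch hle => ?_⟩
  · rw [hU] at htouch hle ⊢
    rw [piecewise_eq_right hvf]
    exact (hsub.mono hab).fracLap_piecewise_nonneg hs₀ hs₁ hv.measurable hvb ht₀ hφ htouch hle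
  · rw [hL] at htouch hle ⊢
    rw [piecewise_eq_right hvf]
    exact (hsup.mono hab).fracLap_piecewise_nonpos hs₀ hs₁ hv.measurable hvb ht₀ hφ htouch hle

lemma isStrictlyConvexDomain_Ioo : IsStrictlyConvexDomain (Ioo (0 : ℝ) 1) where
  isOpen := isOpen_Ioo
  nonempty := nonempty_Ioo.2 one_pos
  bounded := Metric.isBounded_Ioo 0 1
  convex := convex_Ioo 0 1
  strictConvex := by
    rw [closure_Ioo zero_ne_one]
    exact strictConvex_Icc 0 1

lemma exists_continuous_isDirichletSol (hs₀ : 0 < s) (hs₁ : s < 1) {f : ℝ → ℝ} (hf : Continuous f)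
    (hfb : ∃ M : ℝ, ∀ t, |f t| ≤ M) :
    ∃ v : ℝ → ℝ, Continuous v ∧ (∃ M : ℝ, ∀ t, |v t| ≤ M) ∧ (∀ t ∉ Ioo (0 : ℝ) 1, v t = f t) ∧
      IsSupersolOn s (Ioo 0 1) v ∧ IsDirichletSol s f v := by
  obtain ⟨v, hv, hvb, hvf, hsub, hsup⟩ := exists_solution hs₀ hs₁ isStrictlyConvexDomain_Ioo
    hf.continuousOn (hfb.imp fun M hM x _ => hM x)
  exact ⟨v, hv, hvb, hvf, hsup,
    isDirichletSol_of_isSubsolOn_of_isSupersolOn hs₀ hs₁ hv hvb hvf hsub hsup⟩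

end OneDim

section WeightedSpace

variable {s : ℝ} {f : ℝ → ℝ}

lemma abs_div_rpow_le_of_abs_le (hs₀ : 0 < s) {c r t : ℝ} (hr : 0 < r) (hrt : r ≤ t) {x : ℝ}
    (hx : |x| ≤ |c| + t) :
    |f x / t ^ (1 + 2 * s)|
      ≤ ((1 + |c|) / r + 1) ^ (1 + 2 * s) * |f x / (1 + |x|) ^ (1 + 2 * s)| := by
  have ht : 0 < t := hr.trans_le hrt
  have hlin : 1 + |x| ≤ ((1 + |c|) / r + 1) * t := by
    have : 1 + |c| ≤ (1 + |c|) / r * t := by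
      rw [div_mul_eq_mul_div, le_div_iff₀ hr]; gcongr
    linarith
  have hpow : (1 + |x|) ^ (1 + 2 * s) ≤ ((1 + |c|) / r + 1) ^ (1 + 2 * s) * t ^ (1 + 2 * s) := by
    rw [← Real.mul_rpow (by positivity) ht.le]
    exact Real.rpow_le_rpow (by positivity) hlin (by linarith)
  rw [abs_div, abs_div, abs_of_pos (show 0 < t ^ (1 + 2 * s) by positivity),
    abs_of_pos (show 0 < (1 + |x|) ^ (1 + 2 * s) by positivity), ← mul_div_assoc,
    div_le_div_iff₀ (by positivity) (by positivity)]
  calc |f x| * (1 + |x|) ^ (1 + 2 * s)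
      ≤ |f x| * (((1 + |c|) / r + 1) ^ (1 + 2 * s) * t ^ (1 + 2 * s)) := by gcongr
    _ = _ := by ring

lemma integrable_indicator_Ici_comp (hs₀ : 0 < s) {σ : ℝ → ℝ} (hσ : Continuous σ) {c r : ℝ}
    (hr : 0 < r) (hσc : ∀ t, 0 < t → |σ t| ≤ |c| + t)
    (hf : Integrable fun t => f (σ t) / (1 + |σ t|) ^ (1 + 2 * s)) :
    Integrable ((Ici r).indicator fun t => f (σ t)) (kernelMeasure s) := by
  rw [integrable_kernelMeasure_iff]
  have hweight : Continuous fun t => (1 + |σ t|) ^ (1 + 2 * s) :=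
    Continuous.rpow_const (by fun_prop) fun t => Or.inr (by linarith)
  have hfσ : AEStronglyMeasurable (fun t => f (σ t)) volume := by
    refine (hf.aestronglyMeasurable.mul hweight.aestronglyMeasurable).congr (.of_forall fun t => ?_)
    exact div_mul_cancel₀ _ (by positivity)
  have hpow : Measurable fun t : ℝ => t ^ (1 + 2 * s) := by fun_prop
  refine Integrable.mono' (hf.norm.const_mul (((1 + |c|) / r + 1) ^ (1 + 2 * s))).integrableOn
    ((hfσ.indicator measurableSet_Ici).restrict.aemeasurable.div
      hpow.aemeasurable).aestronglyMeasurable ?_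
  filter_upwards [ae_restrict_mem measurableSet_Ioi] with t (ht : 0 < t)
  by_cases h : t ∈ Ici r
  · rw [indicator_of_mem h]
    exact abs_div_rpow_le_of_abs_le hs₀ hr h (hσc t ht)
  · rw [indicator_of_notMem h, zero_div, norm_zero]; positivity

lemma integrable_indicator_Ici_comp_const_add (hs₀ : 0 < s)
    (hf : Integrable fun r : ℝ => f r / (1 + |r|) ^ (1 + 2 * s)) (c : ℝ) {r : ℝ} (hr : 0 < r) :
    Integrable ((Ici r).indicator fun t => f (c + t)) (kernelMeasure s) :=
  integrable_indicator_Ici_comp hs₀ (by fun_prop) hr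
    (fun t ht => (abs_add_le c t).trans (by rw [abs_of_pos ht])) (hf.comp_add_left c)

lemma integrable_indicator_Ici_comp_const_sub (hs₀ : 0 < s)
    (hf : Integrable fun r : ℝ => f r / (1 + |r|) ^ (1 + 2 * s)) (c : ℝ) {r : ℝ} (hr : 0 < r) :
    Integrable ((Ici r).indicator fun t => f (c - t)) (kernelMeasure s) :=
  integrable_indicator_Ici_comp hs₀ (by fun_prop) hr
    (fun t ht => (abs_sub c t).trans (by rw [abs_of_pos ht])) (hf.comp_sub_left c)

lemma integrable_dirLapIntegrand_add (hs₀ : 0 < s) (hs₁ : s < 1) {r : ℝ} (hr : 0 < r)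
    {φ B : ℝ → ℝ} (hφ : ContDiff ℝ 2 φ) (hB : IsLineBounded B)
    (hf : Integrable fun r : ℝ => f r / (1 + |r|) ^ (1 + 2 * s)) (t₀ a : ℝ) :
    Integrable (dirLapIntegrand r φ (B + f) t₀ 1 a) (kernelMeasure s) := by
  refine (((integrable_dirLapIntegrand hs₀ hs₁ hr hφ hB t₀ 1 a).add
    (integrable_indicator_Ici_comp_const_add hs₀ hf t₀ hr)).add
    (integrable_indicator_Ici_comp_const_sub hs₀ hf t₀ hr)).congr (.of_forall fun t => ?_)
  simp only [Pi.add_apply, dirLapIntegrand, smul_eq_mul, mul_one, indicator, mem_Ici]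
  split_ifs <;> linarith

lemma integrable_dirLapIntegrand_of_eqOn (hs₀ : 0 < s) (hs₁ : s < 1) {r : ℝ} (hr : 0 < r)
    {φ W ψ : ℝ → ℝ} {S : Set ℝ} (hS : MeasurableSet S) (hφ : ContDiff ℝ 2 φ) (hW : Measurable W)
    (hWb : ∃ M : ℝ, ∀ t, |W t| ≤ M) (hψW : EqOn ψ W S) (hψf : EqOn ψ f Sᶜ)
    (hf : Integrable fun r : ℝ => f r / (1 + |r|) ^ (1 + 2 * s)) (t₀ a : ℝ) :
    Integrable (dirLapIntegrand r φ ψ t₀ 1 a) (kernelMeasure s) := by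
  have hψ : ψ = S.indicator W + Sᶜ.indicator f := by
    rw [← indicator_congr hψW, ← indicator_congr hψf, indicator_self_add_compl]
  have hB : IsLineBounded (S.indicator W) := by
    obtain ⟨M, hM⟩ := hWb
    refine .of_measurable (hW.indicator hS) ⟨M, fun t => ?_⟩
    exact (norm_indicator_le_norm_self W t).trans (hM t)
  have hfS : Integrable fun r : ℝ => Sᶜ.indicator f r / (1 + |r|) ^ (1 + 2 * s) := by
    refine (hf.indicator hS.compl).congr (.of_forall fun t => ?_)
    simp only [indicator]
    split_ifs <;> simp
  rw [hψ]
  exact integrable_dirLapIntegrand_add hs₀ hs₁ hr hφ hB hfS t₀ a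

lemma integrable_dirLapIntegrand_of_integrable (hs₀ : 0 < s) (hs₁ : s < 1) {r : ℝ} (hr : 0 < r)
    {φ : ℝ → ℝ} (hφ : ContDiff ℝ 2 φ)
    (hf : Integrable fun r : ℝ => f r / (1 + |r|) ^ (1 + 2 * s)) (t₀ a : ℝ) :
    Integrable (dirLapIntegrand r φ f t₀ 1 a) (kernelMeasure s) := by
  simpa using integrable_dirLapIntegrand_add hs₀ hs₁ hr hφ
    (.of_measurable measurable_zero ⟨0, by simp⟩) hf t₀ a

end WeightedSpace

section Correction

variable {s : ℝ}

/-- The excess of the second differences of a perturbed test function over the unperturbed ones,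
at unit scale: `σ` is the size of the perturbation and `η` the gap between the test function and
the exterior datum, which is only seen at distances between `5 / 4` and `5 / 2`. -/
noncomputable def correction (σ η t : ℝ) : ℝ :=
  if t < 1 / 4 then 2 * σ * t ^ 2 else if t < 5 / 4 then σ else if t < 5 / 2 then σ - η / 2 else σ

lemma correction_eq_indicator (σ η : ℝ) :
    correction σ η =
      ((2 * σ) • (Iio (1 / 4)).indicator (fun t => t ^ 2)
        + σ • (Ici (1 / 4)).indicator fun _ => (1 : ℝ))
      + (η / 2) • ((Ici (5 / 2)).indicator (fun _ => (1 : ℝ))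
        - (Ici (5 / 4)).indicator fun _ => (1 : ℝ)) := by
  ext t
  simp only [correction, Pi.add_apply, Pi.smul_apply, Pi.sub_apply, indicator, mem_Iio, mem_Ici,
    smul_eq_mul]
  split_ifs <;> linarith

lemma integrable_correction (hs₀ : 0 < s) (hs₁ : s < 1) (σ η : ℝ) :
    Integrable (correction σ η) (kernelMeasure s) := by
  rw [correction_eq_indicator]
  exact (((integrable_indicator_Iio_sq hs₁ (by norm_num)).smul _).add
    ((integrable_indicator_Ici hs₀ (by norm_num)).smul _)).add
    (((integrable_indicator_Ici hs₀ (by norm_num)).sub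
      (integrable_indicator_Ici hs₀ (by norm_num))).smul _)

lemma integral_correction (hs₀ : 0 < s) (hs₁ : s < 1) (σ η : ℝ) :
    ∫ t, correction σ η t ∂kernelMeasure s =
      σ * (2 * ((1 / 4) ^ (2 - 2 * s) / (2 - 2 * s)) + (1 / 4) ^ (-(2 * s)) / (2 * s))
        - η / 2 * ((5 / 4) ^ (-(2 * s)) / (2 * s) - (5 / 2) ^ (-(2 * s)) / (2 * s)) := by
  have hsq := integrable_indicator_Iio_sq hs₁ (show (0 : ℝ) < 1 / 4 by norm_num)
  have hfar : ∀ {a : ℝ}, 0 < a → _ := fun ha => integrable_indicator_Ici hs₀ ha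
  rw [correction_eq_indicator, integral_add' ((hsq.smul _).add ((hfar (by norm_num)).smul _))
    (((hfar (by norm_num)).sub (hfar (by norm_num))).smul _),
    integral_add' (hsq.smul _) ((hfar (by norm_num)).smul _)]
  simp only [Pi.smul_apply, Pi.sub_apply, integral_smul]
  rw [integral_sub (hfar (by norm_num)) (hfar (by norm_num)), integral_indicator_Iio_sq hs₁
    (by norm_num), integral_indicator_Ici hs₀ (by norm_num), integral_indicator_Ici hs₀
    (by norm_num), integral_indicator_Ici hs₀ (by norm_num)]
  simp only [smul_eq_mul]
  ring

lemma exists_integral_correction_nonpos (hs₀ : 0 < s) (hs₁ : s < 1) {η b : ℝ} (hη : 0 < η)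
    (hb : 0 < b) :
    ∃ σ : ℝ, 0 < σ ∧ σ ≤ b ∧ ∫ t, correction σ η t ∂kernelMeasure s ≤ 0 := by
  have hgap : 0 < (5 / 4 : ℝ) ^ (-(2 * s)) / (2 * s) - (5 / 2 : ℝ) ^ (-(2 * s)) / (2 * s) := by
    rw [← sub_div]
    exact div_pos (sub_pos.2 (Real.rpow_lt_rpow_of_neg (by norm_num) (by norm_num) (by linarith)))
      (by linarith)
  obtain ⟨σ, hσ, hσlt⟩ := exists_pos_mul_lt (mul_pos (half_pos hη) hgap)
    (2 * ((1 / 4 : ℝ) ^ (2 - 2 * s) / (2 - 2 * s)) + (1 / 4) ^ (-(2 * s)) / (2 * s))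
  have h2s : 0 < 2 - 2 * s := by linarith
  refine ⟨min σ b, lt_min hσ hb, min_le_right _ _, ?_⟩
  rw [integral_correction hs₀ hs₁, sub_nonpos]
  refine le_trans ?_ hσlt.le
  rw [mul_comm]
  gcongr
  exact min_le_left _ _

end Correction

section Touching

variable {s : ℝ}

/-- The test function `φ` raised by `m` and by a parabola centred at `τ` that has height `σ` at
distance `d`. -/
noncomputable def addParabola (φ : ℝ → ℝ) (σ τ d m t : ℝ) : ℝ := φ t + σ * ((t - τ) / d) ^ 2 + m

lemma contDiff_addParabola {φ : ℝ → ℝ} (hφ : ContDiff ℝ 2 φ) (σ τ d m : ℝ) :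
    ContDiff ℝ 2 (addParabola φ σ τ d m) := by
  unfold addParabola; fun_prop

lemma secondDiff_addParabola (φ : ℝ → ℝ) (σ τ d m t₀ t : ℝ) :
    secondDiff (addParabola φ σ τ d m) t₀ 1 t = secondDiff φ t₀ 1 t + 2 * σ * (t / d) ^ 2 := by
  simp only [secondDiff, addParabola, smul_eq_mul, mul_one]; ring

lemma addParabola_le {φ : ℝ → ℝ} {σ τ d m t : ℝ} (hσ : 0 < σ) (hd : 0 < d)
    (ht : t ∈ Ioo (τ - d / 2) (τ + d / 2)) : addParabola φ σ τ d m t ≤ φ t + m + σ / 4 := by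
  have hsq : ((t - τ) / d) ^ 2 ≤ (1 / 2) ^ 2 := by
    refine sq_le_sq' ?_ ?_
    · rw [le_div_iff₀ hd]; linarith [ht.1]
    · rw [div_le_iff₀ hd]; linarith [ht.2]
  have := mul_le_mul_of_nonneg_left hsq hσ.le
  unfold addParabola; linarith

lemma upperEnv_indicator_of_mem {X : Type*} [TopologicalSpace X] {S : Set X} (hS : IsOpen S)
    {x : X} (hx : x ∈ S) (v : X → ℝ) : upperEnv (S.indicator v) x = upperEnv v x := by
  refine limsup_congr ?_
  filter_upwards [hS.mem_nhds hx] with y hy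
  rw [indicator_of_mem hy]

lemma exists_isLUB_sub_image_Ioo {V φ : ℝ → ℝ} (hVb : ∃ M : ℝ, ∀ t, |V t| ≤ M)
    (hφ : Continuous φ) : ∃ m, IsLUB ((fun t => V t - φ t) '' Ioo (0 : ℝ) 1) m := by
  obtain ⟨M, hM⟩ := hVb
  obtain ⟨C, hC⟩ := (isCompact_Icc (a := (0 : ℝ)) (b := 1)).exists_bound_of_continuousOn
    hφ.continuousOn
  refine ⟨_, isLUB_csSup ((nonempty_Ioo.2 one_pos).image _) ⟨M + C, ?_⟩⟩
  rintro _ ⟨t, ht, rfl⟩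
  linarith [(abs_le.1 (hM t)).2, (abs_le.1 (hC t (Ioo_subset_Icc_self ht))).1]

lemma exists_touching_addParabola {V φ : ℝ → ℝ} (hV : UpperSemicontinuous V)
    (hVb : ∃ M : ℝ, ∀ t, |V t| ≤ M) (hφ : Continuous φ) {σ : ℝ} (hσ : 0 < σ) :
    ∃ m, (∀ t ∈ Ioo (0 : ℝ) 1, V t ≤ φ t + m) ∧ ∃ τ ∈ Ioo (0 : ℝ) 1, ∃ d, d = min τ (1 - τ) ∧
      ∃ t₀ m', |t₀ - τ| < d / 4 ∧ V t₀ = addParabola φ σ τ d m' t₀ ∧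
        (∀ t ∈ Ioo (τ - d / 2) (τ + d / 2), V t ≤ addParabola φ σ τ d m' t) ∧
        m - σ / 16 ≤ m' ∧ m' ≤ m := by
  obtain ⟨m, hm⟩ := exists_isLUB_sub_image_Ioo hVb hφ
  have hVm : ∀ t ∈ Ioo (0 : ℝ) 1, V t ≤ φ t + m := fun t ht => by
    linarith [hm.1 (mem_image_of_mem (fun t => V t - φ t) ht)]
  refine ⟨m, hVm, ?_⟩
  obtain ⟨_, ⟨τ, hτ, rfl⟩, hτm⟩ := (lt_isLUB_iff hm).1 (show m - σ / 16 < m by linarith)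
  refine ⟨τ, hτ, _, rfl, ?_⟩
  set d := min τ (1 - τ)
  have hd : 0 < d := lt_min hτ.1 (by linarith [hτ.2])
  have hdτ : d ≤ τ := min_le_left _ _
  have hdτ' : d ≤ 1 - τ := min_le_right _ _
  have hquad : Continuous fun t => φ t + σ * ((t - τ) / d) ^ 2 := by fun_prop
  obtain ⟨t₀, ht₀, hmax⟩ := UpperSemicontinuousOn.exists_isMaxOn
    (f := fun t => V t + -(φ t + σ * ((t - τ) / d) ^ 2)) (s := Icc (τ - d / 2) (τ + d / 2))
    ⟨τ, by constructor <;> linarith⟩ isCompact_Icc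
    ((hV.add hquad.neg.upperSemicontinuous).upperSemicontinuousOn _)
  have hτt₀ : m - σ / 16 < V t₀ - (φ t₀ + σ * ((t₀ - τ) / d) ^ 2) := by
    have := hmax (show τ ∈ Icc (τ - d / 2) (τ + d / 2) by constructor <;> linarith)
    simp only [mem_ofPred_eq, sub_self, zero_div, ne_eq, OfNat.ofNat_ne_zero, not_false_eq_true,
      zero_pow, mul_zero] at this
    linarith
  have hVt₀ := hVm t₀ ⟨by linarith [ht₀.1], by linarith [ht₀.2]⟩
  have hsq : 0 ≤ σ * ((t₀ - τ) / d) ^ 2 := by positivity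
  refine ⟨t₀, V t₀ - (φ t₀ + σ * ((t₀ - τ) / d) ^ 2), ?_, by unfold addParabola; ring,
    fun t ht => ?_, hτt₀.le, by linarith⟩
  · have hlt : ((t₀ - τ) / d) ^ 2 < (1 / 4) ^ 2 :=
      lt_of_mul_lt_mul_left (by linarith : σ * ((t₀ - τ) / d) ^ 2 < σ * (1 / 4) ^ 2) hσ.le
    have := abs_lt_of_sq_lt_sq hlt (by norm_num)
    rw [abs_div, abs_of_pos hd, div_lt_iff₀ hd] at this
    linarith
  · have := hmax (Ioo_subset_Icc_self ht)
    simp only [mem_ofPred_eq] at this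
    unfold addParabola; linarith

lemma dirLapIntegrand_addParabola_le {φ ψ f : ℝ → ℝ} {σ η e m m' δ τ d t₀ t : ℝ}
    (hτ : τ ∈ Ioo (0 : ℝ) 1) (hd : d = min τ (1 - τ)) (hnear : |t₀ - τ| < d / 4) (hσ : 0 < σ)
    (hσe : σ ≤ 16 * e) (heη : 8 * e ≤ η) (hδ : 5 ≤ δ) (hem : -e ≤ m)
    (hcenter : φ t₀ + m - σ / 16 ≤ addParabola φ σ τ d m' t₀)
    (hin : ∀ t ∈ Ioo (0 : ℝ) 1, ψ t ≤ φ t + m + σ / 4) (hout : ∀ t ∉ Ioo (0 : ℝ) 1, ψ t = f t)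
    (hfφ : ∀ t ∉ Ioo (0 : ℝ) 1, -δ < t → t < 1 + δ → f t ≤ φ t - η) (ht : 0 < t) :
    dirLapIntegrand (d / 4) (addParabola φ σ τ d m') ψ t₀ 1 (addParabola φ σ τ d m' t₀) t
      ≤ dirLapIntegrand δ φ f t₀ 1 (φ t₀ - 2 * e) t + correction σ η (t / d) := by
  have hd0 : 0 < d := by rw [hd]; exact lt_min hτ.1 (by linarith [hτ.2])
  have hdτ : d ≤ τ := hd ▸ min_le_left _ _
  have hdτ' : d ≤ 1 - τ := hd ▸ min_le_right _ _
  obtain ⟨hn₁, hn₂⟩ := abs_lt.1 hnear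
  have hdatum : ∀ x ∉ Ioo (0 : ℝ) 1, -δ < x → x < 1 + δ → ψ x ≤ φ x + m - 7 * η / 8 :=
    fun x hx h₁ h₂ => by rw [hout x hx]; linarith [hfφ x hx h₁ h₂]
  have hall : ∀ x, -δ < x → x < 1 + δ → ψ x ≤ φ x + m + σ / 4 := fun x h₁ h₂ => by
    by_cases hx : x ∈ Ioo (0 : ℝ) 1
    · exact hin x hx
    · linarith [hdatum x hx h₁ h₂]
  unfold dirLapIntegrand correction
  simp only [div_lt_iff₀ hd0]
  rcases lt_or_ge t (d / 4) with ht₁ | ht₁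
  · rw [if_pos ht₁, if_pos (by linarith), if_pos (by linarith), secondDiff_addParabola]
  rw [if_neg ht₁.not_gt, if_neg (show ¬t < 1 / 4 * d by linarith)]
  simp only [smul_eq_mul, mul_one, secondDiff]
  rcases lt_or_ge t δ with htδ | htδ
  · rw [if_pos htδ]
    have hplus := hall (t₀ + t) (by linarith) (by linarith)
    have hminus := hall (t₀ - t) (by linarith) (by linarith)
    split_ifs with ht₂ ht₃
    · linarith
    · rcases min_choice τ (1 - τ) with hmin | hmin
      · have := hdatum (t₀ - t) (fun h => by linarith [h.1]) (by linarith) (by linarith)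
        linarith
      · have := hdatum (t₀ + t) (fun h => by linarith [h.2]) (by linarith) (by linarith)
        linarith
    · linarith
  · rw [if_neg htδ.not_gt, if_neg (show ¬t < 5 / 4 * d by linarith),
      if_neg (show ¬t < 5 / 2 * d by linarith),
      hout (t₀ + t) fun h => by linarith [h.2], hout (t₀ - t) fun h => by linarith [h.1]]
    linarith

lemma dirLap_nonneg_of_dirLap_add_correction {F : ℝ → ℝ} {φ f : ℝ → ℝ} {σ η d δ t₀ a : ℝ}
    (hs₀ : 0 < s) (hs₁ : s < 1) (hd : 0 < d) (hδ : 0 < δ) (hφ : ContDiff ℝ 2 φ)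
    (hf : Integrable fun r : ℝ => f r / (1 + |r|) ^ (1 + 2 * s))
    (hσ : ∫ t, correction σ η t ∂kernelMeasure s ≤ 0) (hF : Integrable F (kernelMeasure s))
    (hF₀ : 0 ≤ ∫ t, F t ∂kernelMeasure s)
    (hle : ∀ t, 0 < t → F t ≤ dirLapIntegrand δ φ f t₀ 1 a t + correction σ η (t / d)) :
    0 ≤ dirLap s δ φ f t₀ 1 a := by
  have hInt := integrable_dirLapIntegrand_of_integrable hs₀ hs₁ hδ hφ hf t₀ a
  have hcor : Integrable (fun t => correction σ η (d⁻¹ * t)) (kernelMeasure s) :=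
    integrable_kernelMeasure_comp_mul (inv_pos.2 hd) (integrable_correction hs₀ hs₁ σ η)
  have hcor₀ : ∫ t, correction σ η (d⁻¹ * t) ∂kernelMeasure s ≤ 0 := by
    rw [integral_kernelMeasure_comp_mul s (inv_pos.2 hd)]
    exact mul_nonpos_of_nonneg_of_nonpos (by positivity) hσ
  have := integral_kernelMeasure_mono hF (hInt.add hcor) fun t ht => by
    simpa [div_eq_inv_mul] using hle t ht
  rw [integral_add' hInt hcor] at this
  unfold dirLap
  linarith

lemma IsDirichletSol.exists_upperSemicontinuous_eq_upperEnv {f v : ℝ → ℝ}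
    (hsol : IsDirichletSol s f v) :
    ∃ V : ℝ → ℝ, UpperSemicontinuous V ∧ (∃ M : ℝ, ∀ t, |V t| ≤ M) ∧
      (∀ t ∈ Ioo (0 : ℝ) 1, upperEnv v t = V t) ∧ ∀ t ∈ Ioo (0 : ℝ) 1, v t ≤ V t := by
  obtain ⟨M, hM⟩ := hsol.bounded
  have hb : ∀ t, |(Ioo (0 : ℝ) 1).indicator v t| ≤ M := fun t => by
    by_cases ht : t ∈ Ioo (0 : ℝ) 1
    · rw [indicator_of_mem ht]; exact hM t ht
    · rw [indicator_of_notMem ht, abs_zero]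
      exact (abs_nonneg _).trans (hM (1 / 2) (by norm_num))
  refine ⟨upperEnv ((Ioo (0 : ℝ) 1).indicator v), upperSemicontinuous_upperEnv hb,
    ⟨M, fun t => abs_upperEnv_le (.of_forall hb)⟩,
    fun t ht => (upperEnv_indicator_of_mem isOpen_Ioo ht v).symm, fun t ht => ?_⟩
  simpa only [indicator_of_mem ht] using le_upperEnv (x := t) (.of_forall hb)

lemma IsDirichletSol.exists_dirLap_nonneg_of_touching (hs₀ : 0 < s) (hs₁ : s < 1) {f v V : ℝ → ℝ}
    (hsol : IsDirichletSol s f v) (hf : Integrable fun r : ℝ => f r / (1 + |r|) ^ (1 + 2 * s))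
    (hV : Measurable V) (hVb : ∃ M : ℝ, ∀ t, |V t| ≤ M)
    (hVv : ∀ t ∈ Ioo (0 : ℝ) 1, upperEnv v t = V t) {φ : ℝ → ℝ} (hφ : ContDiff ℝ 2 φ)
    {a b t₀ r : ℝ} (hab : Ioo a b ⊆ Ioo 0 1) (hr : 0 < r) (hball : Metric.ball t₀ r ⊆ Ioo a b)
    (htouch : φ t₀ = V t₀) (hle : ∀ t ∈ Ioo a b, V t ≤ φ t) :
    ∃ ψ : ℝ → ℝ, EqOn ψ φ (Ioo a b) ∧ EqOn ψ V (Ioo 0 1 \ Ioo a b) ∧ EqOn ψ f (Ioo 0 1)ᶜ ∧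
      Integrable (dirLapIntegrand r φ ψ t₀ 1 (φ t₀)) (kernelMeasure s) ∧
      0 ≤ dirLap s r φ ψ t₀ 1 (φ t₀) := by
  classical
  have ht₀ : t₀ ∈ Ioo a b := hball (Metric.mem_ball_self hr)
  have htest := hsol.sub a b t₀ φ hab ht₀ hφ (by rw [hVv t₀ (hab ht₀), htouch])
    fun t ht => by rw [hVv t (hab ht)]; exact hle t ht
  rw [fracLap_eq_dirLap hr fun t ht => piecewise_eq_of_mem _ _ _ (hball ht)] at htest
  have hdatum : EqOn ((Ioo a b).piecewise φ ((Ioo (0 : ℝ) 1).piecewise (upperEnv v) f)) f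
      (Ioo 0 1)ᶜ := fun t ht => by
    rw [piecewise_eq_of_notMem _ _ _ fun h => ht (hab h), piecewise_eq_of_notMem _ _ _ ht]
  refine ⟨_, piecewise_eqOn _ _ _, fun t ht => ?_, hdatum, ?_, htest⟩
  · rw [piecewise_eq_of_notMem _ _ _ ht.2, piecewise_eq_of_mem _ _ _ ht.1, hVv t ht.1]
  · refine integrable_dirLapIntegrand_of_eqOn hs₀ hs₁ hr measurableSet_Ioo hφ
      (hφ.continuous.measurable.piecewise measurableSet_Ioo hV)
      (exists_abs_piecewise_Ioo_le hφ.continuous a b hVb) (fun t ht => ?_) hdatum hf t₀ _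
    by_cases h : t ∈ Ioo a b
    · rw [piecewise_eq_of_mem _ _ _ h, piecewise_eq_of_mem _ _ _ h]
    · rw [piecewise_eq_of_notMem _ _ _ h, piecewise_eq_of_notMem _ _ _ h,
        piecewise_eq_of_mem _ _ _ ht, hVv t ht]

/-- Raising `φ` by a parabola of height `σ` produces a test function touching the envelope of `v`
well inside `(0, 1)`. The perturbation costs at most `σ`, while the gap `η` to the datum is seen
from the nearer end of `(0, 1)` on a fixed proportion of scales, so for small `σ` it pays for it. -/
lemma IsDirichletSol.exists_dirLap_nonneg (hs₀ : 0 < s) (hs₁ : s < 1) {f v : ℝ → ℝ}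
    (hsol : IsDirichletSol s f v)
    (hf : Integrable fun r : ℝ => f r / (1 + |r|) ^ (1 + 2 * s)) {φ : ℝ → ℝ}
    (hφ : ContDiff ℝ 2 φ) {η e δ : ℝ} (he : 0 < e) (heη : 8 * e ≤ η) (hδ : 5 ≤ δ)
    (hfφ : ∀ t ∉ Ioo (0 : ℝ) 1, -δ < t → t < 1 + δ → f t ≤ φ t - η) {t₁ : ℝ}
    (ht₁ : t₁ ∈ Ioo (0 : ℝ) 1) (hv : φ t₁ - e ≤ v t₁) :
    ∃ t₀ ∈ Ioo (0 : ℝ) 1, 0 ≤ dirLap s δ φ f t₀ 1 (φ t₀ - 2 * e) := by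
  obtain ⟨V, hVusc, hVb, hVv, hvV⟩ := hsol.exists_upperSemicontinuous_eq_upperEnv
  obtain ⟨σ, hσ₀, hσe, hcor⟩ := exists_integral_correction_nonpos hs₀ hs₁
    (show 0 < η by linarith) (b := 16 * e) (by linarith)
  obtain ⟨m, hVm, τ, hτ, d, hd, t₀, m', hnear, htouch, hVle, hm', hm'm⟩ :=
    exists_touching_addParabola hVusc hVb hφ.continuous hσ₀
  have hd0 : 0 < d := by rw [hd]; exact lt_min hτ.1 (by linarith [hτ.2])
  have hdτ : d ≤ τ := hd ▸ min_le_left _ _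
  have hdτ' : d ≤ 1 - τ := hd ▸ min_le_right _ _
  obtain ⟨hn₁, hn₂⟩ := abs_lt.1 hnear
  have hab : Ioo (τ - d / 2) (τ + d / 2) ⊆ Ioo 0 1 :=
    Ioo_subset_Ioo (by linarith) (by linarith)
  obtain ⟨ψ, hψ_near, hψ_in, hψ_out, hψ_int, hψ_nonneg⟩ :=
    hsol.exists_dirLap_nonneg_of_touching hs₀ hs₁ hf hVusc.measurable hVb hVv
      (contDiff_addParabola hφ σ τ d m') hab (r := d / 4) (by linarith)
      (by rw [Real.ball_eq_Ioo]; exact Ioo_subset_Ioo (by linarith) (by linarith)) htouch.symm hVle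
  have hψ_le : ∀ t ∈ Ioo (0 : ℝ) 1, ψ t ≤ φ t + m + σ / 4 := fun t ht => by
    by_cases h : t ∈ Ioo (τ - d / 2) (τ + d / 2)
    · rw [hψ_near h]; linarith [addParabola_le (φ := φ) (m := m') hσ₀ hd0 h]
    · rw [hψ_in ⟨ht, h⟩]; linarith [hVm t ht]
  have ht₀ : t₀ ∈ Ioo (0 : ℝ) 1 := hab ⟨by linarith, by linarith⟩
  refine ⟨t₀, ht₀, dirLap_nonneg_of_dirLap_add_correction hs₀ hs₁ hd0 (by linarith) hφ hf hcor
    hψ_int hψ_nonneg fun t ht => dirLapIntegrand_addParabola_le hτ hd hnear hσ₀ hσe heη hδ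
      (by linarith [hVm t₁ ht₁, hvV t₁ ht₁]) ?_ hψ_le hψ_out hfφ ht⟩
  have : 0 ≤ σ * ((t₀ - τ) / d) ^ 2 := by positivity
  unfold addParabola; linarith

end Touching

/-! ### `s`-convex functions are subsolutions -/

section WeightedSpace

variable {s : ℝ}

lemma integrable_div_rpow_comp_affine (hs₀ : 0 < s) {F : ℝ → ℝ}
    (hF : Integrable fun r : ℝ => F r / (1 + |r|) ^ (1 + 2 * s)) (a : ℝ) {c : ℝ} (hc : 0 < c) :
    Integrable fun r : ℝ => F (a + c * r) / (1 + |r|) ^ (1 + 2 * s) := by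
  set p := 1 + 2 * s
  have hcomp : Integrable fun r => F (a + c * r) / (1 + |a + c * r|) ^ p :=
    (hF.comp_add_left a).comp_mul_left' hc.ne'
  have hweight : ∀ r : ℝ, (1 + |a + c * r|) ^ p / (1 + |r|) ^ p ≤ (1 + |a| + c) ^ p := fun r => by
    rw [div_le_iff₀ (by positivity), ← Real.mul_rpow (by positivity) (by positivity)]
    refine Real.rpow_le_rpow (by positivity) ?_ (by linarith)
    have habs : |a + c * r| ≤ |a| + c * |r| := by
      simpa only [abs_mul, abs_of_pos hc] using abs_add_le a (c * r)
    have hprod : 0 ≤ |a| * |r| := by positivity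
    nlinarith [abs_nonneg r]
  have hcont : Continuous fun r : ℝ => (1 + |a + c * r|) ^ p / (1 + |r|) ^ p :=
    .div (.rpow_const (by fun_prop) fun t => .inr (by linarith))
      (.rpow_const (by fun_prop) fun t => .inr (by linarith)) fun r => by positivity
  refine (hcomp.mul_bdd (c := (1 + |a| + c) ^ p) hcont.aestronglyMeasurable
    (.of_forall fun r => ?_)).congr (.of_forall fun r => ?_)
  · rw [Real.norm_eq_abs, abs_of_nonneg (by positivity)]
    exact hweight r
  · have : 0 < (1 + |a + c * r|) ^ p := by positivity
    simp only
    field_simp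

lemma norm_div_one_add_abs_rpow (x r p : ℝ) :
    ‖x / (1 + |r|) ^ p‖ = |x| / (1 + |r|) ^ p := by
  rw [norm_div, Real.norm_eq_abs, Real.norm_of_nonneg (by positivity)]

lemma continuous_one_add_abs_rpow {p : ℝ} (hp : 0 ≤ p) :
    Continuous fun r : ℝ => (1 + |r|) ^ p :=
  .rpow_const (by fun_prop) fun _ => .inr hp

lemma MemLs.integrable (hs₀ : 0 < s) {f : ℝ → ℝ} (hf : MemLs s f) :
    Integrable fun r : ℝ => f r / (1 + |r|) ^ (1 + 2 * s) :=
  hf.2.mono' (hf.1.aestronglyMeasurable.div₀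
    (continuous_one_add_abs_rpow (by linarith)).aestronglyMeasurable)
    (.of_forall fun r => (norm_div_one_add_abs_rpow _ _ _).le)

lemma memLs_of_continuous (hs₀ : 0 < s) {f : ℝ → ℝ} (hf : Continuous f) {M : ℝ}
    (hM : ∀ t, |f t| ≤ M) : MemLs s f := by
  refine ⟨hf.locallyIntegrable, ?_⟩
  have hweight : Integrable fun r : ℝ => (1 + ‖r‖) ^ (-(1 + 2 * s)) :=
    integrable_one_add_norm (by simp; linarith)
  refine (hweight.const_mul M).mono' (hf.abs.aestronglyMeasurable.div₀
    (continuous_one_add_abs_rpow (by linarith)).aestronglyMeasurable) (.of_forall fun r => ?_)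
  rw [norm_div_one_add_abs_rpow, abs_abs, Real.rpow_neg (by positivity), Real.norm_eq_abs,
    ← div_eq_mul_inv]
  gcongr
  exact hM r

end WeightedSpace

section Chord

lemma exists_eq_Ioo {S : Set ℝ} (hS : IsOpen S) (hconv : Convex ℝ S)
    (hb : Bornology.IsBounded S) (hne : S.Nonempty) : ∃ a b : ℝ, a < b ∧ S = Ioo a b := by
  have hIoo : Ioo (sInf S) (sSup S) ⊆ S :=
    IsConnected.Ioo_csInf_csSup_subset ⟨hne, hconv.isPreconnected⟩ hb.bddBelow hb.bddAbove
  have hIcc : S ⊆ Icc (sInf S) (sSup S) := fun t ht =>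
    ⟨csInf_le hb.bddBelow ht, le_csSup hb.bddAbove ht⟩
  have hS_eq : S = Ioo (sInf S) (sSup S) := by
    refine Subset.antisymm ?_ hIoo
    simpa only [hS.interior_eq, interior_Icc] using interior_mono hIcc
  exact ⟨_, _, nonempty_Ioo.1 (hS_eq ▸ hne), hS_eq⟩

lemma exists_chord {E : Type*} [NormedAddCommGroup E] [NormedSpace ℝ E] {K : Set E}
    (hK : IsOpen K) (hconv : Convex ℝ K) (hb : Bornology.IsBounded K) {x z : E} (hz : z ≠ 0)
    (hx : x ∈ K) :
    ∃ (p : E) (l t₁ : ℝ), 0 < l ∧ p ∈ closure K ∧ p + l • z ∈ closure K ∧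
      (∀ t : ℝ, p + t • l • z ∈ K ↔ t ∈ Ioo 0 1) ∧ p + t₁ • l • z = x := by
  set S : Set ℝ := (fun t : ℝ => x + t • z) ⁻¹' K with hS
  have hline : Continuous fun t : ℝ => x + t • z := by fun_prop
  have hSb : Bornology.IsBounded S := by
    obtain ⟨R, hR⟩ := hb.exists_norm_le
    refine isBounded_iff_forall_norm_le.2 ⟨2 * R / ‖z‖, fun t ht => ?_⟩
    rw [le_div_iff₀ (norm_pos_iff.2 hz), ← norm_smul]
    calc ‖t • z‖ = ‖(x + t • z) - x‖ := by rw [add_sub_cancel_left]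
      _ ≤ ‖x + t • z‖ + ‖x‖ := norm_sub_le _ _
      _ ≤ 2 * R := by linarith [hR _ ht, hR _ hx]
  have hSc : Convex ℝ S := (hconv.translate_preimage_right x).is_linear_preimage
    (f := fun t : ℝ => t • z) ⟨fun _ _ => add_smul _ _ _, fun c t => by simp [mul_smul]⟩
  have h0S : (0 : ℝ) ∈ S := by simpa [hS] using hx
  obtain ⟨a, b, hab, hSab⟩ := exists_eq_Ioo (S := S) (hK.preimage hline) hSc hSb ⟨0, h0S⟩
  have hclosure : ∀ t ∈ Icc a b, x + t • z ∈ closure K := fun t ht => by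
    rw [← closure_Ioo hab.ne, ← hSab] at ht
    exact map_mem_closure (f := fun t : ℝ => x + t • z) hline ht fun _ => id
  have hl : 0 < b - a := sub_pos.2 hab
  refine ⟨x + a • z, b - a, -a / (b - a), hl, hclosure a (left_mem_Icc.2 hab.le), ?_,
    fun t => ?_, ?_⟩
  · rw [add_assoc, ← add_smul, add_sub_cancel]
    exact hclosure b (right_mem_Icc.2 hab.le)
  · have hpt : x + a • z + t • (b - a) • z = x + (a + t * (b - a)) • z := by module
    have hmem : a + t * (b - a) ∈ S ↔ t ∈ Ioo 0 1 := by
      rw [hSab, mem_Ioo, mem_Ioo, lt_add_iff_pos_right, mul_pos_iff_of_pos_right hl,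
        ← lt_sub_iff_add_lt', mul_lt_iff_lt_one_left hl]
    rw [hpt]
    exact hmem
  · rw [smul_smul, div_mul_cancel₀ _ hl.ne', neg_smul, add_neg_cancel_right]

end Chord

section SConvex

variable {N : ℕ} {s : ℝ} {Ω : Set (EuclideanSpace ℝ (Fin N))}
  {g w : EuclideanSpace ℝ (Fin N) → ℝ}

lemma MemLineLs.exists_bound (hw : MemLineLs s Ω w) (hΩ : Bornology.IsBounded Ω) :
    ∃ M, ∀ x ∈ Ω, |w x| ≤ M := by
  obtain ⟨R, hR⟩ := hΩ.exists_norm_le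
  exact (hw.locallyBounded R).imp fun M hM x hx => hM x (hR x hx)

lemma MemLineLs.integrable_div_rpow (hs₀ : 0 < s) (hw : MemLineLs s Ω w)
    {p z : EuclideanSpace ℝ (Fin N)} (hz : ‖z‖ = 1) {l t : ℝ} (hl : 0 < l)
    (hp : p + t • l • z ∈ Ω) :
    Integrable fun r : ℝ => w (p + r • l • z) / (1 + |r|) ^ (1 + 2 * s) := by
  have hpt : ∀ r : ℝ, p + t • l • z + (-(t * l) + l * r) • z = p + r • l • z := fun r => by module
  simpa only [hpt] using integrable_div_rpow_comp_affine hs₀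
    ((hw.lines _ hp z hz).integrable hs₀) (-(t * l)) hl

lemma SConvexOn.exists_isDirichletSol {A : Set (EuclideanSpace ℝ (Fin N))} (hw : SConvexOn s A w)
    (hA : Convex ℝ A) {p y : EuclideanSpace ℝ (Fin N)} (hp : p ∈ A) (hpy : p + y ∈ A)
    (hy : y ≠ 0) :
    ∃ v : ℝ → ℝ, IsDirichletSol s (fun t => w (p + t • y)) v ∧
      ∀ t ∈ Ioo (0 : ℝ) 1, w (p + t • y) ≤ v t := by
  have hpt : ∀ t : ℝ, t • (p + y) + (1 - t) • p = p + t • y := fun t => by module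
  simpa only [hpt] using hw (p + y) hpy p hp (by simpa using hy) (hA.openSegment_subset hpy hp)

lemma add_smul_mem_ball_of_notMem_Ioo {E : Type*} [NormedAddCommGroup E] [NormedSpace ℝ E]
    {x₀ p y : E} {ρ κ t : ℝ} (hp : p ∈ Metric.closedBall x₀ ρ)
    (hpy : p + y ∈ Metric.closedBall x₀ ρ) (hy : y ≠ 0) (ht : t ∉ Ioo (0 : ℝ) 1)
    (hlt : -κ < t) (hgt : t < 1 + κ) :
    p + t • y ∈ Metric.ball x₀ (ρ + κ * ‖y‖) := by
  have hnear : ∀ {q}, q ∈ Metric.closedBall x₀ ρ → ∀ {r : ℝ}, |r| < κ →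
      q + r • y ∈ Metric.ball x₀ (ρ + κ * ‖y‖) := fun {q} hq {r} hr => by
    have hdist := dist_triangle (q + r • y) q x₀
    rw [dist_self_add_left, norm_smul, Real.norm_eq_abs] at hdist
    have hry := mul_lt_mul_of_pos_right hr (norm_pos_iff.2 hy)
    exact hdist.trans_lt (by linarith [Metric.mem_closedBall.1 hq])
  rw [mem_Ioo, not_and_or, not_lt, not_lt] at ht
  obtain h0 | h1 := ht
  · exact hnear hp (abs_lt.2 ⟨hlt, by linarith⟩)
  · have hpt : p + t • y = p + y + (t - 1) • y := by module
    rw [hpt]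
    exact hnear hpy (abs_lt.2 ⟨by linarith, by linarith⟩)

lemma dirLap_nonneg_of_comp_line {E : Type*} [NormedAddCommGroup E] [NormedSpace ℝ E]
    [FiniteDimensional ℝ E] (hs₀ : 0 < s) (hs₁ : s < 1) {δ : ℝ} (hδ : 0 < δ)
    {φ w U : E → ℝ} (hφ : ContDiff ℝ 2 φ) (hU : IsLineBounded U) (hwU : ∀ x, w x ≤ U x) {p y : E}
    (hw : Integrable fun r : ℝ => w (p + r • y) / (1 + |r|) ^ (1 + 2 * s)) {t₀ a : ℝ}
    (h : 0 ≤ dirLap s δ (fun t : ℝ => φ (p + t • y)) (fun t => w (p + t • y)) t₀ 1 a) :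
    0 ≤ dirLap s δ φ U (p + t₀ • y) y a := by
  refine h.trans (integral_kernelMeasure_mono (integrable_dirLapIntegrand_of_integrable
    hs₀ hs₁ hδ (hφ.comp (by fun_prop)) hw _ _)
    (integrable_dirLapIntegrand hs₀ hs₁ hδ hφ hU _ _ _) fun t _ => ?_)
  have hadd : p + (t₀ + t) • y = p + t₀ • y + t • y := by module
  have hsub : p + (t₀ - t) • y = p + t₀ • y - t • y := by module
  simp only [dirLapIntegrand, secondDiff, smul_eq_mul, mul_one, hadd, hsub]
  split_ifs
  · exact le_rfl
  · linarith [hwU (p + t₀ • y + t • y), hwU (p + t₀ • y - t • y)]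

/-- Reparametrising the chord of `Ω ∩ B(x₀, ρ)` in direction `z` by `(0, 1)` reduces this to the
one-dimensional `IsDirichletSol.exists_dirLap_nonneg`. -/
lemma SConvexOn.exists_dirLap_nonneg (hs₀ : 0 < s) (hs₁ : s < 1) (hΩ : IsOpen Ω)
    (hconv : Convex ℝ Ω) (hwL : MemLineLs s Ω w) (hwC : SConvexOn s (closure Ω) w)
    {φ U : EuclideanSpace ℝ (Fin N) → ℝ} (hφ : ContDiff ℝ 2 φ) (hU : IsLineBounded U)
    (hwU : ∀ x, w x ≤ U x) {x₀ x₁ z : EuclideanSpace ℝ (Fin N)} (hz : ‖z‖ = 1) {ρ η e δ : ℝ}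
    (he : 0 < e) (heη : 8 * e ≤ η) (hρδ : 10 * ρ ≤ δ)
    (hwφ : ∀ y ∈ Metric.ball x₀ (ρ + δ), y ∉ Ω ∩ Metric.ball x₀ ρ → w y ≤ φ y - η)
    (hx₁ : x₁ ∈ Ω ∩ Metric.ball x₀ ρ) (hwx₁ : φ x₁ - e ≤ w x₁) :
    ∃ x₂ ∈ Ω ∩ Metric.ball x₀ ρ, 0 ≤ dirLap s δ φ U x₂ z (φ x₂ - 2 * e) := by
  have hz0 : z ≠ 0 := norm_pos_iff.1 (hz ▸ one_pos)
  obtain ⟨p, l, t₁, hl, hp, hpl, hchord, rfl⟩ := exists_chord (hΩ.inter Metric.isOpen_ball)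
    (hconv.inter (convex_ball x₀ ρ)) (Metric.isBounded_ball.subset inter_subset_right) hz0 hx₁
  have hball : closure (Ω ∩ Metric.ball x₀ ρ) ⊆ Metric.closedBall x₀ ρ :=
    (closure_mono inter_subset_right).trans Metric.closure_ball_subset_closedBall
  have hclosure : closure (Ω ∩ Metric.ball x₀ ρ) ⊆ closure Ω := closure_mono inter_subset_left
  have hlz : ‖l • z‖ = l := by rw [norm_smul, hz, mul_one, Real.norm_of_nonneg hl.le]
  have hl_le : l ≤ 2 * ρ := by
    have hdist := dist_triangle_right (p + l • z) p x₀
    rw [dist_self_add_left, hlz] at hdist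
    linarith [Metric.mem_closedBall.1 (hball hp), Metric.mem_closedBall.1 (hball hpl)]
  have hlz0 : l • z ≠ 0 := smul_ne_zero hl.ne' hz0
  have hδl : 5 ≤ δ / l := by rw [le_div_iff₀ hl]; linarith
  obtain ⟨v, hv, hwv⟩ :=
    hwC.exists_isDirichletSol hconv.closure (hclosure hp) (hclosure hpl) hlz0
  have hw_int := hwL.integrable_div_rpow hs₀ hz hl hx₁.1
  have ht₁ : t₁ ∈ Ioo (0 : ℝ) 1 := (hchord t₁).1 hx₁
  obtain ⟨t₀, ht₀, hnonneg⟩ := hv.exists_dirLap_nonneg hs₀ hs₁ hw_int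
    (φ := fun t => φ (p + t • l • z)) (hφ.comp (by fun_prop)) he heη hδl
    (fun t ht hlt hgt => hwφ _ (by
      simpa only [hlz, div_mul_cancel₀ _ hl.ne'] using
        add_smul_mem_ball_of_notMem_Ioo (hball hp) (hball hpl) hlz0 ht hlt hgt)
      fun h => ht ((hchord t).1 h)) ht₁ (hwx₁.trans (hwv t₁ ht₁))
  refine ⟨p + t₀ • l • z, (hchord t₀).2 ht₀, ?_⟩
  have hscaled := dirLap_nonneg_of_comp_line hs₀ hs₁ (by linarith) hφ hU hwU hw_int hnonneg
  rw [dirLap_smul_dir hl, mul_div_cancel₀ _ hl.ne'] at hscaled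
  exact nonneg_of_mul_nonneg_right hscaled (Real.rpow_pos_of_pos hl _)

/-- Outside `Ω` the gap comes from the datum; outside a small ball it comes from the strictness
of the touching. -/
lemma exists_forall_le_sub_of_strict_touching {E : Type*} [NormedAddCommGroup E] {Ω : Set E}
    (hΩ : IsOpen Ω) {g W φ : E → ℝ} (hg : ContinuousOn g Ωᶜ) (hφ : Continuous φ)
    (hWg : ∀ x ∉ Ω, W x = g x) {x₀ : E} (hx₀ : x₀ ∈ Ω ∨ x₀ ∈ frontier Ω ∧ g x₀ < φ x₀)
    {γ r R : ℝ} (hγ : 0 < γ) (hr : 0 < r)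
    (hle : ∀ x ∈ Metric.ball x₀ R, W x ≤ φ x - γ * ‖x - x₀‖ ^ 2) :
    ∃ ρ η : ℝ, 0 < ρ ∧ ρ ≤ r ∧ 0 < η ∧
      ∀ x ∈ Metric.ball x₀ R, x ∉ Ω ∩ Metric.ball x₀ ρ → W x ≤ φ x - η := by
  obtain ⟨η, hη, hgap⟩ := exists_eventually_datum_lt_sub hΩ hg hx₀
  have hφx : ∀ᶠ x in 𝓝 x₀, φ x₀ - η / 2 < φ x :=
    hφ.continuousAt.eventually (lt_mem_nhds (by linarith))
  obtain ⟨r', hr', hball⟩ := Metric.eventually_nhds_iff_ball.1 (hgap.and hφx)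
  set ρ := min r r'
  have hρ : 0 < ρ := lt_min hr hr'
  refine ⟨ρ, min (η / 2) (γ * ρ ^ 2), hρ, min_le_left _ _, by positivity, fun x hx hxΩ => ?_⟩
  by_cases hxρ : x ∈ Metric.ball x₀ ρ
  · have hx' : x ∉ Ω := fun h => hxΩ ⟨h, hxρ⟩
    obtain ⟨hdatum, hφlt⟩ := hball x (Metric.ball_subset_ball (min_le_right _ _) hxρ)
    rw [hWg x hx']
    linarith [hdatum hx', min_le_left (η / 2) (γ * ρ ^ 2)]
  · rw [Metric.mem_ball, dist_eq_norm, not_lt] at hxρ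
    have hfar : γ * ρ ^ 2 ≤ γ * ‖x - x₀‖ ^ 2 := by gcongr
    linarith [hle x hx, min_le_right (η / 2) (γ * ρ ^ 2)]

lemma isSubsolOn_upperEnv_of_mem_belowDatum (hs₀ : 0 < s) (hs₁ : s < 1) (hΩ : IsOpen Ω)
    (hconv : Convex ℝ Ω) (hg : ContinuousOn g Ωᶜ) (hw : w ∈ belowDatum s Ω g)
    {W : EuclideanSpace ℝ (Fin N) → ℝ} (hWw : EqOn W w Ω) (hWg : ∀ x ∉ Ω, W x = g x)
    {M : ℝ} (hM : ∀ x, |W x| ≤ M) :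
    IsSubsolOn s {x | x ∈ Ω ∨ x ∈ frontier Ω ∧ g x < upperEnv W x} (upperEnv W) := by
  obtain ⟨hwL, hwC, hwg⟩ := hw
  have hUsc : UpperSemicontinuous (upperEnv W) := upperSemicontinuous_upperEnv hM
  have hUb : ∃ M, ∀ x, |upperEnv W x| ≤ M := ⟨M, fun x => abs_upperEnv_le (.of_forall hM)⟩
  have hWU : ∀ x, W x ≤ upperEnv W x := fun x => le_upperEnv (.of_forall hM)
  have hwW : ∀ x, w x ≤ W x := fun x => by
    by_cases hx : x ∈ Ω
    · exact (hWw hx).ge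
    · exact (hwg x hx).trans_eq (hWg x hx).symm
  refine isSubsolOn_of_strict_touching hs₀ hs₁ hUsc hUb
    fun x₀ hx₀ φ z R γ δ r hφ h0 hγ hle hδ hz hR hr hneg => ?_
  have hφ_gt : ∀ᶠ x in 𝓝 x₀, φ x₀ - r / 2 < φ x :=
    hφ.continuous.continuousAt.eventually (lt_mem_nhds (by linarith))
  obtain ⟨r', hr', hball⟩ := Metric.eventually_nhds_iff_ball.1 hφ_gt
  obtain ⟨ρ, η, hρ, hρ_le, hη, hoff⟩ := exists_forall_le_sub_of_strict_touching hΩ hg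
    hφ.continuous hWg (by rwa [h0]) hγ (r := min (min r r') (δ / 10)) (by positivity)
    fun x hx => (hWU x).trans (hle x hx)
  obtain ⟨⟨hρr, hρr'⟩, hρδ⟩ := (le_min_iff.1 hρ_le).imp_left le_min_iff.1
  have hoff' : ∀ x ∈ Metric.ball x₀ (ρ + δ), x ∉ Ω ∩ Metric.ball x₀ ρ → W x ≤ φ x - η :=
    fun x hx => hoff x (Metric.ball_subset_ball (by linarith) hx)
  obtain ⟨e, he, he_lt⟩ := exists_between (show 0 < min (η / 8) (r / 4) by positivity)
  obtain ⟨heη, her⟩ := lt_min_iff.1 he_lt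
  have hφ_lt : ∀ᶠ x in 𝓝 x₀, φ x < φ x₀ + e / 2 :=
    hφ.continuous.continuousAt.eventually (gt_mem_nhds (by linarith))
  obtain ⟨x₁, hx₁W, hx₁φ, hx₁ρ⟩ := ((frequently_lt_of_lt_upperEnv (c := upperEnv W x₀ - e / 2)
    (.of_forall hM) (by linarith)).and_eventually
      (hφ_lt.and (Metric.ball_mem_nhds x₀ hρ))).exists
  have hx₁Ω : x₁ ∈ Ω := by
    by_contra hx₁
    linarith [hoff' x₁ (Metric.ball_subset_ball (by linarith) hx₁ρ) fun h => hx₁ h.1]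
  obtain ⟨x₂, ⟨-, hx₂⟩, hnonneg⟩ := hwC.exists_dirLap_nonneg hs₀ hs₁ hΩ hconv hwL hφ
    (.of_upperSemicontinuous hUsc hUb) (fun x => (hwW x).trans (hWU x)) hz he (by linarith)
    (by linarith) (fun x hx hxΩ => (hwW x).trans (hoff' x hx hxΩ)) ⟨hx₁Ω, hx₁ρ⟩
    (by rw [← hWw hx₁Ω]; linarith)
  exact absurd hnonneg (hneg x₂ (Metric.ball_subset_ball hρr hx₂) _
    (by linarith [hball x₂ (Metric.ball_subset_ball hρr' hx₂)])).not_ge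

lemma le_of_mem_belowDatum [Nontrivial (EuclideanSpace ℝ (Fin N))] (hs₀ : 0 < s) (hs₁ : s < 1)
    (hΩ : IsStrictlyConvexDomain Ω) (hg : ContinuousOn g Ωᶜ)
    (hgb : ∃ M : ℝ, ∀ x ∈ Ωᶜ, |g x| ≤ M) {V : EuclideanSpace ℝ (Fin N) → ℝ}
    (hV : Continuous V) (hVb : ∃ M : ℝ, ∀ x, |V x| ≤ M) (hVg : ∀ x ∉ Ω, V x = g x)
    (hVs : IsSupersolOn s Ω V) (hw : w ∈ belowDatum s Ω g) (x : EuclideanSpace ℝ (Fin N)) :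
    w x ≤ V x := by
  classical
  by_cases hx : x ∉ Ω
  · exact (hw.2.2 x hx).trans_eq (hVg x hx).symm
  rw [not_not] at hx
  obtain ⟨M₁, hM₁⟩ := hw.1.exists_bound hΩ.bounded
  obtain ⟨M₂, hM₂⟩ := hgb
  set W := Ω.piecewise w g
  have hWw : EqOn W w Ω := piecewise_eqOn _ _ _
  have hWg : ∀ y ∉ Ω, W y = g y := fun y => piecewise_eq_of_notMem _ _ _
  have hM : ∀ y, |W y| ≤ max M₁ M₂ := fun y => by
    by_cases hy : y ∈ Ω
    · rw [hWw hy]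
      exact (hM₁ y hy).trans (le_max_left _ _)
    · rw [hWg y hy]
      exact (hM₂ y hy).trans (le_max_right _ _)
  have hsub := isSubsolOn_upperEnv_of_mem_belowDatum hs₀ hs₁ hΩ.isOpen hΩ.convex hg hw
    hWw hWg hM
  have hU : UpperSemicontinuous (upperEnv W) := upperSemicontinuous_upperEnv hM
  have hUb : ∃ M, ∀ y, |upperEnv W y| ≤ M := ⟨_, fun y => abs_upperEnv_le (.of_forall hM)⟩
  have hext : ∀ y ∉ closure Ω, upperEnv W y ≤ g y := fun y hy => by
    rw [upperEnv_of_continuousAt (continuousAt_of_eq_datum hg hWg hy),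
      hWg y fun h => hy (subset_closure h)]
  have hUg := hsub.le_datum hs₀ hs₁ hΩ hg hU hUb hext
  have hUV := (hsub.mono fun y => .inl).le_of_isSupersolOn hs₀ hs₁ hΩ.isOpen hΩ.bounded hU hUb hVs
    hV.lowerSemicontinuous hVb fun y hy => (hUg y hy).trans_eq (hVg y hy).symm
  calc w x = W x := (hWw hx).symm
    _ ≤ upperEnv W x := le_upperEnv (.of_forall hM)
    _ ≤ V x := hUV x

lemma mem_belowDatum (hs₀ : 0 < s) (hs₁ : s < 1) (hΩ : IsStrictlyConvexDomain Ω)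
    {W : EuclideanSpace ℝ (Fin N) → ℝ} (hW : Continuous W) (hWb : ∃ M : ℝ, ∀ x, |W x| ≤ M)
    (hWg : ∀ x ∉ Ω, W x ≤ g x) (hWs : IsSubsolOn s Ω W) : W ∈ belowDatum s Ω g := by
  obtain ⟨M, hM⟩ := hWb
  refine ⟨⟨hW.aestronglyMeasurable, fun R => ⟨M, fun x _ => hM x⟩, fun x _ z _ =>
    memLs_of_continuous hs₀ (by fun_prop) fun t => hM _⟩, fun x hx y hy hxy _ => ?_, hWg⟩
  obtain ⟨v, hv, hvb, hvf, hvs, hsol⟩ := exists_continuous_isDirichletSol hs₀ hs₁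
    (f := fun t : ℝ => W (t • x + (1 - t) • y)) (by fun_prop) ⟨M, fun t => hM _⟩
  have hpt : ∀ t : ℝ, y + ContinuousLinearMap.toSpanSingleton ℝ (x - y) t
      = t • x + (1 - t) • y := fun t => by
    rw [ContinuousLinearMap.toSpanSingleton_apply]; module
  have hmaps : MapsTo (fun t : ℝ => y + ContinuousLinearMap.toSpanSingleton ℝ (x - y) t)
      (Ioo 0 1) Ω := fun t ht => by
    simp only [hpt]
    exact hΩ.openSegment_subset hx hy hxy
      ⟨t, 1 - t, ht.1, sub_pos.2 ht.2, add_sub_cancel _ _, rfl⟩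
  refine ⟨v, hsol, fun t _ => ?_⟩
  rw [← hpt]
  exact comparison hs₀ hs₁ hΩ.isOpen isOpen_Ioo (Metric.isBounded_Ioo 0 1)
    hW.upperSemicontinuous ⟨M, hM⟩ hv.lowerSemicontinuous hvb y _ hmaps hWs hvs
    (fun t ht => by rw [hpt, hvf t ht]) t

end SConvex

/-! ### Viscosity solutions -/

section Evaluation

lemma setIntegral_le_abs_eq {H : ℝ → ℝ} {δ : ℝ} (hδ : 0 < δ) (hH : IntegrableOn H (Ici δ))
    (hH' : IntegrableOn (fun t => H (-t)) (Ici δ)) :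
    ∫ t in {t : ℝ | δ ≤ |t|}, H t = ∫ t in Ici δ, (H (-t) + H t) := by
  have hsplit : {t : ℝ | δ ≤ |t|} = Iic (-δ) ∪ Ici δ := by
    ext t
    simp only [mem_ofPred_eq, le_abs', mem_union, mem_Iic, mem_Ici]
  have hleft : IntegrableOn H (Iic (-δ)) := by
    rw [← neg_neg δ] at hH'
    simpa only [neg_neg] using IntegrableOn.comp_neg_Iic (c := -δ) hH'
  have hdisj : Disjoint (Iic (-δ)) (Ici δ) :=
    Iic_disjoint_Ici.2 (not_le.2 (by linarith))
  rw [hsplit, setIntegral_union hdisj measurableSet_Ici hleft hH, integral_add hH' hH,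
    integral_Ici_eq_integral_Ioi (f := fun t => H (-t)), integral_comp_neg_Ioi]

lemma IsLineBounded.integrableOn_Ici_div_rpow {E : Type*} [NormedAddCommGroup E] [NormedSpace ℝ E]
    {s : ℝ} (hs₀ : 0 < s) {w : E → ℝ} (hw : IsLineBounded w) {δ : ℝ} (hδ : 0 < δ) (x z : E) :
    IntegrableOn (fun t : ℝ => (w (x + t • z) - w x) / t ^ (1 + 2 * s)) (Ici δ) := by
  obtain ⟨M, hM⟩ := hw.bounded
  have hInt : Integrable ((Ici δ).indicator fun t : ℝ => w (x + t • z) - w x)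
      (kernelMeasure s) := by
    refine ((integrable_indicator_Ici hs₀ hδ).const_mul (2 * M)).mono'
      (((hw.measurable x z).sub_const _).indicator measurableSet_Ici).aestronglyMeasurable
      (Eventually.of_forall fun t => ?_)
    by_cases ht : t ∈ Ici δ
    · rw [indicator_of_mem ht, indicator_of_mem ht, mul_one, Real.norm_eq_abs]
      exact (abs_sub _ _).trans (by linarith [hM (x + t • z), hM x])
    · rw [indicator_of_notMem ht, indicator_of_notMem ht, norm_zero, mul_zero]
  rw [integrable_kernelMeasure_iff] at hInt
  refine (integrableOn_congr_fun (fun t (ht : t ∈ Ici δ) => ?_) measurableSet_Ici).1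
    (hInt.mono_set fun t ht => hδ.trans_le ht)
  simp only [indicator_of_mem ht]

variable {N : ℕ} {s δ : ℝ} {φ w : EuclideanSpace ℝ (Fin N) → ℝ}

lemma innerPart_eq_integral_kernelMeasure (s δ : ℝ) (φ w : EuclideanSpace ℝ (Fin N) → ℝ)
    (x z : EuclideanSpace ℝ (Fin N)) (a : ℝ) :
    innerPart s δ φ x z
      = ∫ t, (Ioo 0 δ).indicator (dirLapIntegrand δ φ w x z a) t ∂kernelMeasure s := by
  rw [← setIntegral_div_rpow_eq measurableSet_Ioo fun t ht => ht.1, innerPart]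
  refine setIntegral_congr_fun measurableSet_Ioo fun t ht => ?_
  simp only [dirLapIntegrand, if_pos ht.2, secondDiff]

lemma outerPart_eq_integral_kernelMeasure (hs₀ : 0 < s) (hδ : 0 < δ) (hw : IsLineBounded w)
    (φ : EuclideanSpace ℝ (Fin N) → ℝ) (x z : EuclideanSpace ℝ (Fin N)) :
    outerPart s δ w x z
      = ∫ t, (Ici δ).indicator (dirLapIntegrand δ φ w x z (w x)) t ∂kernelMeasure s := by
  set H : ℝ → ℝ := fun t => (w (x + t • z) - w x) / |t| ^ (1 + 2 * s) with hH
  have hright : ∀ t ∈ Ici δ, H t = (w (x + t • z) - w x) / t ^ (1 + 2 * s) := fun t ht => by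
    simp only [hH, abs_of_pos (hδ.trans_le (mem_Ici.1 ht))]
  have hleft : ∀ t ∈ Ici δ, H (-t) = (w (x + t • -z) - w x) / t ^ (1 + 2 * s) := fun t ht => by
    simp only [hH, abs_neg, abs_of_pos (hδ.trans_le (mem_Ici.1 ht)), neg_smul, smul_neg]
  have hInt : IntegrableOn H (Ici δ) :=
    (integrableOn_congr_fun hright measurableSet_Ici).2 (hw.integrableOn_Ici_div_rpow hs₀ hδ x z)
  have hInt' : IntegrableOn (fun t => H (-t)) (Ici δ) :=
    (integrableOn_congr_fun hleft measurableSet_Ici).2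
      (hw.integrableOn_Ici_div_rpow hs₀ hδ x (-z))
  rw [← setIntegral_div_rpow_eq measurableSet_Ici fun t ht => hδ.trans_le ht, outerPart,
    setIntegral_le_abs_eq hδ hInt hInt']
  refine setIntegral_congr_fun measurableSet_Ici fun t ht => ?_
  simp only [hleft t ht, hright t ht, dirLapIntegrand, if_neg (not_lt.2 (mem_Ici.1 ht)), smul_neg,
    ← sub_eq_add_neg]
  ring

lemma innerPart_add_outerPart (hs₀ : 0 < s) (hs₁ : s < 1) (hδ : 0 < δ) (hφ : ContDiff ℝ 2 φ)
    (hw : IsLineBounded w) (x z : EuclideanSpace ℝ (Fin N)) :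
    innerPart s δ φ x z + outerPart s δ w x z = dirLap s δ φ w x z (w x) := by
  have hInt := integrable_dirLapIntegrand hs₀ hs₁ hδ hφ hw x z (w x)
  rw [innerPart_eq_integral_kernelMeasure s δ φ w x z (w x),
    outerPart_eq_integral_kernelMeasure hs₀ hδ hw φ,
    ← integral_add (hInt.indicator measurableSet_Ioo) (hInt.indicator measurableSet_Ici), dirLap]
  refine integral_congr_ae ?_
  filter_upwards [ae_kernelMeasure_pos s] with t ht
  rcases lt_or_ge t δ with h | h
  · rw [indicator_of_mem (show t ∈ Ioo 0 δ from ⟨ht, h⟩), indicator_of_notMem (notMem_Ici.2 h),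
      add_zero]
  · rw [indicator_of_notMem fun ht => h.not_gt ht.2, indicator_of_mem (mem_Ici.2 h), zero_add]

lemma evalE_eq_neg_iInf_dirLap (hs₀ : 0 < s) (hs₁ : s < 1) (hδ : 0 < δ) (hφ : ContDiff ℝ 2 φ)
    (hw : IsLineBounded w) (x : EuclideanSpace ℝ (Fin N)) :
    evalE s δ w φ x
      = -⨅ z : Metric.sphere (0 : EuclideanSpace ℝ (Fin N)) 1, dirLap s δ φ w x z (w x) := by
  simp only [evalE, innerPart_add_outerPart hs₀ hs₁ hδ hφ hw]

lemma bddBelow_range_dirLap (hs₀ : 0 < s) (hs₁ : s < 1) (hδ : 0 < δ) (hφ : ContDiff ℝ 2 φ)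
    (hw : IsLineBounded w) (x : EuclideanSpace ℝ (Fin N)) :
    BddBelow (range fun z : Metric.sphere (0 : EuclideanSpace ℝ (Fin N)) 1 =>
      dirLap s δ φ w x z (w x)) := by
  set R := max (max ‖x‖ 1) |w x| with hR
  obtain ⟨C, hC⟩ := exists_abs_dirLapIntegrand_le hφ hw R δ
  refine ⟨∫ t, -(C * kernelProfile δ t) ∂kernelMeasure s, ?_⟩
  rintro _ ⟨z, rfl⟩
  refine integral_kernelMeasure_mono ((integrable_kernelProfile hs₀ hs₁ hδ).const_mul C).neg
    (integrable_dirLapIntegrand hs₀ hs₁ hδ hφ hw x z (w x)) fun t ht => ?_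
  exact (abs_le.1 (hC x z (w x) t (by simp [hR]) (by simp [hR]) (by simp [hR]) ht)).1

variable [Nontrivial (EuclideanSpace ℝ (Fin N))]

lemma evalE_nonpos_iff (hs₀ : 0 < s) (hs₁ : s < 1) (hδ : 0 < δ) (hφ : ContDiff ℝ 2 φ)
    (hw : IsLineBounded w) (x : EuclideanSpace ℝ (Fin N)) :
    evalE s δ w φ x ≤ 0 ↔
      ∀ z : EuclideanSpace ℝ (Fin N), ‖z‖ = 1 → 0 ≤ dirLap s δ φ w x z (w x) := by
  rw [evalE_eq_neg_iInf_dirLap hs₀ hs₁ hδ hφ hw, neg_nonpos]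
  have : Nonempty (Metric.sphere (0 : EuclideanSpace ℝ (Fin N)) 1) :=
    (NormedSpace.sphere_nonempty.2 zero_le_one).to_subtype
  rw [le_ciInf_iff (bddBelow_range_dirLap hs₀ hs₁ hδ hφ hw x)]
  simp

lemma evalE_nonneg_iff (hs₀ : 0 < s) (hs₁ : s < 1) (hδ : 0 < δ) (hφ : ContDiff ℝ 2 φ)
    (hw : IsLineBounded w) (x : EuclideanSpace ℝ (Fin N)) :
    0 ≤ evalE s δ w φ x ↔ ∀ c : ℝ, 0 < c →
      ∃ z : EuclideanSpace ℝ (Fin N), ‖z‖ = 1 ∧ dirLap s δ φ w x z (w x) < c := by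
  rw [evalE_eq_neg_iInf_dirLap hs₀ hs₁ hδ hφ hw, neg_nonneg]
  have : Nonempty (Metric.sphere (0 : EuclideanSpace ℝ (Fin N)) 1) :=
    (NormedSpace.sphere_nonempty.2 zero_le_one).to_subtype
  rw [← forall_gt_iff_le]
  simp [ciInf_lt_iff (bddBelow_range_dirLap hs₀ hs₁ hδ hφ hw x)]

end Evaluation

section Extension

variable {N : ℕ} {Ω : Set (EuclideanSpace ℝ (Fin N))} {g u : EuclideanSpace ℝ (Fin N) → ℝ}

lemma upperExt_of_mem {x : EuclideanSpace ℝ (Fin N)} (hx : x ∈ Ω) : upperExt Ω g u x = u x :=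
  if_pos hx

lemma upperExt_of_notMem (hΩ : IsOpen Ω) (h : ∀ x ∉ closure Ω, u x ≤ g x)
    {x : EuclideanSpace ℝ (Fin N)} (hx : x ∉ Ω) : upperExt Ω g u x = max (u x) (g x) := by
  rw [upperExt, if_neg hx]
  split_ifs with hf
  · rfl
  · rw [hΩ.frontier_eq] at hf
    exact (max_eq_right (h x fun hc => hf ⟨hc, hx⟩)).symm

lemma upperExt_of_notMem_closure (hΩ : IsOpen Ω) (h : ∀ x ∉ closure Ω, u x ≤ g x)
    {x : EuclideanSpace ℝ (Fin N)} (hx : x ∉ closure Ω) : upperExt Ω g u x = g x := by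
  rw [upperExt_of_notMem hΩ h fun hxΩ => hx (subset_closure hxΩ), max_eq_right (h x hx)]

lemma upperExt_of_mem_or_lt {x : EuclideanSpace ℝ (Fin N)}
    (hx : x ∈ Ω ∨ x ∈ frontier Ω ∧ g x < upperExt Ω g u x) : upperExt Ω g u x = u x := by
  by_cases hxΩ : x ∈ Ω
  · exact upperExt_of_mem hxΩ
  obtain ⟨hf, hlt⟩ := hx.resolve_left hxΩ
  simp only [upperExt, if_neg hxΩ, if_pos hf, lt_max_iff, lt_self_iff_false, or_false] at hlt ⊢
  exact max_eq_left hlt.le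

lemma upperExt_eq_self (h : ∀ x ∉ Ω, u x = g x) : upperExt Ω g u = u := by
  ext x
  by_cases hx : x ∈ Ω
  · exact upperExt_of_mem hx
  · simp [upperExt, hx, h x hx]

lemma le_upperExt (hΩ : IsOpen Ω) (h : ∀ x ∉ closure Ω, u x ≤ g x)
    (x : EuclideanSpace ℝ (Fin N)) : u x ≤ upperExt Ω g u x := by
  by_cases hx : x ∈ Ω
  · rw [upperExt_of_mem hx]
  · rw [upperExt_of_notMem hΩ h hx]
    exact le_max_left _ _

lemma upperSemicontinuous_upperExt (hΩ : IsOpen Ω) (hg : ContinuousOn g Ωᶜ)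
    (hu : UpperSemicontinuous u) (h : ∀ x ∉ closure Ω, u x ≤ g x) :
    UpperSemicontinuous (upperExt Ω g u) := by
  intro x c hc
  by_cases hx : x ∈ Ω
  · rw [upperExt_of_mem hx] at hc
    filter_upwards [hΩ.mem_nhds hx, hu x c hc] with y hy hyc
    rwa [upperExt_of_mem hy]
  · rw [upperExt_of_notMem hΩ h hx, max_lt_iff] at hc
    filter_upwards [eventually_nhdsWithin_iff.1 ((hg x hx).eventually (gt_mem_nhds hc.2)),
      hu x c hc.1] with y hgy huy
    by_cases hy : y ∈ Ω
    · rwa [upperExt_of_mem hy]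
    · rw [upperExt_of_notMem hΩ h hy]
      exact max_lt huy (hgy hy)

lemma exists_bound_upperExt (hg : ∃ M : ℝ, ∀ x ∈ Ωᶜ, |g x| ≤ M) (hu : ∃ M : ℝ, ∀ x, |u x| ≤ M) :
    ∃ M : ℝ, ∀ x, |upperExt Ω g u x| ≤ M := by
  obtain ⟨⟨M₁, hM₁⟩, M₂, hM₂⟩ := And.intro hg hu
  refine ⟨max M₁ M₂, fun x => ?_⟩
  rw [upperExt]
  split_ifs with hx hf
  · exact (hM₂ x).trans (le_max_right _ _)
  · exact abs_max_le_max_abs_abs.trans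
      (max_le ((hM₂ x).trans (le_max_right _ _)) ((hM₁ x hx).trans (le_max_left _ _)))
  · exact (hM₁ x hx).trans (le_max_left _ _)

lemma lowerExt_eq_neg (Ω : Set (EuclideanSpace ℝ (Fin N))) (g u : EuclideanSpace ℝ (Fin N) → ℝ) :
    lowerExt Ω g u = -upperExt Ω (-g) (-u) := by
  ext x
  simp only [lowerExt, upperExt, Pi.neg_apply]
  split_ifs
  · rw [neg_neg]
  · rw [max_neg_neg, neg_neg]
  · rw [neg_neg]

lemma lowerExt_of_notMem_closure (hΩ : IsOpen Ω) (h : ∀ x ∉ closure Ω, g x ≤ u x)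
    {x : EuclideanSpace ℝ (Fin N)} (hx : x ∉ closure Ω) : lowerExt Ω g u x = g x := by
  rw [lowerExt_eq_neg, Pi.neg_apply, upperExt_of_notMem_closure (g := -g) (u := -u) hΩ
    (fun y hy => neg_le_neg (h y hy)) hx, Pi.neg_apply, neg_neg]

lemma lowerExt_of_mem_or_lt {x : EuclideanSpace ℝ (Fin N)}
    (hx : x ∈ Ω ∨ x ∈ frontier Ω ∧ lowerExt Ω g u x < g x) : lowerExt Ω g u x = u x := by
  rw [lowerExt_eq_neg, Pi.neg_apply] at hx ⊢
  rw [upperExt_of_mem_or_lt (hx.imp_right fun h => ⟨h.1, neg_lt.1 h.2⟩), Pi.neg_apply, neg_neg]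

lemma lowerExt_eq_self (h : ∀ x ∉ Ω, u x = g x) : lowerExt Ω g u = u := by
  rw [lowerExt_eq_neg, upperExt_eq_self fun x hx => by simp [h x hx], neg_neg]

lemma lowerExt_le (hΩ : IsOpen Ω) (h : ∀ x ∉ closure Ω, g x ≤ u x)
    (x : EuclideanSpace ℝ (Fin N)) : lowerExt Ω g u x ≤ u x := by
  rw [lowerExt_eq_neg, Pi.neg_apply, neg_le]
  exact le_upperExt hΩ (fun y hy => neg_le_neg (h y hy)) x

lemma lowerSemicontinuous_lowerExt (hΩ : IsOpen Ω) (hg : ContinuousOn g Ωᶜ)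
    (hu : LowerSemicontinuous u) (h : ∀ x ∉ closure Ω, g x ≤ u x) :
    LowerSemicontinuous (lowerExt Ω g u) := by
  rw [lowerExt_eq_neg]
  exact lowerSemicontinuous_neg (upperSemicontinuous_upperExt hΩ hg.neg
    (upperSemicontinuous_neg hu) fun x hx => neg_le_neg (h x hx))

lemma exists_bound_lowerExt (hg : ∃ M : ℝ, ∀ x ∈ Ωᶜ, |g x| ≤ M) (hu : ∃ M : ℝ, ∀ x, |u x| ≤ M) :
    ∃ M : ℝ, ∀ x, |lowerExt Ω g u x| ≤ M := by
  rw [lowerExt_eq_neg]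
  simpa using exists_bound_upperExt (Ω := Ω) (g := -g) (u := -u) (by simpa using hg)
    (by simpa using hu)

end Extension

section ViscositySol

variable {N : ℕ} [Nontrivial (EuclideanSpace ℝ (Fin N))] {s : ℝ}
  {Ω : Set (EuclideanSpace ℝ (Fin N))} {g u W : EuclideanSpace ℝ (Fin N) → ℝ}

lemma IsViscositySub.isSubsolOn_upperExt (hs₀ : 0 < s) (hs₁ : s < 1) (hΩ : IsOpen Ω)
    (hu : IsViscositySub s Ω g u) (hL : IsLineBounded (upperExt Ω g u)) :
    IsSubsolOn s {x | x ∈ Ω ∨ x ∈ frontier Ω ∧ g x < upperExt Ω g u x} (upperExt Ω g u) := by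
  refine isSubsolOn_of_forall_norm_eq_one fun x₀ hx₀ φ r hφ hφ₀ hle z δ hδ hz hr => ?_
  have hext : upperExt Ω g u x₀ = u x₀ := upperExt_of_mem_or_lt hx₀
  have hmax : IsMaxOn (fun x => u x - φ x) (Metric.ball x₀ δ) x₀ := fun x hx => by
    have hux := (le_upperExt hΩ hu.exterior x).trans (hle x (Metric.ball_subset_ball hr hx))
    simp only [mem_ofPred_eq]
    linarith
  have hE : evalE s δ (upperExt Ω g u) φ x₀ ≤ 0 := by
    rcases hx₀ with h | ⟨h, hlt⟩
    · exact hu.interior_test δ φ hδ hφ x₀ h hmax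
    · exact (min_le_iff.1 (hu.boundary_test δ φ hδ hφ x₀ h hmax)).resolve_right (by linarith)
  exact (evalE_nonpos_iff hs₀ hs₁ hδ hφ hL x₀).1 hE z hz

lemma IsViscositySuper.isSupersolOn_lowerExt (hs₀ : 0 < s) (hs₁ : s < 1) (hΩ : IsOpen Ω)
    (hu : IsViscositySuper s Ω g u) (hL : IsLineBounded (lowerExt Ω g u)) :
    IsSupersolOn s {x | x ∈ Ω ∨ x ∈ frontier Ω ∧ lowerExt Ω g u x < g x} (lowerExt Ω g u) := by
  intro x₀ hx₀ φ r hφ hφ₀ hle δ hδ hr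
  have hext : lowerExt Ω g u x₀ = u x₀ := lowerExt_of_mem_or_lt hx₀
  have hmin : IsMinOn (fun x => u x - φ x) (Metric.ball x₀ δ) x₀ := fun x hx => by
    have hux := (hle x (Metric.ball_subset_ball hr hx)).trans (lowerExt_le hΩ hu.exterior x)
    simp only [mem_ofPred_eq]
    linarith
  have hE : 0 ≤ evalE s δ (lowerExt Ω g u) φ x₀ := by
    rcases hx₀ with h | ⟨h, hlt⟩
    · exact hu.interior_test δ φ hδ hφ x₀ h hmin
    · exact (le_max_iff.1 (hu.boundary_test δ φ hδ hφ x₀ h hmin)).resolve_right (by linarith)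
  exact (evalE_nonneg_iff hs₀ hs₁ hδ hφ hL x₀).1 hE

lemma isViscositySub_of_isSubsolOn (hs₀ : 0 < s) (hs₁ : s < 1) (hΩ : IsOpen Ω)
    (hW : UpperSemicontinuous W) (hWb : ∃ M : ℝ, ∀ x, |W x| ≤ M) (hWg : ∀ x ∉ Ω, W x = g x)
    (hWs : IsSubsolOn s Ω W) : IsViscositySub s Ω g W where
  bounded := hWb
  usc := hW
  exterior x hx := (hWg x fun h => hx (subset_closure h)).le
  interior_test δ φ hδ hφ x₀ hx₀ hmax := by
    rw [upperExt_eq_self hWg, evalE_nonpos_iff hs₀ hs₁ hδ hφ (.of_upperSemicontinuous hW hWb)]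
    intro z hz
    have hnonneg := hWs x₀ hx₀ (fun y => φ y + (W x₀ - φ x₀)) δ (hφ.add contDiff_const) (by ring)
      (fun x hx => by linarith [show W x - φ x ≤ W x₀ - φ x₀ from hmax hx]) z δ hδ
      (by rw [hz, mul_one])
    rwa [dirLap_add_const] at hnonneg
  boundary_test δ φ _ _ x₀ hx₀ _ := by
    rw [hΩ.frontier_eq] at hx₀
    exact (min_le_right _ _).trans (sub_nonpos.2 (hWg x₀ hx₀.2).le)

lemma isViscositySuper_of_isSupersolOn (hs₀ : 0 < s) (hs₁ : s < 1) (hΩ : IsOpen Ω)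
    (hW : LowerSemicontinuous W) (hWb : ∃ M : ℝ, ∀ x, |W x| ≤ M) (hWg : ∀ x ∉ Ω, W x = g x)
    (hWs : IsSupersolOn s Ω W) : IsViscositySuper s Ω g W where
  bounded := hWb
  lsc := hW
  exterior x hx := (hWg x fun h => hx (subset_closure h)).ge
  interior_test δ φ hδ hφ x₀ hx₀ hmin := by
    rw [lowerExt_eq_self hWg, evalE_nonneg_iff hs₀ hs₁ hδ hφ (.of_lowerSemicontinuous hW hWb)]
    intro c hc
    have hlt := hWs x₀ hx₀ (fun y => φ y + (W x₀ - φ x₀)) δ (hφ.add contDiff_const) (by ring)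
      (fun x hx => by linarith [show W x₀ - φ x₀ ≤ W x - φ x from hmin hx]) δ hδ le_rfl c hc
    simpa only [dirLap_add_const] using hlt
  boundary_test δ φ _ _ x₀ hx₀ _ := by
    rw [hΩ.frontier_eq] at hx₀
    exact (sub_nonneg.2 (hWg x₀ hx₀.2).ge).trans (le_max_right _ _)

lemma isViscositySol_of_continuous (hs₀ : 0 < s) (hs₁ : s < 1) (hΩ : IsOpen Ω) (hW : Continuous W)
    (hWb : ∃ M : ℝ, ∀ x, |W x| ≤ M) (hWg : ∀ x ∉ Ω, W x = g x) (hsub : IsSubsolOn s Ω W)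
    (hsup : IsSupersolOn s Ω W) : IsViscositySol s Ω g W where
  bounded := hWb
  sub := by
    rw [show upperEnv W = W from funext fun x => upperEnv_of_continuousAt hW.continuousAt]
    exact isViscositySub_of_isSubsolOn hs₀ hs₁ hΩ hW.upperSemicontinuous hWb hWg hsub
  super := by
    rw [show lowerEnv W = W from funext fun x => lowerEnv_of_continuousAt hW.continuousAt]
    exact isViscositySuper_of_isSupersolOn hs₀ hs₁ hΩ hW.lowerSemicontinuous hWb hWg hsup

lemma IsViscositySub.le_of_isSupersolOn (hs₀ : 0 < s) (hs₁ : s < 1)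
    (hΩ : IsStrictlyConvexDomain Ω) (hg : ContinuousOn g Ωᶜ) (hgb : ∃ M : ℝ, ∀ x ∈ Ωᶜ, |g x| ≤ M)
    (hu : IsViscositySub s Ω g u) (hW : LowerSemicontinuous W) (hWb : ∃ M : ℝ, ∀ x, |W x| ≤ M)
    (hWg : ∀ x ∉ Ω, g x ≤ W x) (hWs : IsSupersolOn s Ω W) (x : EuclideanSpace ℝ (Fin N)) :
    u x ≤ W x := by
  have hU := upperSemicontinuous_upperExt hΩ.isOpen hg hu.usc hu.exterior
  have hUb := exists_bound_upperExt hgb hu.bounded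
  have hUs := hu.isSubsolOn_upperExt hs₀ hs₁ hΩ.isOpen (.of_upperSemicontinuous hU hUb)
  have hUg := hUs.le_datum hs₀ hs₁ hΩ hg hU hUb fun y hy =>
    (upperExt_of_notMem_closure hΩ.isOpen hu.exterior hy).le
  exact (le_upperExt hΩ.isOpen hu.exterior x).trans
    ((hUs.mono fun y => .inl).le_of_isSupersolOn hs₀ hs₁ hΩ.isOpen hΩ.bounded hU hUb hWs hW hWb
      (fun y hy => (hUg y hy).trans (hWg y hy)) x)

lemma IsViscositySuper.ge_of_isSubsolOn (hs₀ : 0 < s) (hs₁ : s < 1)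
    (hΩ : IsStrictlyConvexDomain Ω) (hg : ContinuousOn g Ωᶜ) (hgb : ∃ M : ℝ, ∀ x ∈ Ωᶜ, |g x| ≤ M)
    (hu : IsViscositySuper s Ω g u) (hW : UpperSemicontinuous W) (hWb : ∃ M : ℝ, ∀ x, |W x| ≤ M)
    (hWg : ∀ x ∉ Ω, W x ≤ g x) (hWs : IsSubsolOn s Ω W) (x : EuclideanSpace ℝ (Fin N)) :
    W x ≤ u x := by
  have hV := lowerSemicontinuous_lowerExt hΩ.isOpen hg hu.lsc hu.exterior
  have hVb := exists_bound_lowerExt hgb hu.bounded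
  have hVs := hu.isSupersolOn_lowerExt hs₀ hs₁ hΩ.isOpen (.of_lowerSemicontinuous hV hVb)
  have hVg := hVs.datum_le hs₀ hs₁ hΩ hg hV hVb fun y hy =>
    (lowerExt_of_notMem_closure hΩ.isOpen hu.exterior hy).ge
  exact (hWs.le_of_isSupersolOn hs₀ hs₁ hΩ.isOpen hΩ.bounded hW hWb (hVs.mono fun y => .inl) hV hVb
    (fun y hy => (hWg y hy).trans (hVg y hy)) x).trans (lowerExt_le hΩ.isOpen hu.exterior x)

lemma IsViscositySol.eq_of_continuous (hs₀ : 0 < s) (hs₁ : s < 1) (hΩ : IsStrictlyConvexDomain Ω)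
    (hg : ContinuousOn g Ωᶜ) (hgb : ∃ M : ℝ, ∀ x ∈ Ωᶜ, |g x| ≤ M) (hu : IsViscositySol s Ω g u)
    (hW : Continuous W) (hWb : ∃ M : ℝ, ∀ x, |W x| ≤ M) (hWg : ∀ x ∉ Ω, W x = g x)
    (hsub : IsSubsolOn s Ω W) (hsup : IsSupersolOn s Ω W) : u = W := by
  obtain ⟨M, hM⟩ := hu.bounded
  ext x
  refine le_antisymm ?_ ?_
  · exact (le_upperEnv (.of_forall hM)).trans (hu.sub.le_of_isSupersolOn hs₀ hs₁ hΩ hg hgb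
      hW.lowerSemicontinuous hWb (fun y hy => (hWg y hy).ge) hsup x)
  · exact (hu.super.ge_of_isSubsolOn hs₀ hs₁ hΩ hg hgb hW.upperSemicontinuous hWb
      (fun y hy => (hWg y hy).le) hsub x).trans (lowerEnv_le hM x)

end ViscositySol

section Envelope

variable {N : ℕ} [Nontrivial (EuclideanSpace ℝ (Fin N))] {s : ℝ}
  {Ω : Set (EuclideanSpace ℝ (Fin N))} {g W : EuclideanSpace ℝ (Fin N) → ℝ}

lemma isGreatest_image_belowDatum (hs₀ : 0 < s) (hs₁ : s < 1) (hΩ : IsStrictlyConvexDomain Ω)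
    (hg : ContinuousOn g Ωᶜ) (hgb : ∃ M : ℝ, ∀ x ∈ Ωᶜ, |g x| ≤ M) (hW : Continuous W)
    (hWb : ∃ M : ℝ, ∀ x, |W x| ≤ M) (hWg : ∀ x ∉ Ω, W x = g x) (hsub : IsSubsolOn s Ω W)
    (hsup : IsSupersolOn s Ω W) (x : EuclideanSpace ℝ (Fin N)) :
    IsGreatest ((fun w : EuclideanSpace ℝ (Fin N) → ℝ => w x) '' belowDatum s Ω g) (W x) := by
  refine ⟨mem_image_of_mem _ (mem_belowDatum hs₀ hs₁ hΩ hW hWb (fun y hy => (hWg y hy).le) hsub),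
    forall_mem_image.2 fun w hw => ?_⟩
  exact le_of_mem_belowDatum hs₀ hs₁ hΩ hg hgb hW hWb hWg hsup hw x

end Envelope

lemma IsStrictlyConvexC2Domain.isStrictlyConvexDomain {N : ℕ}
    {Ω : Set (EuclideanSpace ℝ (Fin N))} (hΩ : IsStrictlyConvexC2Domain Ω) :
    IsStrictlyConvexDomain Ω :=
  ⟨hΩ.isOpen, hΩ.nonempty, hΩ.bounded, hΩ.convex, hΩ.strictConvex⟩

end FracConvex

theorem theorem1p1_general {N : ℕ} (hN : 1 ≤ N) {s : ℝ} (hs₀ : 0 < s) (hs₁ : s < 1)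
    {Ω : Set (EuclideanSpace ℝ (Fin N))} (hΩ : IsStrictlyConvexDomain Ω)
    {g : EuclideanSpace ℝ (Fin N) → ℝ} (hg : ContinuousOn g Ωᶜ)
    (hgb : ∃ M : ℝ, ∀ x ∈ Ωᶜ, |g x| ≤ M) :
    ((∀ x, BddAbove ((fun w : EuclideanSpace ℝ (Fin N) → ℝ => w x) '' belowDatum s Ω g)) ∧
      sConvexEnvelope s Ω g ∈ belowDatum s Ω g) ∧
    ContinuousOn (sConvexEnvelope s Ω g) (closure Ω) ∧
    (∀ x ∈ frontier Ω, sConvexEnvelope s Ω g x = g x) ∧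
    (∀ x ∈ Ωᶜ, sConvexEnvelope s Ω g x = g x) ∧
    IsViscositySol s Ω g (sConvexEnvelope s Ω g) ∧
    ∀ u : EuclideanSpace ℝ (Fin N) → ℝ, IsViscositySol s Ω g u → u = sConvexEnvelope s Ω g := by
  have : Nonempty (Fin N) := ⟨⟨0, hN⟩⟩
  obtain ⟨W, hW, hWb, hWg, hsub, hsup⟩ := exists_solution hs₀ hs₁ hΩ hg hgb
  have hgreatest := isGreatest_image_belowDatum hs₀ hs₁ hΩ hg hgb hW hWb hWg hsub hsup
  have henv : sConvexEnvelope s Ω g = W := funext fun x => (hgreatest x).csSup_eq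
  rw [henv]
  exact ⟨⟨fun x => (hgreatest x).bddAbove,
      mem_belowDatum hs₀ hs₁ hΩ hW hWb (fun x hx => (hWg x hx).le) hsub⟩,
    hW.continuousOn, fun x hx => hWg x (hΩ.isOpen.frontier_eq ▸ hx).2, hWg,
    isViscositySol_of_continuous hs₀ hs₁ hΩ.isOpen hW hWb hWg hsub hsup,
    fun u hu => hu.eq_of_continuous hs₀ hs₁ hΩ hg hgb hW hWb hWg hsub hsup⟩

theorem theorem1p1 {N : ℕ} (hN : 1 ≤ N) {s : ℝ} (hs₀ : 0 < s) (hs₁ : s < 1)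
    {Ω : Set (EuclideanSpace ℝ (Fin N))} (hΩ : IsStrictlyConvexC2Domain Ω)
    {g : EuclideanSpace ℝ (Fin N) → ℝ} (hg : ContinuousOn g Ωᶜ)
    (hgb : ∃ M : ℝ, ∀ x ∈ Ωᶜ, |g x| ≤ M) :
    -- the envelope is well defined: a finite supremum, attained by a member of the class
    ((∀ x, BddAbove ((fun w : EuclideanSpace ℝ (Fin N) → ℝ => w x) '' belowDatum s Ω g)) ∧
      sConvexEnvelope s Ω g ∈ belowDatum s Ω g) ∧
    ContinuousOn (sConvexEnvelope s Ω g) (closure Ω) ∧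
    (∀ x ∈ frontier Ω, sConvexEnvelope s Ω g x = g x) ∧
    -- the envelope is the unique viscosity solution with exterior datum `g`
    (∀ x ∈ Ωᶜ, sConvexEnvelope s Ω g x = g x) ∧
    IsViscositySol s Ω g (sConvexEnvelope s Ω g) ∧
    ∀ u : EuclideanSpace ℝ (Fin N) → ℝ, IsViscositySol s Ω g u → u = sConvexEnvelope s Ω g := by
  exact theorem1p1_general hN hs₀ hs₁ hΩ.isStrictlyConvexDomain hg hgb
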